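/- Model. Bit complexity is Boolean circuit complexity: the number of gates (arbitrary binary Boolean operations) of a Boolean circuit whose inputs and outputs are the bits of the data, and constants; $\mu(N)$ is the least number of gates of a circuit that multiplies two $N$-bit integers. Numbers are given and returned as complex numbers whose real and imaginary parts are fixed-point binary (two's complement) numbers. Write $\lg=\log_2$, let $\|f\|_\infty$ be the maximum modulus of the coefficients of $f\in\mathbb C[x]$, and call $\tilde f$ a $\lambda$-approximation of $f$ if $\|f-\tilde f\|_\infty\le 2^{-\lambda}$. Fan-out process. Let $n\ge 2$, $k=\lceil\lg n\rceil$, let $x_0,\dots,x_{n-1}\in\mathbb C$ and $v\in\mathbb C[x]$ with $\deg v\le n-1$. The supermoduli are $m_j^{(0)}=x-x_j$ for $0\le j<n$, $m_j^{(0)}=1$ for $n\le j<2^k$, and $m_j^{(h+1)}=m_{2j}^{(h)}m_{2j+1}^{(h)}$. The fan-out process computes $r_0^{(k)}=v$ and $r_j^{(h)}=r_{\lfloor j/2\rfloor}^{(h+1)}\bmod m_j^{(h)}$ for $h=k-1,\dots,0$ and $0\le j<2^{k-h}$. Lemma (complexity of the fan-out process). There is an absolute constant $K$ such that the following holds for every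 integer $n\ge2$ and all real numbers $\ell\ge0$, $\tau_1\ge0$, $\rho\ge1$. Put $$\lambda=\ell+2\tau_1\lg n+300(\rho+1)n\lg n .$$ For every fixed-point format of the input (any number of bits, any number of fractional bits) there is a Boolean circuit with at most $$K\,n\,\lg^2 n\;\mu\bigl(\lceil \ell+\tau_1\lg n+\rho\, n\lg n\rceil\bigr)$$ gates such that, whenever $\|v\|_\infty\le2^{\tau_1}$, $|x_i|\le 2^\rho$ for all $i$ (so that all roots of all supermoduli have modulus at most $2^\rho$), and the input consists of a polynomial $\tilde v$ of degree at most $n-1$ that is a $\lambda$-approximation of $v$ and of polynomials $\tilde m_j^{(h)}$ of degree at most $2^h$ that are $\lambda$-approximations of the supermoduli $m_j^{(h)}$ ($0\le h<k$, $0\le j<2^{k-h}$), the circuit outputs polynomials $\tilde r_j^{(h)}$ with $\|r_j^{(h)}-\tilde r_j^{(h)}\|_\infty\le2^{-\ell}$ for all $0\le h<k$ and $0\le j<2^{k-h}$. In short, an $\ell$-approximation of the whole fan-out process costs $O_B\bigl(n\lg^2 n\;\mu(\ell+\tau_1\lg n+\rho\,n\lg n)\bigr)$. -/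

import Mathlib

open Polynomial

/-! ### Boolean complexity

The Boolean (bit) complexity of a map between bit strings is the number of binary Boolean operations
of a straight-line program (equivalently, the number of gates of a Boolean circuit of fan-in two over
the full binary basis) that computes it. -/

/-- `IsWire L f`: the Boolean function `f` of the input bits `x : I → Bool` may be used as an operand
once the functions in `L` are available: it is one of them, or an input bit, or a constant. -/
def IsWire {I : Type} (L : List ((I → Bool) → Bool)) (f : (I → Bool) → Bool) : Prop :=
  f ∈ L ∨ (∃ i : I, f = fun x => x i) ∨ ∃ b : Bool, f = fun _ => b

/-- `L` lists (last gate first) the functions computed by the gates of a Boolean circuit: every gate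
applies a binary Boolean operation to input bits, constants, or values of earlier gates. -/
inductive IsCircuit {I : Type} : List ((I → Bool) → Bool) → Prop
  | nil : IsCircuit []
  | gate (op : Bool → Bool → Bool) {L : List ((I → Bool) → Bool)} {f g : (I → Bool) → Bool} :
      IsCircuit L → IsWire L f → IsWire L g → IsCircuit ((fun x => op (f x) (g x)) :: L)

/-- The map `F` from bit strings indexed by `I` to bit strings indexed by `O` is computed by a Boolean
circuit with at most `s` gates. -/
def ComputableWithGates {I O : Type} (s : ℕ) (F : (I → Bool) → (O → Bool)) : Prop :=
  ∃ L : List ((I → Bool) → Bool), IsCircuit L ∧ L.length ≤ s ∧ ∀ o : O, IsWire L (fun x => F x o)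

theorem IsWire.mono {I : Type} {L L' : List ((I → Bool) → Bool)} {f : (I → Bool) → Bool}
    (h : IsWire L f) (hL : ∀ g ∈ L, g ∈ L') : IsWire L' f := by
  rcases h with h | h | h
  · exact Or.inl (hL _ h)
  · exact Or.inr (Or.inl h)
  · exact Or.inr (Or.inr h)

/-- Any circuit can be extended so as to compute a given function of finitely many input bits. -/
theorem exists_isCircuit_extension {I : Type} [DecidableEq I] (S : Finset I) :
    ∀ (f : (I → Bool) → Bool), (∀ x y : I → Bool, (∀ i ∈ S, x i = y i) → f x = f y) →
      ∀ L : List ((I → Bool) → Bool), IsCircuit L →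
        ∃ L', IsCircuit L' ∧ (∀ g ∈ L, g ∈ L') ∧ IsWire L' f := by
  induction S using Finset.induction_on with
  | empty =>
    intro f hf L hL
    refine ⟨L, hL, fun _ h => h, Or.inr (Or.inr ⟨f fun _ => false, ?_⟩)⟩
    funext x
    exact hf _ _ (by simp)
  | insert a S _ ih =>
    intro f hf L hL
    have key : ∀ b : Bool, ∀ x y : I → Bool, (∀ i ∈ S, x i = y i) →
        f (Function.update x a b) = f (Function.update y a b) := by
      intro b x y hxy
      refine hf _ _ fun i hi => ?_
      by_cases hia : i = a
      · subst hia; simp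
      · simp [hia, hxy i (Finset.mem_of_mem_insert_of_ne hi hia)]
    obtain ⟨L₁, hL₁, hs₁, hw₁⟩ := ih (fun x => f (Function.update x a true)) (key true) L hL
    obtain ⟨L₂, hL₂, hs₂, hw₂⟩ := ih (fun x => f (Function.update x a false)) (key false) L₁ hL₁
    have ha : ∀ M : List ((I → Bool) → Bool), IsWire M (fun x => x a) :=
      fun M => Or.inr (Or.inl ⟨a, rfl⟩)
    have h₃ := IsCircuit.gate and hL₂ (ha L₂) (hw₁.mono hs₂)
    have h₄ := IsCircuit.gate (fun u v => !u && v) h₃ (ha _)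
      (hw₂.mono fun g hg => List.mem_cons_of_mem _ hg)
    have h₅ := IsCircuit.gate or h₄ (Or.inl (List.mem_cons_of_mem _ List.mem_cons_self))
      (Or.inl List.mem_cons_self)
    refine ⟨_, h₅, fun g hg => ?_, Or.inl ?_⟩
    · exact List.mem_cons_of_mem _ (List.mem_cons_of_mem _ (List.mem_cons_of_mem _ (hs₂ g (hs₁ g hg))))
    · refine List.mem_cons.2 (Or.inl ?_)
      funext x
      cases hx : x a
      · have : Function.update x a false = x := by rw [← hx]; exact Function.update_eq_self a x
        simp [this]
      · have : Function.update x a true = x := by rw [← hx]; exact Function.update_eq_self a x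
        simp [this]

/-- Every map between finite bit strings is computed by some circuit, so minimal gate counts are
attained. -/
theorem exists_computableWithGates {I O : Type} [Finite I] [Finite O]
    (F : (I → Bool) → (O → Bool)) : ∃ s : ℕ, ComputableWithGates s F := by
  classical
  have := Fintype.ofFinite I
  have := Fintype.ofFinite O
  have key : ∀ T : Finset O, ∃ L : List ((I → Bool) → Bool), IsCircuit L ∧
      ∀ o ∈ T, IsWire L (fun x => F x o) := by
    intro T
    induction T using Finset.induction_on with
    | empty => exact ⟨[], IsCircuit.nil, by simp⟩
    | insert o T _ ih =>
      obtain ⟨L, hL, hT⟩ := ih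
      obtain ⟨L', hL', hs, hw⟩ := exists_isCircuit_extension Finset.univ (fun x => F x o)
        (fun x y h => by rw [show x = y from funext fun i => h i (Finset.mem_univ i)]) L hL
      refine ⟨L', hL', fun q hq => ?_⟩
      rcases Finset.mem_insert.1 hq with rfl | hq
      · exact hw
      · exact (hT q hq).mono hs
  obtain ⟨L, hL, h⟩ := key Finset.univ
  exact ⟨L.length, L, hL, le_rfl, fun o => h o (Finset.mem_univ o)⟩

/-- The natural number with binary digits `b`, least significant bit first. -/
def natOfBits {N : ℕ} (b : Fin N → Bool) : ℕ :=
  ∑ i : Fin N, (b i).toNat * 2 ^ (i : ℕ)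

/-- Multiplication of two `N`-bit integers, as a map on bits. -/
def mulBits (N : ℕ) (x : Fin 2 × Fin N → Bool) : Fin (2 * N) → Bool :=
  fun i => (natOfBits (fun j => x (0, j)) * natOfBits (fun j => x (1, j))).testBit (i : ℕ)

/-- `mulComplexity N` is the Boolean complexity `μ(N)` of multiplying two `N`-bit integers. -/
noncomputable def mulComplexity (N : ℕ) : ℕ :=
  sInf {s : ℕ | ComputableWithGates s (mulBits N)}

theorem computableWithGates_mulComplexity (N : ℕ) :
    ComputableWithGates (mulComplexity N) (mulBits N) :=
  Nat.sInf_mem (exists_computableWithGates (mulBits N))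

/-! ### Fixed-point numbers and polynomials -/

/-- The real number with the `w`-bit two's complement fixed-point representation `b` (least significant
bit first), `p` of whose bits are fractional. -/
noncomputable def realOfBits (p : ℕ) {w : ℕ} (b : Fin w → Bool) : ℝ :=
  (∑ i : Fin w, if b i then (if (i : ℕ) + 1 = w then -(2 : ℝ) ^ (i : ℕ) else 2 ^ (i : ℕ)) else 0)
    / 2 ^ p

/-- The complex number with the given fixed-point real and imaginary parts. -/
noncomputable def complexOfBits (p : ℕ) {w : ℕ} (b : Fin 2 × Fin w → Bool) : ℂ :=
  ⟨realOfBits p fun i => b (0, i), realOfBits p fun i => b (1, i)⟩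

/-- The polynomial of degree less than `d` with the given fixed-point complex coefficients. -/
noncomputable def polyOfBits (p : ℕ) {w d : ℕ} (b : Fin d × Fin 2 × Fin w → Bool) : ℂ[X] :=
  ∑ i : Fin d, C (complexOfBits p fun t => b (i, t)) * X ^ (i : ℕ)

/-! ### The remainder tree -/

/-- The supermodulus `m_j^{(h)}` produced by the fan-in process from the knots `x₀, …, x_{n-1}`:
the leaves are `X - x_j` for `j < n`, padded with ones. -/
noncomputable def supermodulus {n : ℕ} (x : Fin n → ℂ) : ℕ → ℕ → ℂ[X]
  | 0, j => if hj : j < n then X - C (x ⟨j, hj⟩) else 1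
  | h + 1, j => supermodulus x h (2 * j) * supermodulus x h (2 * j + 1)

/-- The remainders at depth `d` below the root of the tree of height `k`, i.e. at level `k - d`. -/
noncomputable def fanOutAtDepth {n : ℕ} (x : Fin n → ℂ) (v : ℂ[X]) (k : ℕ) : ℕ → ℕ → ℂ[X]
  | 0, _ => v
  | d + 1, j => fanOutAtDepth x v k d (j / 2) % supermodulus x (k - (d + 1)) j

/-- The remainder `r_j^{(h)}` of the fan-out process in the tree of height `k`:
`r_0^{(k)} = v` and `r_j^{(h)} = r_{⌊j/2⌋}^{(h+1)} mod m_j^{(h)}` for `h < k`. -/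
noncomputable def fanOut {n : ℕ} (x : Fin n → ℂ) (v : ℂ[X]) (k h j : ℕ) : ℂ[X] :=
  fanOutAtDepth x v k (k - h) j

/-- The nodes `(h, j)`, `0 ≤ h < k`, `0 ≤ j < 2^(k-h)`, of the tree of height `k`, without the root. -/
abbrev Node (k : ℕ) : Type := Σ h : Fin k, Fin (2 ^ (k - (h : ℕ)))

/-- Input bits: `n` coefficients for `v`, and `2^h + 1` coefficients for the supermodulus at each node
of level `h`, every coefficient being a complex number of `2 * w` bits. -/
abbrev FanOutInput (n k w : ℕ) : Type :=
  (Fin n × Fin 2 × Fin w) ⊕ (Σ t : Node k, Fin (2 ^ (t.1 : ℕ) + 1) × Fin 2 × Fin w)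

/-- Output bits: `2^h` coefficients for the remainder at each node of level `h`. -/
abbrev FanOutOutput (k w : ℕ) : Type :=
  Σ t : Node k, Fin (2 ^ (t.1 : ℕ)) × Fin 2 × Fin w

/-! Scaling makes the process well conditioned. Substituting `2 ^ σ * X` for `X`, with `σ` a little
larger than `ρ + lg n`, divides every knot by `2 ^ σ`, so that all knots have modulus at most some
`a` with `2 ^ k * a ≤ 1 / 4`. A product of at most `2 ^ k` linear factors then has `ℓ¹` norm at most
`(1 + a) ^ 2 ^ k ≤ exp (1 / 4) ≤ 3 / 2`. Hence each scaled supermodulus is `X ^ d + m'` with `l1 m'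
≤ 1 / 2` (`l1_lowPart_supermodulus_le`), and its reversal `1 + u` has a power series inverse of norm
at most 2 (`exists_inverse_mod_X_pow`). A division therefore at most doubles the norm and multiplies
the error of the dividend by 4, up to additive terms (`divMod_error`). The `ℓ¹` norm suits this
because it is submultiplicative, invariant under reversal and not increased by truncation.

Over the `k` levels the error grows by at most `5 ^ k`, and Newton inversion loses a factor `9 ^ k`
(`newton_error`), that is, `O(lg n)` bits each. Scaling costs `σ * n` bits in the coefficients of
`v`, whereas the lower coefficients of the supermoduli only shrink. Scaling commutes with taking
remainders (`fanOutAtDepth_comp`), and it is undone by an exact shift that does not increase errors.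
The prescribed input precision covers all these losses (`fanOut_loss_le`).

For the cost, integer polynomials are multiplied over `ZMod (2 ^ M + 1)`, where `2 ^ M = -1`, so
that products with powers of two are rotations of bit strings. The factorization of `X ^ (2 * T) - 2
^ (2 * e)` into `X ^ T - 2 ^ e` and `X ^ T - 2 ^ (e + M)` gives a recursive multiplication of
polynomials with `2 ^ t` coefficients in `O(t * 2 ^ t)` coefficient operations
(`exists_cyc_polyMul`). Newton inversion and division keep this order, a level of the tree costs
`O(k * 2 ^ k * μ(2 * M))`, and there are `k` levels (`exists_fanOutCircuit`). Since `M` is at most a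
constant multiple of the nominal precision `N` (`fanOut_precision_le`), the doubling bound
`mulComplexity_two_mul_le` replaces `μ(2 * M)` by a constant times `μ(N)`, and
`le_two_mul_mulComplexity` absorbs all overhead linear in `M`.

An integer depending on the input is represented by the wires of its two's complement bits, so
shifts, constants and sign extension need no gates. The circuits exist unconditionally; size and
accuracy hypotheses on the data enter only the error statements. -/

/-! ### Computing sets of Boolean functions from sets of Boolean functions -/

/-- Every circuit that has the functions in `S` as wires can be extended by at most `s` gates to a
circuit that has the functions in `T` as wires. -/
def Computes {I : Type} (s : ℕ) (S T : Set ((I → Bool) → Bool)) : Prop :=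
  ∀ L : List ((I → Bool) → Bool), IsCircuit L → (∀ f ∈ S, IsWire L f) →
    ∃ L', IsCircuit L' ∧ (∀ g ∈ L, g ∈ L') ∧ L'.length ≤ L.length + s ∧ ∀ f ∈ T, IsWire L' f

namespace Computes

variable {I : Type} {s t : ℕ} {S T U S' T' : Set ((I → Bool) → Bool)}

theorem of_free (h : ∀ f ∈ T, f ∈ S ∨ ∃ b : Bool, f = fun _ => b) : Computes 0 S T :=
  fun L hL hS => ⟨L, hL, fun _ h => h, le_rfl, fun f hf => (h f hf).elim (hS f)
    fun hb => Or.inr (Or.inr hb)⟩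

theorem of_subset (h : T ⊆ S) : Computes 0 S T := of_free fun _ hf => Or.inl (h hf)

theorem mono (h : Computes s S T) (hs : s ≤ t) (hS : S ⊆ S') (hT : T' ⊆ T) :
    Computes t S' T' := fun L hL hw => by
  obtain ⟨L', h1, h2, h3, h4⟩ := h L hL fun f hf => hw f (hS hf)
  exact ⟨L', h1, h2, by omega, fun f hf => h4 f (hT hf)⟩

theorem mono_left (h : Computes s S T) (hS : S ⊆ S') : Computes s S' T :=
  h.mono le_rfl hS subset_rfl

theorem mono_right (h : Computes s S T) (hT : T' ⊆ T) : Computes s S T' :=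
  h.mono le_rfl subset_rfl hT

theorem mono_cost (h : Computes s S T) (hs : s ≤ t) : Computes t S T :=
  h.mono hs subset_rfl subset_rfl

/-- Circuits only grow, so wires once obtained stay available. A value shared by several later
computations is therefore paid for once. -/
theorem bind (h : Computes s S T) (h' : Computes t (S ∪ T) U) :
    Computes (s + t) S (T ∪ U) := fun L hL hw => by
  obtain ⟨L₁, h1, h2, h3, h4⟩ := h L hL hw
  obtain ⟨L₂, k1, k2, k3, k4⟩ := h' L₁ h1 fun f hf =>
    hf.elim (fun hf => (hw f hf).mono h2) (h4 f)
  exact ⟨L₂, k1, fun g hg => k2 g (h2 g hg), by omega, fun f hf =>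
    hf.elim (fun hf => (h4 f hf).mono k2) (k4 f)⟩

theorem trans (h : Computes s S T) (h' : Computes t T U) : Computes (s + t) S U :=
  (h.bind (h'.mono_left Set.subset_union_right)).mono_right Set.subset_union_right

theorem trans' (h : Computes s S T) (h' : Computes t (S ∪ T) U) : Computes (s + t) S U :=
  (h.bind h').mono_right Set.subset_union_right

theorem union (h : Computes s S T) (h' : Computes t S U) : Computes (s + t) S (T ∪ U) :=
  h.bind (h'.mono_left Set.subset_union_left)

theorem gate (op : Bool → Bool → Bool) {f g : (I → Bool) → Bool} (hf : f ∈ S) (hg : g ∈ S) :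
    Computes 1 S {fun x => op (f x) (g x)} := fun L hL hw =>
  ⟨_, IsCircuit.gate op hL (hw f hf) (hw g hg), fun _ h => List.mem_cons_of_mem _ h, le_rfl,
    fun f hf => Or.inl (by rw [Set.mem_singleton_iff.1 hf]; exact List.mem_cons_self)⟩

theorem biUnion_finset {α : Type*} (A : Finset α) (c : α → ℕ)
    (T : α → Set ((I → Bool) → Bool)) (h : ∀ a ∈ A, Computes (c a) S (T a)) :
    Computes (∑ a ∈ A, c a) S (⋃ a ∈ A, T a) := by
  classical
  induction A using Finset.induction_on with
  | empty => exact of_subset (by simp)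
  | insert a A ha ih =>
    rw [Finset.sum_insert ha, Finset.set_biUnion_insert]
    exact (h a (Finset.mem_insert_self a A)).union
      (ih fun b hb => h b (Finset.mem_insert_of_mem hb))

theorem iUnion_lt (d c : ℕ) (T : ℕ → Set ((I → Bool) → Bool))
    (h : ∀ i < d, Computes c S (T i)) : Computes (d * c) S (⋃ i, ⋃ _ : i < d, T i) := by
  have := biUnion_finset (S := S) (Finset.range d) (fun _ => c) T
    fun i hi => h i (Finset.mem_range.1 hi)
  simpa using this

/-- Substitution of wires for the inputs of a circuit. -/
theorem of_computableWithGates {J O : Type} {F : (J → Bool) → (O → Bool)}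
    (hF : ComputableWithGates s F) (φ : J → (I → Bool) → Bool) (hφ : ∀ j, φ j ∈ S) :
    Computes s S (Set.range fun (o : O) (x : I → Bool) => F (fun j => φ j x) o) := by
  intro L hL hw
  obtain ⟨L₀, h1, h2, h3⟩ := hF
  have key : ∀ f, IsWire L₀ f → IsWire ((L₀.map fun f x => f fun j => φ j x) ++ L)
      (fun x => f fun j => φ j x) := by
    rintro f (h | ⟨j, rfl⟩ | ⟨b, rfl⟩)
    · exact Or.inl (List.mem_append_left _ (List.mem_map.2 ⟨f, h, rfl⟩))
    · exact (hw _ (hφ j)).mono fun g hg => List.mem_append_right _ hg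
    · exact Or.inr (Or.inr ⟨b, rfl⟩)
  refine ⟨(L₀.map fun f x => f fun j => φ j x) ++ L, ?_,
    fun g hg => List.mem_append_right _ hg, by simp; omega, ?_⟩
  · clear h2 h3
    induction h1 with
    | nil => exact hL
    | @gate op L₁ f g hL₁ hf hg ih =>
      -- The induction hypothesis asks for the substitution property of the shorter gate list, so it
      -- is proved again there.
      have aux : ∀ f, IsWire L₁ f → IsWire ((L₁.map fun f x => f fun j => φ j x) ++ L)
          (fun x => f fun j => φ j x) := by
        rintro f (h | ⟨j, rfl⟩ | ⟨b, rfl⟩)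
        · exact Or.inl (List.mem_append_left _ (List.mem_map.2 ⟨f, h, rfl⟩))
        · exact (hw _ (hφ j)).mono fun g hg => List.mem_append_right _ hg
        · exact Or.inr (Or.inr ⟨b, rfl⟩)
      refine IsCircuit.gate op (ih ?_) (aux f hf) (aux g hg)
      exact aux
  · rintro _ ⟨o, rfl⟩
    exact key _ (h3 o)

theorem computableWithGates {O : Type} {F : (I → Bool) → (O → Bool)}
    (h : Computes s {f | ∃ i : I, f = fun x => x i} (Set.range fun o x => F x o)) :
    ComputableWithGates s F := by
  obtain ⟨L, h1, _, h3, h4⟩ := h [] IsCircuit.nil fun f hf => Or.inr (Or.inl hf)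
  exact ⟨L, h1, by simpa using h3, fun o => h4 _ ⟨o, rfl⟩⟩

end Computes

/-! ### Bits of integers in two's complement -/

/-- The bit of weight `2 ^ i` of an integer in (infinite) two's complement. -/
def ibit (z : ℤ) (i : ℕ) : Bool := decide (z / 2 ^ i % 2 = 1)

theorem ibit_toInt (z : ℤ) (i : ℕ) : ((ibit z i).toInt : ℤ) = z / 2 ^ i % 2 := by
  unfold ibit
  rcases Int.emod_two_eq_zero_or_one (z / 2 ^ i) with h | h <;> simp [h]

/-- Bits are handled through this recursion on residues rather than through quotients; it holds for
negative integers too, as division rounds down. -/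
theorem emod_two_pow_succ (z : ℤ) (i : ℕ) :
    z % 2 ^ (i + 1) = z % 2 ^ i + 2 ^ i * (ibit z i).toInt := by
  rw [ibit_toInt, pow_succ, Int.emod_def, Int.emod_def, Int.emod_def,
    ← Int.ediv_ediv_of_nonneg (by positivity)]
  ring

theorem ibit_congr {W i : ℕ} {z z' : ℤ} (h : z % 2 ^ W = z' % 2 ^ W) (hi : i < W) :
    ibit z i = ibit z' i := by
  have h1 : z % 2 ^ (i + 1) = z' % 2 ^ (i + 1) := by
    have hd : (2 : ℤ) ^ (i + 1) ∣ 2 ^ W := pow_dvd_pow 2 hi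
    rw [← Int.emod_emod_of_dvd z hd, h, Int.emod_emod_of_dvd z' hd]
  have h0 : z % 2 ^ i = z' % 2 ^ i := by
    have hd : (2 : ℤ) ^ i ∣ 2 ^ W := pow_dvd_pow 2 hi.le
    rw [← Int.emod_emod_of_dvd z hd, h, Int.emod_emod_of_dvd z' hd]
  rw [emod_two_pow_succ, emod_two_pow_succ, h0] at h1
  have h2 : (ibit z i).toInt = (ibit z' i).toInt :=
    mul_left_cancel₀ (by positivity : (2 : ℤ) ^ i ≠ 0) (add_left_cancel h1)
  revert h2
  cases ibit z i <;> cases ibit z' i <;> simp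

theorem emod_eq_of_ibit {W : ℕ} {z z' : ℤ} (h : ∀ i < W, ibit z i = ibit z' i) :
    z % 2 ^ W = z' % 2 ^ W := by
  induction W with
  | zero => simp
  | succ W ih =>
    rw [emod_two_pow_succ, emod_two_pow_succ, ih fun i hi => h i (by omega), h W (by omega)]

theorem ibit_ediv (z : ℤ) (s i : ℕ) : ibit (z / 2 ^ s) i = ibit z (s + i) := by
  unfold ibit
  rw [Int.ediv_ediv_of_nonneg (by positivity), ← pow_add]

theorem ibit_mul_pow_of_lt (z : ℤ) {s i : ℕ} (h : i < s) : ibit (z * 2 ^ s) i = false := by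
  rw [ibit_congr (W := s) (z' := 0) (by simp) h]
  simp [ibit]

theorem ibit_mul_pow (z : ℤ) (s i : ℕ) : ibit (z * 2 ^ s) (s + i) = ibit z i := by
  rw [← ibit_ediv, Int.mul_ediv_cancel _ (by positivity)]

theorem ibit_of_lt {z : ℤ} {W i : ℕ} (h0 : 0 ≤ z) (h : z < 2 ^ W) (hi : W ≤ i) :
    ibit z i = false := by
  have : z / 2 ^ i = 0 :=
    Int.ediv_eq_zero_of_lt h0 (h.trans_le (pow_le_pow_right₀ (by norm_num) hi))
  simp [ibit, this]

/-- For a negative number in range the rounded-down quotient is `-1`, which is odd. -/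
theorem ibit_sign {z : ℤ} {W i : ℕ} (h0 : -2 ^ W ≤ z) (h : z < 2 ^ W) (hi : W ≤ i) :
    ibit z i = decide (z < 0) := by
  have hp : (2 : ℤ) ^ W ≤ 2 ^ i := pow_le_pow_right₀ (by norm_num) hi
  by_cases hz : z < 0
  · have : z / 2 ^ i = -1 := by
      rw [Int.ediv_eq_iff_of_pos (by positivity)]
      constructor <;> linarith
    simp [ibit, this, hz]
  · simp only [hz, decide_false]
    exact ibit_of_lt (not_lt.1 hz) h hi

/-- Complementing all bits turns subtraction into addition with an initial carry. -/
theorem ibit_lnot (z : ℤ) (i : ℕ) : ibit (-z - 1) i = !ibit z i := by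
  have h : (-z - 1) / 2 ^ i = -(z / 2 ^ i) - 1 := by
    have hp : (0 : ℤ) < 2 ^ i := by positivity
    have h1 := Int.emod_add_mul_ediv z (2 ^ i)
    have h2 := Int.emod_nonneg z hp.ne'
    have h3 := Int.emod_lt_of_pos z hp
    rw [Int.ediv_eq_iff_of_pos hp]
    constructor <;> nlinarith
  unfold ibit
  rw [h]
  rcases Int.emod_two_eq_zero_or_one (z / 2 ^ i) with h | h
  · simp [h]; omega
  · simp [h]; omega

theorem sum_ibit (z : ℤ) (W : ℕ) :
    ∑ i ∈ Finset.range W, (ibit z i).toInt * 2 ^ i = z % 2 ^ W := by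
  induction W with
  | zero => simp
  | succ W ih => rw [Finset.sum_range_succ, ih, emod_two_pow_succ]; ring

/-- The `W` low order bits of an integer that depends on the input. -/
def bits {I : Type} (W : ℕ) (X : (I → Bool) → ℤ) : Set ((I → Bool) → Bool) :=
  {f | ∃ i < W, f = fun x => ibit (X x) i}

section
variable {I : Type} {W W' : ℕ} {X Y : (I → Bool) → ℤ}

theorem mem_bits {i : ℕ} (h : i < W) : (fun x => ibit (X x) i) ∈ bits W X := ⟨i, h, rfl⟩

theorem bits_mono (h : W ≤ W') : bits W X ⊆ bits W' X := by
  rintro f ⟨i, hi, rfl⟩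
  exact mem_bits (by omega)

theorem bits_congr (h : ∀ x, X x % 2 ^ W = Y x % 2 ^ W) : bits W X = bits W Y := by
  ext f
  constructor <;> rintro ⟨i, hi, rfl⟩ <;> refine ⟨i, hi, funext fun x => ?_⟩
  · exact ibit_congr (h x) hi
  · exact (ibit_congr (h x) hi).symm

theorem bits_ediv_subset (s : ℕ) : bits W (fun x => X x / 2 ^ s) ⊆ bits (s + W) X := by
  rintro f ⟨i, hi, rfl⟩
  exact ⟨s + i, by omega, funext fun x => ibit_ediv _ _ _⟩

theorem Computes.const (z : ℤ) (S : Set ((I → Bool) → Bool)) : Computes 0 S (bits W fun _ => z) :=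
  Computes.of_free <| by
    rintro f ⟨i, _, rfl⟩
    exact Or.inr ⟨_, rfl⟩

theorem Computes.mul_pow (s : ℕ) : Computes 0 (bits W X) (bits (s + W) fun x => X x * 2 ^ s) :=
  Computes.of_free <| by
    rintro f ⟨i, hi, rfl⟩
    by_cases h : i < s
    · exact Or.inr ⟨false, funext fun x => ibit_mul_pow_of_lt _ h⟩
    · obtain ⟨j, rfl⟩ := Nat.exists_eq_add_of_le (not_lt.1 h)
      exact Or.inl ⟨j, by omega, funext fun x => ibit_mul_pow _ _ _⟩

theorem Computes.zero_ext (h : ∀ x, 0 ≤ X x ∧ X x < 2 ^ W) :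
    Computes 0 (bits W X) (bits W' X) := Computes.of_free <| by
  rintro f ⟨i, hi, rfl⟩
  by_cases hW : i < W
  · exact Or.inl (mem_bits hW)
  · exact Or.inr ⟨false, funext fun x => ibit_of_lt (h x).1 (h x).2 (not_lt.1 hW)⟩

/-- All higher bits are copies of the bit at position `W`, so widening to any `W'` needs no gates.
-/
theorem bits_sign_ext (h : ∀ x, -2 ^ W ≤ X x ∧ X x < 2 ^ W) :
    bits W' X ⊆ bits (W + 1) X := by
  rintro f ⟨i, hi, rfl⟩
  by_cases hW : i < W
  · exact mem_bits (by omega)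
  · refine ⟨W, by omega, funext fun x => ?_⟩
    rw [ibit_sign (h x).1 (h x).2 (not_lt.1 hW), ibit_sign (h x).1 (h x).2 le_rfl]

/-! ### Ripple-carry addition and subtraction. -/

/-- The carry into position `i` in the addition `x + y + c`. -/
def carryBit (c : Bool) (x y : ℤ) (i : ℕ) : Bool :=
  decide (2 ^ i ≤ x % 2 ^ i + y % 2 ^ i + c.toInt)

/-- Two residues and a carry add up to less than `2 * 2 ^ i`, so at most one multiple of `2 ^ i` is
removed. -/
theorem add_emod_carry (c : Bool) (x y : ℤ) (i : ℕ) :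
    (x + y + c.toInt) % 2 ^ i + 2 ^ i * (carryBit c x y i).toInt =
      x % 2 ^ i + y % 2 ^ i + c.toInt := by
  have hp : (0 : ℤ) < 2 ^ i := by positivity
  have hx := Int.emod_nonneg x hp.ne'
  have hx' := Int.emod_lt_of_pos x hp
  have hy := Int.emod_nonneg y hp.ne'
  have hy' := Int.emod_lt_of_pos y hp
  have hc : 0 ≤ c.toInt ∧ c.toInt ≤ 1 := by cases c <;> simp
  have e : (x + y + c.toInt) % 2 ^ i = (x % 2 ^ i + y % 2 ^ i + c.toInt) % 2 ^ i := by
    simp [Int.add_emod]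
  rw [e]
  unfold carryBit
  by_cases h : 2 ^ i ≤ x % 2 ^ i + y % 2 ^ i + c.toInt
  · have : (x % 2 ^ i + y % 2 ^ i + c.toInt) % 2 ^ i =
        x % 2 ^ i + y % 2 ^ i + c.toInt - 2 ^ i := by
      rw [← Int.sub_emod_right]
      exact Int.emod_eq_of_lt (by linarith) (by linarith)
    rw [this]
    simp [h]
  · rw [Int.emod_eq_of_lt (by linarith) (by linarith)]
    simp [h]

/-- Subtracting the carry identities for `i` and `i + 1` and cancelling `2 ^ i` leaves `sum + 2 *
carryOut = x + y + carryIn` in single bits, which is decided by cases. -/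
theorem adder_step (c : Bool) (x y : ℤ) (i : ℕ) :
    ibit (x + y + c.toInt) i = ((ibit x i ^^ ibit y i) ^^ carryBit c x y i) ∧
    carryBit c x y (i + 1) =
      ((ibit x i && ibit y i) || (carryBit c x y i && (ibit x i ^^ ibit y i))) := by
  have h0 := add_emod_carry c x y i
  have h1 := add_emod_carry c x y (i + 1)
  rw [emod_two_pow_succ, emod_two_pow_succ, emod_two_pow_succ, pow_succ] at h1
  have hp : (2 : ℤ) ^ i ≠ 0 := by positivity
  have h2 : (ibit (x + y + c.toInt) i).toInt + 2 * (carryBit c x y (i + 1)).toInt =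
      (ibit x i).toInt + (ibit y i).toInt + (carryBit c x y i).toInt := by
    apply mul_left_cancel₀ hp
    linear_combination h1 - h0
  revert h2
  cases ibit (x + y + c.toInt) i <;> cases carryBit c x y (i + 1) <;> cases ibit x i <;>
    cases ibit y i <;> cases carryBit c x y i <;> simp

/-- Ripple carry adder and subtractor: `X + Y` or `X - Y` modulo `2 ^ W`. -/
theorem Computes.addSub (b : Bool) (W : ℕ) (X Y : (I → Bool) → ℤ) :
    Computes (5 * W) (bits W X ∪ bits W Y) (bits W fun x => X x + if b then -Y x else Y x) := by
  -- Subtraction is `X + (-Y - 1) + 1`: complement the second operand and start with carry one.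
  set Y' : (I → Bool) → ℤ := fun x => if b then -Y x - 1 else Y x with hY'
  have hbit : ∀ x i, ibit (Y' x) i = (ibit (Y x) i ^^ b) := by
    intro x i
    cases b <;> simp [hY', ibit_lnot]
  have hZ : (fun x => X x + if b then -Y x else Y x) = fun x => X x + Y' x + b.toInt := by
    funext x
    cases b <;> simp [hY']
    ring
  rw [hZ]
  have key : ∀ V, V ≤ W → Computes (5 * V) (bits W X ∪ bits W Y)
      (bits V (fun x => X x + Y' x + b.toInt) ∪ {fun x => carryBit b (X x) (Y' x) V}) := by
    intro V
    induction V with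
    | zero =>
      intro _
      refine Computes.of_free ?_
      rintro f (⟨i, hi, rfl⟩ | hf)
      · omega
      · exact Or.inr ⟨carryBit b 0 0 0, by rw [Set.mem_singleton_iff.1 hf]; simp [carryBit]⟩
    | succ V ih =>
      intro hV
      have hx : (fun x => ibit (X x) V) ∈ bits W X := mem_bits hV
      have hy : (fun x => ibit (Y x) V) ∈ bits W Y := mem_bits hV
      set S := bits W X ∪ bits W Y
      set T := bits V (fun x => X x + Y' x + b.toInt) ∪ {fun x => carryBit b (X x) (Y' x) V}
      -- Five gates per position. Complementing the second operand is free, since it is absorbed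
      -- into the binary operation of the gate.
      have g1 : Computes 1 (S ∪ T) {fun x => ibit (X x) V ^^ ibit (Y' x) V} := by
        have := Computes.gate (S := S ∪ T) (fun p q => p ^^ (q ^^ b)) (Or.inl (Or.inl hx))
          (Or.inl (Or.inr hy))
        simpa only [hbit] using this
      have g2 : Computes 1 (S ∪ T) {fun x => ibit (X x) V && ibit (Y' x) V} := by
        have := Computes.gate (S := S ∪ T) (fun p q => p && (q ^^ b)) (Or.inl (Or.inl hx))
          (Or.inl (Or.inr hy))
        simpa only [hbit] using this
      have g12 := g1.union g2
      set T' : Set ((I → Bool) → Bool) := {fun x => ibit (X x) V ^^ ibit (Y' x) V} ∪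
        {fun x => ibit (X x) V && ibit (Y' x) V}
      have hc : (fun x => carryBit b (X x) (Y' x) V) ∈ (S ∪ T) ∪ T' :=
        Or.inl (Or.inr (Or.inr rfl))
      have g3 := Computes.gate (S := (S ∪ T) ∪ T') (fun p q => p ^^ q) (Or.inr (Or.inl rfl)) hc
      have g4 := Computes.gate (S := (S ∪ T) ∪ T') (fun p q => p && q) hc (Or.inr (Or.inl rfl))
      have g5 := g4.trans' (Computes.gate (fun p q => p || q)
        (Or.inl (Or.inr (Or.inr rfl))) (Or.inr rfl))
      have g := (ih (by omega)).bind (g12.trans' (g3.union g5))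
      refine g.mono (by omega) subset_rfl ?_
      rintro f (⟨i, hi, rfl⟩ | hf)
      · rcases Nat.lt_succ_iff_lt_or_eq.1 hi with hi | rfl
        · exact Or.inl (Or.inl (mem_bits hi))
        · exact Or.inr (Or.inl (funext fun x => (adder_step b (X x) (Y' x) i).1))
      · rw [Set.mem_singleton_iff.1 hf]
        exact Or.inr (Or.inr (funext fun x => (adder_step b (X x) (Y' x) V).2))
  exact (key W le_rfl).mono_right Set.subset_union_left

theorem Computes.add (W : ℕ) (X Y : (I → Bool) → ℤ) :
    Computes (5 * W) (bits W X ∪ bits W Y) (bits W fun x => X x + Y x) := by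
  simpa using Computes.addSub false W X Y

theorem Computes.sub (W : ℕ) (X Y : (I → Bool) → ℤ) :
    Computes (5 * W) (bits W X ∪ bits W Y) (bits W fun x => X x - Y x) := by
  simpa [sub_eq_add_neg] using Computes.addSub true W X Y

end

/-! ### Multiplication and its complexity -/

theorem natOfBits_ibit (z : ℤ) (N : ℕ) :
    ((natOfBits fun j : Fin N => ibit z j : ℕ) : ℤ) = z % 2 ^ N := by
  rw [natOfBits, ← sum_ibit, Finset.sum_range]
  push_cast
  refine Finset.sum_congr rfl fun i _ => ?_
  cases ibit z i <;> simp

theorem ibit_natCast (a i : ℕ) : ibit (a : ℤ) i = a.testBit i := by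
  rw [ibit, Nat.testBit_eq_decide_div_mod_eq]
  congr 1
  apply propext
  norm_cast

/-- Full product of two `N`-bit natural numbers. -/
theorem Computes.mul {I : Type} (N : ℕ) (X Y : (I → Bool) → ℤ)
    (hX : ∀ x, 0 ≤ X x ∧ X x < 2 ^ N) (hY : ∀ x, 0 ≤ Y x ∧ Y x < 2 ^ N) :
    Computes (mulComplexity N) (bits N X ∪ bits N Y) (bits (2 * N) fun x => X x * Y x) := by
  have h := Computes.of_computableWithGates (computableWithGates_mulComplexity N)
    (S := bits N X ∪ bits N Y)
    (fun (j : Fin 2 × Fin N) x => if j.1 = 0 then ibit (X x) j.2 else ibit (Y x) j.2) ?_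
  · refine h.mono_right ?_
    rintro f ⟨i, hi, rfl⟩
    refine ⟨⟨i, hi⟩, funext fun x => ?_⟩
    simp only [mulBits, if_true, one_ne_zero, if_false]
    rw [← ibit_natCast]
    push_cast
    rw [natOfBits_ibit, natOfBits_ibit, Int.emod_eq_of_lt (hX x).1 (hX x).2,
      Int.emod_eq_of_lt (hY x).1 (hY x).2]
  · rintro ⟨j, i⟩
    by_cases hj : j = 0
    · exact Or.inl ⟨i, i.2, by simp [hj]⟩
    · exact Or.inr ⟨i, i.2, by simp [hj]⟩

/-! ### Arithmetic modulo `2 ^ (2 * M) - 1` and multiplication of polynomials modulo `2 ^ M + 1` -/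

/-- Residues modulo `2 ^ (2 * M) - 1`, on `2 * M` bits. -/
abbrev Cyc (M : ℕ) : Type := {a : ℤ // 0 ≤ a ∧ a < 2 ^ (2 * M)}

/-- The bits of an input-dependent residue. -/
abbrev cycBits {I : Type} {M : ℕ} (a : (I → Bool) → Cyc M) : Set ((I → Bool) → Bool) :=
  bits (2 * M) fun x => (a x).1

section Cyclic

variable {I : Type} {M : ℕ} {R : Type*} [CommRing R]

/-- This justifies the redundant representation: `2 ^ (2 * M) - 1` vanishes in `R`, so words of `2 *
M` bits may be combined cyclically without reducing modulo `2 ^ M + 1`. -/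
theorem two_pow_two_mul (hR : (2 : R) ^ M = -1) : (2 : R) ^ (2 * M) = 1 := by
  rw [mul_comm, pow_mul, hR]; norm_num

/-- Addition with end-around carry: the overflow bit has weight `2 ^ (2 * M) = 1` in `R` and is
added back at the bottom. -/
theorem exists_cyc_add (hM : 1 ≤ M) (hR : (2 : R) ^ M = -1) (a b : (I → Bool) → Cyc M) :
    ∃ c : (I → Bool) → Cyc M, Computes (25 * M) (cycBits a ∪ cycBits b) (cycBits c) ∧
      ∀ x, (((c x).1 : ℤ) : R) = ((a x).1 : ℤ) + ((b x).1 : ℤ) := by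
  set s : (I → Bool) → ℤ := fun x => (a x).1 + (b x).1 with hs
  have hp : (0 : ℤ) < 2 ^ (2 * M) := by positivity
  have h2M : (2 : ℤ) ^ (1 + 2 * M) = 2 * 2 ^ (2 * M) := by rw [pow_add]; ring
  have hd : ∀ x, 0 ≤ s x / 2 ^ (2 * M) ∧ s x / 2 ^ (2 * M) < 2 ^ 1 := by
    intro x
    have ha := (a x).2
    have hb := (b x).2
    refine ⟨Int.ediv_nonneg (by simp only [hs]; linarith) hp.le, ?_⟩
    rw [Int.ediv_lt_iff_lt_mul hp]
    simp only [hs]; linarith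
  -- No second overflow occurs: when the carry is one, the low part is at most `2 ^ (2 * M) - 2`.
  have hr : ∀ x, 0 ≤ s x % 2 ^ (2 * M) + s x / 2 ^ (2 * M) ∧
      s x % 2 ^ (2 * M) + s x / 2 ^ (2 * M) < 2 ^ (2 * M) := by
    intro x
    have ha := (a x).2
    have hb := (b x).2
    have h1 := Int.emod_nonneg (s x) hp.ne'
    have h2 := Int.emod_lt_of_pos (s x) hp
    have h3 := Int.emod_add_mul_ediv (s x) (2 ^ (2 * M))
    refine ⟨by linarith [(hd x).1], ?_⟩
    have hsx : s x = (a x).1 + (b x).1 := rfl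
    rcases (by have := hd x; omega : s x / 2 ^ (2 * M) = 0 ∨ s x / 2 ^ (2 * M) = 1) with h | h
    · rw [h]; linarith
    · rw [h] at h3 ⊢; linarith
  refine ⟨fun x => ⟨_, hr x⟩, ?_, fun x => ?_⟩
  · have h1 : Computes (5 * (1 + 2 * M)) (cycBits a ∪ cycBits b) (bits (1 + 2 * M) s) := by
      have ea : Computes 0 (cycBits a ∪ cycBits b) (bits (1 + 2 * M) fun x => (a x).1) :=
        (Computes.zero_ext fun x => (a x).2).mono_left Set.subset_union_left
      have eb : Computes 0 (cycBits a ∪ cycBits b) (bits (1 + 2 * M) fun x => (b x).1) :=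
        (Computes.zero_ext fun x => (b x).2).mono_left Set.subset_union_right
      exact ((ea.union eb).trans (Computes.add _ _ _)).mono_cost (by omega)
    have h2 : Computes 0 (bits (1 + 2 * M) s) (bits (2 * M) fun x => s x / 2 ^ (2 * M)) := by
      refine (Computes.zero_ext (W := 1) hd).mono_left ?_
      exact (bits_ediv_subset _).trans (by rw [add_comm])
    have h3 : Computes 0 (bits (1 + 2 * M) s) (bits (2 * M) fun x => s x % 2 ^ (2 * M)) := by
      refine Computes.of_subset ?_
      rw [bits_congr (Y := s) fun x => Int.emod_emod_of_dvd _ dvd_rfl]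
      exact bits_mono (by omega)
    have h4 := h1.trans ((h3.union h2).trans (Computes.add (2 * M) _ _))
    exact h4.mono_cost (by omega)
  · have h3 := Int.emod_add_mul_ediv (s x) (2 ^ (2 * M))
    have h4 := congrArg (Int.cast (R := R)) h3
    push_cast at h4 ⊢
    rw [two_pow_two_mul hR, one_mul] at h4
    rw [h4]
    simp [hs]

/-- The upper half of the full product has weight one in `R`, so one cyclic addition of the two
halves finishes the reduction. -/
theorem exists_cyc_mul (hM : 1 ≤ M) (hR : (2 : R) ^ M = -1) (a b : (I → Bool) → Cyc M) :
    ∃ c : (I → Bool) → Cyc M, Computes (mulComplexity (2 * M) + 25 * M)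
      (cycBits a ∪ cycBits b) (cycBits c) ∧
      ∀ x, (((c x).1 : ℤ) : R) = ((a x).1 : ℤ) * ((b x).1 : ℤ) := by
  have hp : (0 : ℤ) < 2 ^ (2 * M) := by positivity
  set s : (I → Bool) → ℤ := fun x => (a x).1 * (b x).1 with hs
  have hs0 : ∀ x, 0 ≤ s x := fun x => mul_nonneg (a x).2.1 (b x).2.1
  set lo : (I → Bool) → Cyc M := fun x =>
    ⟨s x % 2 ^ (2 * M), Int.emod_nonneg _ hp.ne', Int.emod_lt_of_pos _ hp⟩
  set hi : (I → Bool) → Cyc M := fun x => ⟨s x / 2 ^ (2 * M), Int.ediv_nonneg (hs0 x) hp.le, by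
    rw [Int.ediv_lt_iff_lt_mul hp]
    exact mul_lt_mul'' (a x).2.2 (b x).2.2 (a x).2.1 (b x).2.1⟩
  obtain ⟨c, hc, hc'⟩ := exists_cyc_add hM hR lo hi
  refine ⟨c, (Computes.mul (2 * M) _ _ (fun x => (a x).2) fun x => (b x).2).trans
    (hc.mono_left ?_), fun x => ?_⟩
  · refine Set.union_subset ?_ ?_
    · have : cycBits lo = bits (2 * M) s := bits_congr fun x => Int.emod_emod_of_dvd _ dvd_rfl
      rw [this]
      exact bits_mono (by omega)
    · exact (bits_ediv_subset _).trans (bits_mono (by omega))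
  · have h4 := congrArg (Int.cast (R := R)) (Int.emod_add_mul_ediv (s x) (2 ^ (2 * M)))
    rw [hc']
    push_cast at h4 ⊢
    rw [two_pow_two_mul hR, one_mul] at h4
    rw [h4]
    simp [hs]

/-- Doubling is a rotation by one position, the top bit returning as the lowest; it rearranges wires
and uses no gates. -/
theorem exists_cyc_two_mul (hM : 1 ≤ M) (hR : (2 : R) ^ M = -1) (a : (I → Bool) → Cyc M) :
    ∃ c : (I → Bool) → Cyc M, cycBits c ⊆ cycBits a ∧
      ∀ x, (((c x).1 : ℤ) : R) = 2 * ((a x).1 : ℤ) := by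
  obtain ⟨w, hw⟩ : ∃ w, 2 * M = 1 + w := ⟨2 * M - 1, by omega⟩
  have hp : (0 : ℤ) < 2 ^ w := by positivity
  have hpw : (2 : ℤ) ^ (2 * M) = 2 ^ w * 2 := by rw [hw, pow_add]; ring
  have hd : ∀ x, 0 ≤ (a x).1 / 2 ^ w ∧ (a x).1 / 2 ^ w < 2 := fun x =>
    ⟨Int.ediv_nonneg (a x).2.1 hp.le, by
      rw [Int.ediv_lt_iff_lt_mul hp]; linarith [(a x).2.2]⟩
  have hr : ∀ x, 0 ≤ (a x).1 % 2 ^ w * 2 ^ 1 + (a x).1 / 2 ^ w ∧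
      (a x).1 % 2 ^ w * 2 ^ 1 + (a x).1 / 2 ^ w < 2 ^ (2 * M) := by
    intro x
    have h1 := Int.emod_nonneg (a x).1 hp.ne'
    have h2 := Int.emod_lt_of_pos (a x).1 hp
    have h3 := hd x
    constructor <;> linarith
  refine ⟨fun x => ⟨_, hr x⟩, ?_, fun x => ?_⟩
  · rintro f ⟨i, hi, rfl⟩
    rcases Nat.eq_zero_or_pos i with rfl | hi0
    · refine ⟨w, by omega, funext fun x => ?_⟩
      have e : ((a x).1 % 2 ^ w * 2 ^ 1 + (a x).1 / 2 ^ w) % 2 = (a x).1 / 2 ^ w % 2 := by omega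
      simp only [ibit, pow_zero, Int.ediv_one]
      rw [e]
    · obtain ⟨j, rfl⟩ : ∃ j, i = 1 + j := ⟨i - 1, by omega⟩
      refine ⟨j, by omega, funext fun x => ?_⟩
      have h3 := hd x
      have e : ((a x).1 % 2 ^ w * 2 ^ 1 + (a x).1 / 2 ^ w) / 2 ^ 1 = (a x).1 % 2 ^ w := by omega
      simp only
      rw [← ibit_ediv, e]
      exact ibit_congr (W := w) (Int.emod_emod_of_dvd _ dvd_rfl) (by omega)
  · have h4 := congrArg (Int.cast (R := R)) (Int.emod_add_mul_ediv (a x).1 (2 ^ w))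
    have h5 := two_pow_two_mul hR
    rw [hw, pow_add, pow_one] at h5
    push_cast at h4 ⊢
    linear_combination 2 * h4 - ((((a x).1 / 2 ^ w : ℤ) : R)) * h5

theorem exists_cyc_two_pow_mul (hM : 1 ≤ M) (hR : (2 : R) ^ M = -1) (e : ℕ)
    (a : (I → Bool) → Cyc M) :
    ∃ c : (I → Bool) → Cyc M, cycBits c ⊆ cycBits a ∧
      ∀ x, (((c x).1 : ℤ) : R) = 2 ^ e * ((a x).1 : ℤ) := by
  induction e with
  | zero => exact ⟨a, subset_rfl, by simp⟩
  | succ e ih =>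
    obtain ⟨c, h1, h2⟩ := ih
    obtain ⟨c', h1', h2'⟩ := exists_cyc_two_mul hM hR c
    exact ⟨c', h1'.trans h1, fun x => by rw [h2', h2]; ring⟩

/-- A butterfly: `2 ^ e' * (a + 2 ^ e * b)`. -/
theorem exists_cyc_butterfly (hM : 1 ≤ M) (hR : (2 : R) ^ M = -1) (e e' : ℕ)
    (a b : (I → Bool) → Cyc M) :
    ∃ c : (I → Bool) → Cyc M, Computes (25 * M) (cycBits a ∪ cycBits b) (cycBits c) ∧
      ∀ x, (((c x).1 : ℤ) : R) = 2 ^ e' * (((a x).1 : ℤ) + 2 ^ e * ((b x).1 : ℤ)) := by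
  obtain ⟨b', hb1, hb2⟩ := exists_cyc_two_pow_mul hM hR e b
  obtain ⟨s, hs1, hs2⟩ := exists_cyc_add hM hR a b'
  obtain ⟨c, hc1, hc2⟩ := exists_cyc_two_pow_mul hM hR e' s
  refine ⟨c, (hs1.mono_left (Set.union_subset_union_right _ hb1)).mono_right hc1, fun x => ?_⟩
  rw [hc2, hs2, hb2]

/-- The bits of a list of `d` input-dependent residues. -/
abbrev cycVecBits {I : Type} {M : ℕ} (d : ℕ) (a : ℕ → (I → Bool) → Cyc M) :
    Set ((I → Bool) → Bool) := ⋃ i, ⋃ _ : i < d, cycBits (a i)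

/-- The polynomial of degree less than `d` with given residues as coefficients. -/
noncomputable abbrev cycPoly (R : Type*) [CommRing R] {I : Type} {M : ℕ} (d : ℕ)
    (a : ℕ → (I → Bool) → Cyc M) (x : I → Bool) : R[X] :=
  ∑ i ∈ Finset.range d, C ((((a i x).1 : ℤ) : R)) * X ^ i

theorem cycBits_subset_cycVecBits {d i : ℕ} (a : ℕ → (I → Bool) → Cyc M) (h : i < d) :
    cycBits (a i) ⊆ cycVecBits d a :=
  Set.subset_iUnion₂ (s := fun i (_ : i < d) => cycBits (a i)) i h

/-- This is reduction modulo `X ^ T - 2 ^ e`: the upper half of the coefficients is folded onto the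
lower half. -/
theorem exists_cyc_split (hM : 1 ≤ M) (hR : (2 : R) ^ M = -1) (e T : ℕ)
    (a : ℕ → (I → Bool) → Cyc M) :
    ∃ u : ℕ → (I → Bool) → Cyc M, Computes (T * (25 * M)) (cycVecBits (T + T) a) (cycVecBits T u) ∧
      ∀ x, cycPoly R T u x = cycPoly R T a x + C (2 ^ e) * cycPoly R T (fun i => a (T + i)) x := by
  choose u hu hu' using fun i => exists_cyc_butterfly hM hR e 0 (a i) (a (T + i))
  refine ⟨u, Computes.iUnion_lt T (25 * M) _ fun i hi => (hu i).mono_left ?_, fun x => ?_⟩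
  · exact Set.union_subset (cycBits_subset_cycVecBits a (by omega))
      (cycBits_subset_cycVecBits a (by omega))
  · rw [Finset.mul_sum, ← Finset.sum_add_distrib]
    refine Finset.sum_congr rfl fun i _ => ?_
    rw [hu']
    simp only [C_add, C_mul]
    simp
    ring

/-- Chinese remaindering for `Y ^ 2 - d ^ 2 = (Y - d) * (Y + d)`. The polynomial in `Y` of degree at
most one with value `p` at `d` and `q` at `-d` is `(p + q) / 2 + Y * (p - q) / (2 * d)`, where `δ`
serves as the inverse of `2 * d`. -/
theorem recombine_dvd {A : Type*} [CommRing A] {Y d δ a0 a1 b0 b1 u v u' v' p q : A}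
    (hδ : δ * (2 * d) = 1) (hu : u = a0 + d * a1) (hv : v = a0 - d * a1)
    (hu' : u' = b0 + d * b1) (hv' : v' = b0 - d * b1) (hp : Y - d ∣ p - u * u')
    (hq : Y + d ∣ q - v * v') :
    Y * Y - d * d ∣ (δ * d * (p + q) + Y * (δ * (p - q))) - (a0 + Y * a1) * (b0 + Y * b1) := by
  obtain ⟨P, hP⟩ := hp
  obtain ⟨Q, hQ⟩ := hq
  refine ⟨δ * P - δ * Q - a1 * b1, ?_⟩
  have hp' : p = u * u' + (Y - d) * P := by linear_combination hP
  have hq' : q = v * v' + (Y + d) * Q := by linear_combination hQ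
  subst hu hv hu' hv' hp' hq'
  linear_combination (a0 * b0 + d * d * a1 * b1 + Y * (a0 * b1 + a1 * b0)) * hδ

/-- Fast multiplication modulo `X ^ (2 ^ t) - 2 ^ e`. -/
theorem exists_cyc_polyMul {κ : ℕ} (hM : 1 ≤ M) (hR : (2 : R) ^ M = -1)
    (hκ : mulComplexity (2 * M) + 25 * M ≤ κ) (t : ℕ) :
    ∀ e : ℕ, 2 ^ t ∣ e → (∀ t' < t, 2 ^ t' ∣ M) → ∀ a b : ℕ → (I → Bool) → Cyc M,
    ∃ c : ℕ → (I → Bool) → Cyc M, Computes ((3 * t + 1) * 2 ^ t * κ)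
      (cycVecBits (2 ^ t) a ∪ cycVecBits (2 ^ t) b) (cycVecBits (2 ^ t) c) ∧
      ∀ x, (X ^ (2 ^ t) - C (2 ^ e) : R[X]) ∣
        cycPoly R (2 ^ t) c x - cycPoly R (2 ^ t) a x * cycPoly R (2 ^ t) b x := by
  induction t with
  | zero =>
    intro e _ _ a b
    obtain ⟨c, hc, hc'⟩ := exists_cyc_mul hM hR (a 0) (b 0)
    refine ⟨fun _ => c, ?_, fun x => ?_⟩
    · refine hc.mono (by omega) (Set.union_subset_union ?_ ?_) ?_
      · exact cycBits_subset_cycVecBits a (by norm_num)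
      · exact cycBits_subset_cycVecBits b (by norm_num)
      · simp
    · simp [cycPoly, hc']
  | succ t ih =>
    intro e he hdM a b
    obtain ⟨e₁, rfl⟩ : ∃ e₁, e = 2 * e₁ := by
      obtain ⟨z, hz⟩ := he
      exact ⟨2 ^ t * z, by rw [hz, pow_succ]; ring⟩
    have he₁ : 2 ^ t ∣ e₁ := by
      rw [pow_succ, mul_comm] at he
      exact Nat.dvd_of_mul_dvd_mul_left (by norm_num) he
    -- The second factor `X ^ T + 2 ^ e₁` is `X ^ T - 2 ^ (e₁ + M)`, and divisibility of `M` allows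
    -- the recursion to continue there.
    have he₂ : 2 ^ t ∣ e₁ + M := dvd_add he₁ (hdM t (by omega))
    have hdM' : ∀ t' < t, 2 ^ t' ∣ M := fun t' h => hdM t' (by omega)
    set T := 2 ^ t with hT
    have hTT : 2 ^ (t + 1) = T + T := by rw [pow_succ]; omega
    rw [hTT]
    obtain ⟨u, hu, hu2⟩ := exists_cyc_split hM hR e₁ T a
    obtain ⟨v, hv, hv2⟩ := exists_cyc_split hM hR (e₁ + M) T a
    obtain ⟨u', hu', hu2'⟩ := exists_cyc_split hM hR e₁ T b
    obtain ⟨v', hv', hv2'⟩ := exists_cyc_split hM hR (e₁ + M) T b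
    obtain ⟨p, hp, hp2⟩ := ih e₁ he₁ hdM' u u'
    obtain ⟨q, hq, hq2⟩ := ih (e₁ + M) he₂ hdM' v v'
    -- As `2 ^ (2 * M) = 1`, the exponent `(2 * M - 1) * (1 + e₁)` represents the inverse of `2 ^ (1
    -- + e₁)`, the divisor in the recombination. The low half needs the additional factor `2 ^ e₁`;
    -- the high half gets its minus sign from `2 ^ M = -1`.
    choose r₀ hr₀ hr₀' using fun i => exists_cyc_butterfly hM hR 0
      ((2 * M - 1) * (1 + e₁) + e₁) (p i) (q i)
    choose r₁ hr₁ hr₁' using fun i => exists_cyc_butterfly hM hR M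
      ((2 * M - 1) * (1 + e₁)) (p i) (q i)
    refine ⟨fun i => if i < T then r₀ i else r₁ (i - T), ?_, fun x => ?_⟩
    · have c1 := ((hu.mono_left Set.subset_union_left).union
        (hu'.mono_left (Set.subset_union_right (s := cycVecBits (T + T) a)))).trans hp
      have c2 := ((hv.mono_left Set.subset_union_left).union
        (hv'.mono_left (Set.subset_union_right (s := cycVecBits (T + T) a)))).trans hq
      have c3 := Computes.iUnion_lt (S := cycVecBits T p ∪ cycVecBits T q) T (25 * M)
        (fun i => cycBits (r₀ i)) fun i hi => (hr₀ i).mono_left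
        (Set.union_subset_union (cycBits_subset_cycVecBits p hi) (cycBits_subset_cycVecBits q hi))
      have c4 := Computes.iUnion_lt (S := cycVecBits T p ∪ cycVecBits T q) T (25 * M)
        (fun i => cycBits (r₁ i)) fun i hi => (hr₁ i).mono_left
        (Set.union_subset_union (cycBits_subset_cycVecBits p hi) (cycBits_subset_cycVecBits q hi))
      refine ((c1.union c2).trans (c3.union c4)).mono ?_ subset_rfl ?_
      -- Four splittings and two recombinations use `6 * T` butterflies, so the cost `c t` obeys `c
      -- (t + 1) = 2 * c t + 6 * 2 ^ t * κ`, solved by `(3 * t + 1) * 2 ^ t * κ`.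
      · have : T * (25 * M) ≤ T * κ := Nat.mul_le_mul_left _ (by omega)
        calc _ ≤ 6 * (T * κ) + 2 * ((3 * t + 1) * T * κ) := by omega
          _ = _ := by ring
      · refine Set.iUnion₂_subset fun i hi => ?_
        by_cases h : i < T
        · simp only [h, if_true]
          exact (cycBits_subset_cycVecBits r₀ h).trans Set.subset_union_left
        · simp only [h, if_false]
          exact (cycBits_subset_cycVecBits r₁ (by omega)).trans Set.subset_union_right
    · have split : ∀ a : ℕ → (I → Bool) → Cyc M, cycPoly R (T + T) a x =
          cycPoly R T a x + X ^ T * cycPoly R T (fun i => a (T + i)) x := by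
        intro a
        simp only [cycPoly]
        rw [Finset.sum_range_add, Finset.mul_sum]
        congr 1
        exact Finset.sum_congr rfl fun i _ => by ring
      have hq2x := hq2 x
      rw [pow_add, hR, mul_neg_one, C_neg, sub_neg_eq_add] at hq2x
      have key := recombine_dvd (δ := C (2 ^ ((2 * M - 1) * (1 + e₁)))) (d := C ((2 : R) ^ e₁)) ?_
        (hu2 x) (v := cycPoly R T v x) ?_ (hu2' x) (v' := cycPoly R T v' x) ?_ (hp2 x) hq2x
      · rw [split a, split b, two_mul, pow_add, pow_add, C_mul]
        refine key.trans (dvd_of_eq ?_)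
        congr 1
        rw [split]
        have s0 : cycPoly R T (fun i => if i < T then r₀ i else r₁ (i - T)) x =
            C (2 ^ ((2 * M - 1) * (1 + e₁))) * C (2 ^ e₁) * (cycPoly R T p x + cycPoly R T q x) := by
          simp only [cycPoly]
          rw [← Finset.sum_add_distrib, Finset.mul_sum]
          refine Finset.sum_congr rfl fun i hi => ?_
          simp only [Finset.mem_range.1 hi, if_true]
          rw [hr₀', pow_add]
          simp only [C_mul, C_add, pow_zero, one_mul]
          ring
        have s1 : cycPoly R T (fun i => if T + i < T then r₀ (T + i) else r₁ (T + i - T)) x =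
            C (2 ^ ((2 * M - 1) * (1 + e₁))) * (cycPoly R T p x - cycPoly R T q x) := by
          simp only [cycPoly]
          rw [← Finset.sum_sub_distrib, Finset.mul_sum]
          refine Finset.sum_congr rfl fun i hi => ?_
          simp only [Nat.not_lt.2 (Nat.le_add_right T i), if_false, Nat.add_sub_cancel_left]
          rw [hr₁', hR]
          simp only [C_mul, C_add, C_neg, C_1]
          ring
        rw [s0, s1]
      · rw [← map_ofNat C 2, ← C_mul, ← C_mul, ← C_1]
        congr 1
        have : (2 * M - 1) * (1 + e₁) + (1 + e₁) = 2 * M * (1 + e₁) := by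
          obtain ⟨m, hm⟩ : ∃ m, 2 * M = m + 1 := ⟨2 * M - 1, by omega⟩
          rw [hm]; simp; ring
        rw [← pow_succ', ← pow_add, add_comm e₁ 1, this, pow_mul, two_pow_two_mul hR, one_pow]
      · rw [hv2 x, pow_add, hR]; simp [sub_eq_add_neg]
      · rw [hv2' x, pow_add, hR]; simp [sub_eq_add_neg]

end Cyclic

/-! ### Exact multiplication of integer polynomials -/

/-- The low order bits of the first `d` coefficients of an input-dependent integer polynomial. -/
abbrev polyBits {I : Type} (W d : ℕ) (A : (I → Bool) → ℤ[X]) : Set ((I → Bool) → Bool) :=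
  ⋃ i, ⋃ _ : i < d, bits W fun x => (A x).coeff i

section IntPoly

variable {I : Type} {M w : ℕ}

theorem bits_subset_polyBits {W d i : ℕ} (A : (I → Bool) → ℤ[X]) (h : i < d) :
    bits W (fun x => (A x).coeff i) ⊆ polyBits W d A :=
  Set.subset_iUnion₂ (s := fun i (_ : i < d) => bits W fun x => (A x).coeff i) i h

/-- The sign bit has weight `-2 ^ w`, which equals `2 ^ (M + w)` in `R`. Moving it to position `M +
w < 2 * M` makes the word nonnegative without any gate. -/
theorem exists_cyc_encode {R : Type*} [CommRing R] (hR : (2 : R) ^ M = -1) (hw : w < M)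
    (X : (I → Bool) → ℤ) (hX : ∀ x, -2 ^ w ≤ X x ∧ X x < 2 ^ w) :
    ∃ a : (I → Bool) → Cyc M, Computes 0 (bits (w + 1) X) (cycBits a) ∧
      ∀ x, (((a x).1 : ℤ) : R) = (X x : ℤ) := by
  have hp : (0 : ℤ) < 2 ^ w := by positivity
  have hsgn : ∀ x, ibit (X x) w = decide (X x < 0) := fun x => ibit_sign (hX x).1 (hX x).2 le_rfl
  have hval : ∀ x, X x % 2 ^ w - (ibit (X x) w).toInt * 2 ^ w = X x := by
    intro x
    have hx := hX x
    rw [hsgn]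
    by_cases h : X x < 0
    · have : X x % 2 ^ w = X x + 2 ^ w := by
        rw [← Int.add_emod_right]
        exact Int.emod_eq_of_lt (by linarith) (by linarith)
      simp [h, this]
    · rw [Int.emod_eq_of_lt (not_lt.1 h) hx.2]
      simp [h]
  have hlt : ∀ z : ℤ, 0 ≤ z % 2 ^ w ∧ z % 2 ^ w < 2 ^ w := fun z =>
    ⟨Int.emod_nonneg _ hp.ne', Int.emod_lt_of_pos _ hp⟩
  have hpp : (2 : ℤ) ^ (M + w) + 2 ^ w ≤ 2 ^ (2 * M) := by
    have h1 : (2 : ℤ) ^ w ≤ 2 ^ (M + w) := pow_le_pow_right₀ (by norm_num) (by omega)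
    have h2 : (2 : ℤ) ^ (M + w + 1) ≤ 2 ^ (2 * M) := pow_le_pow_right₀ (by norm_num) (by omega)
    rw [pow_succ] at h2
    linarith
  have hwM : (2 : ℤ) ^ w ≤ 2 ^ (M + w) := pow_le_pow_right₀ (by norm_num) (by omega)
  have hb : ∀ b : Bool, 0 ≤ b.toInt ∧ b.toInt ≤ 1 := fun b => by cases b <;> simp
  refine ⟨fun x => ⟨X x % 2 ^ w + (ibit (X x) w).toInt * 2 ^ (M + w), ?_, ?_⟩, ?_, fun x => ?_⟩
  · have := (hb (ibit (X x) w)).1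
    have := (hlt (X x)).1
    positivity
  · have h1 := (hb (ibit (X x) w)).2
    have h2 := (hlt (X x)).2
    have h3 : (ibit (X x) w).toInt * 2 ^ (M + w) ≤ 1 * 2 ^ (M + w) :=
      mul_le_mul_of_nonneg_right h1 (by positivity)
    linarith
  · refine Computes.of_free ?_
    rintro f ⟨i, hi, rfl⟩
    by_cases h1 : i < M + w
    · have e : ∀ x, ibit (X x % 2 ^ w + (ibit (X x) w).toInt * 2 ^ (M + w)) i =
          ibit (X x % 2 ^ w) i := fun x =>
        ibit_congr (W := M + w) (by simp) h1
      by_cases h2 : i < w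
      · exact Or.inl ⟨i, by omega, funext fun x => (e x).trans
          (ibit_congr (Int.emod_emod_of_dvd _ dvd_rfl) h2)⟩
      · exact Or.inr ⟨false, funext fun x => (e x).trans
          (ibit_of_lt (hlt _).1 (hlt _).2 (not_lt.1 h2))⟩
    · obtain ⟨j, rfl⟩ := Nat.exists_eq_add_of_le (not_lt.1 h1)
      have e : ∀ x, ibit (X x % 2 ^ w + (ibit (X x) w).toInt * 2 ^ (M + w)) (M + w + j) =
          ibit ((ibit (X x) w).toInt) j := fun x => by
        rw [← ibit_ediv, Int.add_mul_ediv_right _ _ (by positivity),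
          Int.ediv_eq_zero_of_lt (hlt _).1 ((hlt _).2.trans_le hwM), zero_add]
      rcases Nat.eq_zero_or_pos j with rfl | hj
      · refine Or.inl ⟨w, by omega, funext fun x => (e x).trans ?_⟩
        cases ibit (X x) w <;> simp [ibit]
      · refine Or.inr ⟨false, funext fun x => (e x).trans ?_⟩
        refine ibit_of_lt (W := 1) (hb _).1 ?_ hj
        have := (hb (ibit (X x) w)).2
        omega
  · conv_rhs => rw [← hval x]
    push_cast
    rw [pow_add, hR]
    ring

/-- The residue modulo `2 ^ M + 1` is the low half minus the high half, because `2 ^ M = -1`. The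
bound on `V` selects the representative; adding `2 ^ (M - 1)` beforehand makes that representative
nonnegative. -/
theorem Computes.cyc_decode (hM : 1 ≤ M) (c : (I → Bool) → Cyc M) (V : (I → Bool) → ℤ)
    (hcV : ∀ x, (((c x).1 : ℤ) : ZMod (2 ^ M + 1)) = (V x : ℤ))
    (hV : ∀ x, -2 ^ (M - 1) ≤ V x ∧ V x < 2 ^ (M - 1)) :
    Computes (50 * M) (cycBits c) (bits M V) := by
  have hR : (2 : ZMod (2 ^ M + 1)) ^ M = -1 := by
    have : ((2 ^ M + 1 : ℕ) : ZMod (2 ^ M + 1)) = 0 := ZMod.natCast_self _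
    push_cast at this
    exact eq_neg_of_add_eq_zero_left this
  obtain ⟨m, hMm⟩ : ∃ m, M = m + 1 := ⟨M - 1, by omega⟩
  rw [show M - 1 = m by omega] at hV
  have hp : (0 : ℤ) < 2 ^ M := by positivity
  have hpm : (2 : ℤ) ^ M = 2 * 2 ^ m := by rw [hMm, pow_succ]; ring
  obtain ⟨c', hc', hc'2⟩ := exists_cyc_add hM hR c fun _ =>
    ⟨2 ^ m, by positivity, pow_lt_pow_right₀ (by norm_num) (by omega)⟩
  have hc1 : Computes (25 * M) (cycBits c) (cycBits c') :=
    (((Computes.of_subset subset_rfl).union (Computes.const _ _)).trans hc').mono_cost (by omega)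
  set lo : (I → Bool) → ℤ := fun x => (c' x).1 % 2 ^ M with hlo
  set hi : (I → Bool) → ℤ := fun x => (c' x).1 / 2 ^ M with hhi
  have hlo' : ∀ x, 0 ≤ lo x ∧ lo x < 2 ^ M := fun x =>
    ⟨Int.emod_nonneg _ hp.ne', Int.emod_lt_of_pos _ hp⟩
  have hhi' : ∀ x, 0 ≤ hi x ∧ hi x < 2 ^ M := fun x => ⟨Int.ediv_nonneg (c' x).2.1 hp.le, by
    simp only [hhi]
    rw [Int.ediv_lt_iff_lt_mul hp, ← pow_add, ← two_mul]
    exact (c' x).2.2⟩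
  set D : (I → Bool) → ℤ := fun x => lo x - hi x with hD
  set s : (I → Bool) → ℤ := fun x => (ibit (D x) M).toInt with hs
  -- If the difference of the halves is negative, adding the modulus once brings it into `[0, 2 ^
  -- M]`. Both sides then lie in an interval shorter than the modulus and are congruent, hence
  -- equal.
  have hE : ∀ x, V x + 2 ^ m = D x + s x * (2 ^ M + 1) := by
    intro x
    have hsgn : ibit (D x) M = decide (D x < 0) :=
      ibit_sign (by simp only [hD]; linarith [hlo' x, hhi' x])
        (by simp only [hD]; linarith [hlo' x, hhi' x]) le_rfl
    have hdvd : ((2 ^ M + 1 : ℕ) : ℤ) ∣ (V x + 2 ^ m) - (D x + s x * (2 ^ M + 1)) := by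
      rw [← ZMod.intCast_eq_intCast_iff_dvd_sub]
      have h1 := hc'2 x
      rw [hcV] at h1
      have h2 := congrArg (Int.cast (R := ZMod (2 ^ M + 1)))
        (Int.emod_add_mul_ediv (c' x).1 (2 ^ M))
      push_cast at h1 h2 ⊢
      rw [← h1, ← h2, hR]
      simp [hD, hlo, hhi]
      ring
    have hr : 0 ≤ D x + s x * (2 ^ M + 1) ∧ D x + s x * (2 ^ M + 1) < 2 ^ M + 1 := by
      simp only [hs, hsgn]
      have := hlo' x
      have := hhi' x
      by_cases h : D x < 0
      · simp [h]
        simp only [hD] at h ⊢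
        constructor <;> linarith
      · simp [h]
        simp only [hD] at h ⊢
        constructor <;> linarith
    have hv := hV x
    have := Int.eq_zero_of_abs_lt_dvd hdvd (by
      push_cast
      rw [abs_lt]
      constructor <;> linarith)
    linarith
  have c2 : Computes (5 * (M + 1)) (cycBits c') (bits (M + 1) D) := by
    have e1 : Computes 0 (cycBits c') (bits (M + 1) lo) := by
      refine (Computes.zero_ext hlo').mono_left ?_
      rw [bits_congr (Y := fun x => (c' x).1) fun x => Int.emod_emod_of_dvd _ dvd_rfl]
      exact bits_mono (by omega)
    have e2 : Computes 0 (cycBits c') (bits (M + 1) hi) :=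
      (Computes.zero_ext hhi').mono_left
        ((bits_ediv_subset _).trans (bits_mono (by omega)))
    exact ((e1.union e2).trans (Computes.sub _ _ _)).mono_cost (by omega)
  -- Only `M` bits are wanted, and `2 ^ M + 1` is one modulo `2 ^ M`: the correction amounts to
  -- adding the sign bit.
  have c3 : Computes (5 * M) (bits (M + 1) D) (bits M fun x => D x + s x) := by
    have e1 : Computes 0 (bits (M + 1) D) (bits M D) := Computes.of_subset (bits_mono (by omega))
    have e2 : Computes 0 (bits (M + 1) D) (bits M s) := by
      refine Computes.of_free ?_
      rintro f ⟨i, _, rfl⟩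
      rcases Nat.eq_zero_or_pos i with rfl | hi
      · refine Or.inl ⟨M, by omega, funext fun x => ?_⟩
        simp only [hs]
        cases ibit (D x) M <;> simp [ibit]
      · refine Or.inr ⟨false, funext fun x => ibit_of_lt (W := 1) ?_ ?_ hi⟩ <;>
          simp only [hs] <;> cases ibit (D x) M <;> simp
    exact ((e1.union e2).trans (Computes.add _ _ _)).mono_cost (by omega)
  have c4 : Computes (5 * M) (bits M fun x => D x + s x) (bits M V) := by
    have := ((Computes.of_subset subset_rfl).union (Computes.const (W := M) (2 ^ m) _)).trans
      (Computes.sub M (fun x => D x + s x) fun _ => 2 ^ m)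
    refine (this.mono_cost (by omega)).mono_right (bits_congr fun x => ?_).subset
    have : V x = (D x + s x - 2 ^ m) + s x * 2 ^ M := by linarith [hE x]
    rw [this, Int.add_mul_emod_self_right]
  exact (hc1.trans (c2.trans (c3.trans c4))).mono_cost (by omega)

theorem abs_coeff_mul_le {A B : ℤ[X]} {a b : ℤ} {T : ℕ} (hA : ∀ i, |A.coeff i| ≤ a)
    (hB : ∀ i, |B.coeff i| ≤ b) (hdeg : ∀ i, T ≤ i → A.coeff i = 0) (l : ℕ) :
    |(A * B).coeff l| ≤ T * (a * b) := by
  have ha : 0 ≤ a := (abs_nonneg _).trans (hA 0)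
  have hb : 0 ≤ b := (abs_nonneg _).trans (hB 0)
  rw [coeff_mul, Finset.Nat.sum_antidiagonal_eq_sum_range_succ_mk]
  refine (Finset.abs_sum_le_sum_abs _ _).trans ?_
  have h1 : ∀ k ∈ Finset.range (l + 1), |A.coeff k * B.coeff (l - k)| ≤
      if k < T then a * b else 0 := by
    intro k _
    split_ifs with h
    · rw [abs_mul]
      exact mul_le_mul (hA k) (hB _) (abs_nonneg _) ha
    · simp [hdeg k (not_lt.1 h)]
  refine (Finset.sum_le_sum h1).trans ?_
  rw [← Finset.sum_filter, Finset.sum_const, nsmul_eq_mul]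
  refine mul_le_mul_of_nonneg_right ?_ (mul_nonneg ha hb)
  have : (Finset.range (l + 1)).filter (· < T) ⊆ Finset.range T := fun k hk => by
    simpa using (Finset.mem_filter.1 hk).2
  exact_mod_cast (Finset.card_le_card this).trans (by simp)

/-- With `2 ^ (t + 1)` slots the product modulo `X ^ (2 ^ (t + 1)) - 1` has no wraparound. Its
coefficients are at most `2 ^ (t + 2 * w) < 2 ^ (M - 1)` in modulus, so their residues modulo `2 ^ M
+ 1` determine them. -/
theorem Computes.intPolyMul {κ t : ℕ} (hκ : mulComplexity (2 * M) + 50 * M ≤ κ)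
    (hM : 2 * w + t + 2 ≤ M) (hdvd : ∀ t' ≤ t, 2 ^ t' ∣ M) (A B : (I → Bool) → ℤ[X])
    (hA : ∀ x i, -2 ^ w ≤ (A x).coeff i ∧ (A x).coeff i < 2 ^ w)
    (hB : ∀ x i, -2 ^ w ≤ (B x).coeff i ∧ (B x).coeff i < 2 ^ w)
    (hA' : ∀ x i, 2 ^ t ≤ i → (A x).coeff i = 0) (hB' : ∀ x i, 2 ^ t ≤ i → (B x).coeff i = 0) :
    Computes ((6 * t + 10) * 2 ^ t * κ) (polyBits (w + 1) (2 ^ t) A ∪ polyBits (w + 1) (2 ^ t) B)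
      (polyBits M (2 ^ (t + 1)) fun x => A x * B x) := by
  have hM1 : 1 ≤ M := by omega
  have : Fact (1 < 2 ^ M + 1) := ⟨by have := Nat.two_pow_pos M; omega⟩
  have hR : (2 : ZMod (2 ^ M + 1)) ^ M = -1 := by
    have : ((2 ^ M + 1 : ℕ) : ZMod (2 ^ M + 1)) = 0 := ZMod.natCast_self _
    push_cast at this
    exact eq_neg_of_add_eq_zero_left this
  choose a ha ha2 using fun i => exists_cyc_encode hR (by omega : w < M)
    (fun x => (A x).coeff i) fun x => hA x i
  choose b hb hb2 using fun i => exists_cyc_encode hR (by omega : w < M)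
    (fun x => (B x).coeff i) fun x => hB x i
  have zc : ∀ i, 2 ^ t ≤ i → ∀ (A : (I → Bool) → ℤ[X]),
      (∀ x i, 2 ^ t ≤ i → (A x).coeff i = 0) → ∀ (a : ℕ → (I → Bool) → Cyc M),
      (∀ i, Computes 0 (bits (w + 1) fun x => (A x).coeff i) (cycBits (a i))) →
      ∀ S, Computes 0 S (cycBits (a i)) := by
    intro i hi A hA' a ha S
    have h0 : (fun x => (A x).coeff i) = fun _ : I → Bool => (0 : ℤ) :=
      funext fun x => hA' x i hi
    have := ha i
    rw [h0] at this
    exact ((Computes.const 0 S).trans this).mono_cost (by omega)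
  have enc : ∀ (A : (I → Bool) → ℤ[X]),
      (∀ x i, 2 ^ t ≤ i → (A x).coeff i = 0) → ∀ (a : ℕ → (I → Bool) → Cyc M),
      (∀ i, Computes 0 (bits (w + 1) fun x => (A x).coeff i) (cycBits (a i))) →
      Computes 0 (polyBits (w + 1) (2 ^ t) A) (cycVecBits (2 ^ (t + 1)) a) := by
    intro A hA' a ha
    refine (Computes.iUnion_lt (2 ^ (t + 1)) 0 _ fun i _ => ?_).mono_cost (by simp)
    by_cases h : i < 2 ^ t
    · exact (ha i).mono_left (bits_subset_polyBits A h)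
    · exact zc i (not_lt.1 h) A hA' a ha _
  obtain ⟨c, hc, hc2⟩ := exists_cyc_polyMul hM1 hR (κ := κ) (by omega) (t + 1) 0 (by simp)
    (fun t' h => hdvd t' (by omega)) a b
  have hpoly : ∀ x, cycPoly (ZMod (2 ^ M + 1)) (2 ^ (t + 1)) c x =
      (A x * B x).map (Int.castRingHom _) := by
    intro x
    have mp : ∀ (A : (I → Bool) → ℤ[X]), (∀ x i, 2 ^ t ≤ i → (A x).coeff i = 0) →
        ∀ (a : ℕ → (I → Bool) → Cyc M),
        (∀ i x, (((a i x).1 : ℤ) : ZMod (2 ^ M + 1)) = ((A x).coeff i : ℤ)) →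
        cycPoly (ZMod (2 ^ M + 1)) (2 ^ (t + 1)) a x = (A x).map (Int.castRingHom _) := by
      intro A hA' a ha
      ext j
      simp only [cycPoly, finsetSum_coeff, coeff_C_mul_X_pow, coeff_map]
      rw [Finset.sum_ite_eq]
      split_ifs with h
      · rw [ha]; simp
      · rw [hA' x j]
        · simp
        · rw [Finset.mem_range, not_lt, pow_succ] at h
          omega
    have hd := hc2 x
    rw [mp A hA' a ha2, mp B hB' b hb2, ← Polynomial.map_mul] at hd
    by_contra hne
    -- A nonzero polynomial of smaller degree cannot be divisible by a monic one, so the congruence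
    -- is an equality.
    have hmon : (X ^ (2 ^ (t + 1)) - C (2 ^ 0) : (ZMod (2 ^ M + 1))[X]).Monic :=
      monic_X_pow_sub_C _ (by positivity)
    refine hmon.not_dvd_of_degree_lt (sub_ne_zero.2 hne) ?_ hd
    rw [degree_X_pow_sub_C (by positivity)]
    refine (degree_sub_le _ _).trans_lt (max_lt ?_ ?_)
    · rw [degree_lt_iff_coeff_zero]
      intro j hj
      simp only [cycPoly, finsetSum_coeff, coeff_C_mul_X_pow]
      rw [Finset.sum_ite_eq, if_neg]
      simpa using hj
    · rw [degree_lt_iff_coeff_zero]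
      intro j hj
      rw [coeff_map, coeff_mul, Finset.sum_eq_zero, map_zero]
      intro ij hij
      replace hij := Finset.HasAntidiagonal.mem_antidiagonal.1 hij
      rw [pow_succ] at hj
      rcases Nat.lt_or_ge ij.1 (2 ^ t) with h | h
      · rw [hB' x ij.2 (by omega), mul_zero]
      · rw [hA' x ij.1 h, zero_mul]
  have habs : ∀ (A : (I → Bool) → ℤ[X]),
      (∀ x i, -2 ^ w ≤ (A x).coeff i ∧ (A x).coeff i < 2 ^ w) →
      ∀ x i, |(A x).coeff i| ≤ 2 ^ w := fun A hA x i =>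
    abs_le.2 ⟨(hA x i).1, (hA x i).2.le⟩
  have hdec : ∀ i < 2 ^ (t + 1), Computes (50 * M) (cycVecBits (2 ^ (t + 1)) c)
      (bits M fun x => (A x * B x).coeff i) := by
    intro i hi
    refine (Computes.cyc_decode hM1 (c i) _ (fun x => ?_) fun x => ?_).mono_left
      (cycBits_subset_cycVecBits c hi)
    · have := congrArg (fun p => p.coeff i) (hpoly x)
      simp only [cycPoly, finsetSum_coeff, coeff_C_mul_X_pow, coeff_map] at this
      rw [Finset.sum_ite_eq, if_pos (Finset.mem_range.2 hi)] at this
      simpa using this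
    · have h1 := abs_coeff_mul_le (habs A hA x) (habs B hB x) (hA' x) i
      have h2 : (((2 ^ t : ℕ) : ℤ) * (2 ^ w * 2 ^ w) : ℤ) < 2 ^ (M - 1) := by
        push_cast
        rw [← pow_add, ← pow_add]
        exact pow_lt_pow_right₀ (by norm_num) (by omega)
      have h3 := abs_lt.1 (h1.trans_lt h2)
      exact ⟨h3.1.le, h3.2⟩
  have e1 := ((enc A hA' a ha).mono_left Set.subset_union_left).union
    ((enc B hB' b hb).mono_left (Set.subset_union_right (s := polyBits (w + 1) (2 ^ t) A)))
  refine (e1.trans (hc.trans (Computes.iUnion_lt _ _ _ hdec))).mono_cost ?_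
  have : 2 ^ (t + 1) * (50 * M) ≤ 2 ^ (t + 1) * κ := Nat.mul_le_mul_left _ (by omega)
  calc _ ≤ (3 * (t + 1) + 1) * 2 ^ (t + 1) * κ + 2 ^ (t + 1) * κ := by omega
    _ = _ := by rw [pow_succ]; ring

end IntPoly

/-! ### Growth of the complexity of multiplication -/

/-- Each gate reads at most two input bits directly, so all gate values depend on at most twice as
many inputs as there are gates. -/
theorem IsCircuit.exists_support {I : Type} [DecidableEq I] {L : List ((I → Bool) → Bool)}
    (hL : IsCircuit L) : ∃ S : Finset I, S.card ≤ 2 * L.length ∧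
      ∀ f ∈ L, ∀ x y : I → Bool, (∀ i ∈ S, x i = y i) → f x = f y := by
  induction hL with
  | nil => exact ⟨∅, by simp, by simp⟩
  | @gate op L f g hL hf hg ih =>
    obtain ⟨S, hS, h⟩ := ih
    have key : ∀ f, IsWire L f → ∃ T : Finset I, T.card ≤ 1 ∧
        ∀ x y : I → Bool, (∀ i ∈ S ∪ T, x i = y i) → f x = f y := by
      rintro f (hf | ⟨i, rfl⟩ | ⟨b, rfl⟩)
      · exact ⟨∅, by simp, fun x y hxy => h f hf x y fun i hi =>
          hxy i (Finset.mem_union_left _ hi)⟩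
      · exact ⟨{i}, by simp, fun x y hxy => hxy i (by simp)⟩
      · exact ⟨∅, by simp, fun _ _ _ => rfl⟩
    obtain ⟨T₁, h1, h1'⟩ := key f hf
    obtain ⟨T₂, h2, h2'⟩ := key g hg
    refine ⟨S ∪ T₁ ∪ T₂, ?_, fun f' hf' x y hxy => ?_⟩
    · have e1 := Finset.card_union_le (S ∪ T₁) T₂
      have e2 := Finset.card_union_le S T₁
      simp only [List.length_cons]
      omega
    · rcases List.mem_cons.1 hf' with rfl | hf'
      · simp only
        rw [h1' x y fun i hi => hxy i (Finset.mem_union_left _ hi),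
          h2' x y fun i hi => hxy i ?_]
        rcases Finset.mem_union.1 hi with hi | hi
        · exact Finset.mem_union_left _ (Finset.mem_union_left _ hi)
        · exact Finset.mem_union_right _ hi
      · exact h f' hf' x y fun i hi => hxy i
          (Finset.mem_union_left _ (Finset.mem_union_left _ hi))

theorem natOfBits_single {N : ℕ} (j : Fin N) : natOfBits (fun i => decide (i = j)) = 2 ^ (j : ℕ) := by
  rw [natOfBits, Finset.sum_eq_single j] <;> simp +contextual

theorem natOfBits_false {N : ℕ} : natOfBits (fun _ : Fin N => false) = 0 := by
  simp [natOfBits]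

/-- Every input bit of a multiplication circuit feeds a gate. -/
theorem le_two_mul_mulComplexity (N : ℕ) : N ≤ 2 * mulComplexity N := by
  classical
  obtain ⟨L, hL, hlen, hw⟩ := computableWithGates_mulComplexity N
  obtain ⟨S, hS, hdep⟩ := hL.exists_support
  have hmem : ∀ j : Fin N, ((0 : Fin 2), j) ∈ S := by
    intro j
    by_contra hj
    have hN : 0 < N := j.pos
    let inp : (Fin N → Bool) → (Fin N → Bool) → Fin 2 × Fin N → Bool :=
      fun a b p => if p.1 = 0 then a p.2 else b p.2
    let o : Fin (2 * N) := ⟨j, by have := j.2; omega⟩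
    let e : Fin N → Bool := fun i => decide (i = j)
    let u : Fin N → Bool := fun i => decide (i = ⟨0, hN⟩)
    let z : Fin N → Bool := fun _ => false
    -- With second factor one, changing bit `j` of the first factor changes bit `j` of the product.
    -- The case of second factor zero excludes that the output wire is just the input bit `j`.
    have h1 : mulBits N (inp e u) o = true := by
      simp only [mulBits, inp, if_true, one_ne_zero, if_false, e, u, natOfBits_single, o]
      simp
    have h0 : mulBits N (inp z u) o = false := by
      simp only [mulBits, inp, if_true, one_ne_zero, if_false, z, natOfBits_false]
      simp
    have h2 : mulBits N (inp e z) o = false := by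
      simp only [mulBits, inp, if_true, one_ne_zero, if_false, z, natOfBits_false]
      simp
    have hagree : ∀ p : Fin 2 × Fin N, p ≠ (0, j) → inp e u p = inp z u p := by
      rintro ⟨c, i⟩ hp
      simp only [inp]
      split_ifs with hc
      · have : i ≠ j := fun h => hp (by rw [h, hc])
        simp [e, z, this]
      · rfl
    rcases hw o with h | ⟨p, h⟩ | ⟨b, h⟩
    · have := hdep _ h (inp e u) (inp z u) fun p hp => hagree p fun hpj => hj (hpj ▸ hp)
      simp only [h1, h0] at this
      exact absurd this (by simp)
    · have e1 := congrFun h (inp e u)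
      have e0 := congrFun h (inp z u)
      have e2 := congrFun h (inp e z)
      by_cases hp : p = (0, j)
      · simp only [h2] at e2
        subst hp
        simp [inp, e] at e2
      · simp only [h1, h0] at e1 e0
        rw [hagree p hp, ← e0] at e1
        exact absurd e1 (by simp)
    · have e1 := congrFun h (inp e u)
      have e0 := congrFun h (inp z u)
      simp only [h1, h0] at e1 e0
      rw [← e0] at e1
      exact absurd e1 (by simp)
  have hsub : (Finset.univ.image fun j : Fin N => ((0 : Fin 2), j)) ⊆ S := by
    intro p hp
    obtain ⟨j, _, rfl⟩ := Finset.mem_image.1 hp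
    exact hmem j
  have := Finset.card_le_card hsub
  rw [Finset.card_image_of_injective _ fun a b h => (Prod.mk.inj h).2] at this
  simp at this
  omega

/-! ### Integers assembled from bits, and monotonicity and doubling of the multiplication
complexity. -/

theorem sum_toInt_mul_two_pow_lt (f : ℕ → Bool) (N : ℕ) :
    0 ≤ ∑ j ∈ Finset.range N, (f j).toInt * 2 ^ j ∧
      ∑ j ∈ Finset.range N, (f j).toInt * 2 ^ j < 2 ^ N := by
  induction N with
  | zero => simp
  | succ V ih =>
    rw [Finset.sum_range_succ, pow_succ]
    have hp : (0 : ℤ) < 2 ^ V := by positivity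
    cases f V <;> simp <;> constructor <;> linarith

theorem ibit_sum (f : ℕ → Bool) {N i : ℕ} (hi : i < N) :
    ibit (∑ j ∈ Finset.range N, (f j).toInt * 2 ^ j) i = f i := by
  induction N with
  | zero => omega
  | succ N ih =>
    rw [Finset.sum_range_succ]
    rcases Nat.lt_succ_iff_lt_or_eq.1 hi with h | rfl
    · rw [← ih h]
      exact ibit_congr (W := N) (by simp) h
    · have h := sum_toInt_mul_two_pow_lt f i
      have e : (∑ j ∈ Finset.range i, (f j).toInt * 2 ^ j + (f i).toInt * 2 ^ i) / 2 ^ i =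
          (f i).toInt := by
        rw [Int.add_mul_ediv_right _ _ (by positivity), Int.ediv_eq_zero_of_lt h.1 h.2, zero_add]
      unfold ibit
      rw [e]
      cases f i <;> simp

theorem ibit_natOfBits {N : ℕ} (b : Fin N → Bool) (i : Fin N) :
    ibit (natOfBits b : ℤ) i = b i := by
  have := ibit_sum (fun j => if h : j < N then b ⟨j, h⟩ else false) i.2
  rw [Finset.sum_range] at this
  simp only [Fin.is_lt, dite_true, Fin.eta] at this
  rw [← this, natOfBits]
  push_cast
  congr 1
  refine Finset.sum_congr rfl fun j _ => ?_
  cases b j <;> simp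

/-- A multiplication procedure bounds the complexity of multiplication. -/
theorem mulComplexity_le {N s : ℕ}
    (h : ∀ (I : Type) (X Y : (I → Bool) → ℤ), (∀ x, 0 ≤ X x ∧ X x < 2 ^ N) →
      (∀ x, 0 ≤ Y x ∧ Y x < 2 ^ N) →
      Computes s (bits N X ∪ bits N Y) (bits (2 * N) fun x => X x * Y x)) :
    mulComplexity N ≤ s := by
  refine Nat.sInf_le (Computes.computableWithGates ?_)
  have hb : ∀ (b : Fin N → Bool), ∀ i : Fin N, ibit (natOfBits b : ℤ) i = b i := ibit_natOfBits
  have hr : ∀ (b : Fin N → Bool), 0 ≤ (natOfBits b : ℤ) ∧ (natOfBits b : ℤ) < 2 ^ N := by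
    intro b
    refine ⟨by positivity, ?_⟩
    have h2 : (natOfBits b : ℤ) = (natOfBits b : ℤ) % 2 ^ N := by
      conv_lhs => rw [show b = fun j : Fin N => ibit (natOfBits b : ℤ) j from
        funext fun j => (hb b j).symm]
      rw [natOfBits_ibit]
    rw [h2]
    exact Int.emod_lt_of_pos _ (by positivity)
  refine (h (Fin 2 × Fin N) (fun x => (natOfBits fun j => x (0, j) : ℕ))
    (fun x => (natOfBits fun j => x (1, j) : ℕ)) (fun x => hr _) fun x => hr _).mono le_rfl ?_ ?_
  · rintro f (⟨i, hi, rfl⟩ | ⟨i, hi, rfl⟩)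
    · exact ⟨(0, ⟨i, hi⟩), funext fun x => hb (fun j => x (0, j)) ⟨i, hi⟩⟩
    · exact ⟨(1, ⟨i, hi⟩), funext fun x => hb (fun j => x (1, j)) ⟨i, hi⟩⟩
  · rintro _ ⟨o, rfl⟩
    refine ⟨o, o.2, funext fun x => ?_⟩
    simp only [mulBits]
    rw [← ibit_natCast]
    push_cast
    rfl

theorem mulComplexity_mono : Monotone mulComplexity := by
  intro N N' h
  refine mulComplexity_le fun I X Y hX hY => ?_
  have hp : (2 : ℤ) ^ N ≤ 2 ^ N' := pow_le_pow_right₀ (by norm_num) h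
  have := ((Computes.zero_ext (W' := N') hX).mono_left
    (Set.subset_union_left (t := bits N Y))).union
    ((Computes.zero_ext (W' := N') hY).mono_left (Set.subset_union_right (s := bits N X)))
  refine ((this.trans (Computes.mul N' X Y (fun x => ⟨(hX x).1, (hX x).2.trans_le hp⟩)
    fun x => ⟨(hY x).1, (hY x).2.trans_le hp⟩)).mono_cost (by omega)).mono_right
    (bits_mono (by omega))

/-- Schoolbook multiplication: four products of half-size factors and three additions on `4 * N`
bits, costing `60 * N ≤ 120 * mulComplexity N` further gates. -/
theorem mulComplexity_two_mul_le (N : ℕ) : mulComplexity (2 * N) ≤ 124 * mulComplexity N := by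
  have hN := le_two_mul_mulComplexity N
  refine le_trans (mulComplexity_le (s := 4 * mulComplexity N + 60 * N)
    fun I X Y hX hY => ?_) (by omega)
  have hp : (0 : ℤ) < 2 ^ N := by positivity
  have lo : ∀ X : (I → Bool) → ℤ, bits N (fun x => X x % 2 ^ N) ⊆ bits (2 * N) X := fun X => by
    rw [bits_congr (Y := X) fun x => Int.emod_emod_of_dvd _ dvd_rfl]
    exact bits_mono (by omega)
  have hi : ∀ X : (I → Bool) → ℤ, bits N (fun x => X x / 2 ^ N) ⊆ bits (2 * N) X := fun X =>
    (bits_ediv_subset _).trans (bits_mono (by omega))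
  have lor : ∀ X : (I → Bool) → ℤ, ∀ x, 0 ≤ X x % 2 ^ N ∧ X x % 2 ^ N < 2 ^ N := fun X x =>
    ⟨Int.emod_nonneg _ hp.ne', Int.emod_lt_of_pos _ hp⟩
  have hir : ∀ X : (I → Bool) → ℤ, (∀ x, 0 ≤ X x ∧ X x < 2 ^ (2 * N)) →
      ∀ x, 0 ≤ X x / 2 ^ N ∧ X x / 2 ^ N < 2 ^ N := fun X hX x =>
    ⟨Int.ediv_nonneg (hX x).1 hp.le, by
      rw [Int.ediv_lt_iff_lt_mul hp, ← pow_add, ← two_mul]; exact (hX x).2⟩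
  have prod : ∀ U V : (I → Bool) → ℤ, ∀ s : ℕ, (∀ x, 0 ≤ U x ∧ U x < 2 ^ N) →
      (∀ x, 0 ≤ V x ∧ V x < 2 ^ N) → bits N U ⊆ bits (2 * N) X → bits N V ⊆ bits (2 * N) Y →
      Computes (mulComplexity N) (bits (2 * N) X ∪ bits (2 * N) Y)
        (bits (2 * (2 * N)) fun x => U x * V x * 2 ^ s) := by
    intro U V s hU hV hUX hVY
    have h1 := (Computes.mul N U V hU hV).mono_left (Set.union_subset_union hUX hVY)
    have h2 : Computes 0 (bits (2 * N) fun x => U x * V x)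
        (bits (2 * (2 * N)) fun x => U x * V x) := by
      refine Computes.zero_ext fun x => ⟨mul_nonneg (hU x).1 (hV x).1, ?_⟩
      rw [two_mul, pow_add]
      exact mul_lt_mul'' (hU x).2 (hV x).2 (hU x).1 (hV x).1
    exact (h1.trans (h2.trans (Computes.mul_pow s))).mono_right (bits_mono (by omega))
  have p1 := prod _ _ 0 (lor X) (lor Y) (lo X) (lo Y)
  have p2 := prod _ _ N (lor X) (hir Y hY) (lo X) (hi Y)
  have p3 := prod _ _ N (hir X hX) (lor Y) (hi X) (lo Y)
  have p4 := prod _ _ (2 * N) (hir X hX) (hir Y hY) (hi X) (hi Y)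
  have s1 := (p1.union p2).trans (Computes.add _ _ _)
  have s2 := (p3.union p4).trans (Computes.add _ _ _)
  have s3 := (s1.union s2).trans (Computes.add _ _ _)
  refine (s3.mono_cost (by omega)).mono_right (bits_congr fun x => ?_).subset
  congr 1
  have hx := Int.emod_add_mul_ediv (X x) (2 ^ N)
  have hy := Int.emod_add_mul_ediv (Y x) (2 ^ N)
  conv_lhs => rw [← hx, ← hy]
  ring

theorem mulComplexity_two_pow_mul_le (j N : ℕ) :
    mulComplexity (2 ^ j * N) ≤ 124 ^ j * mulComplexity N := by
  induction j with
  | zero => simp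
  | succ j ih =>
    rw [pow_succ', mul_assoc, pow_succ', mul_assoc]
    exact (mulComplexity_two_mul_le _).trans (Nat.mul_le_mul_left _ ih)

/-! ### The `ℓ¹` norm of polynomials and truncation -/

/-- The part of degree less than `N` of a polynomial. -/
noncomputable def lowPart {R : Type*} [Semiring R] (N : ℕ) (p : R[X]) : R[X] :=
  ∑ i ∈ Finset.range N, monomial i (p.coeff i)

section LowPart

variable {R : Type*}

theorem coeff_lowPart [Semiring R] (N : ℕ) (p : R[X]) (i : ℕ) :
    (lowPart N p).coeff i = if i < N then p.coeff i else 0 := by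
  simp [lowPart, finsetSum_coeff, coeff_monomial]

theorem lowPart_eq_self [Semiring R] {N : ℕ} {p : R[X]} (h : p.degree < N) : lowPart N p = p := by
  ext i
  rw [coeff_lowPart]
  split_ifs with hi
  · rfl
  · exact ((degree_lt_iff_coeff_zero _ _).1 h i (not_lt.1 hi)).symm

theorem degree_lowPart_lt [Semiring R] (N : ℕ) (p : R[X]) : (lowPart N p).degree < N := by
  rw [degree_lt_iff_coeff_zero]
  intro i hi
  rw [coeff_lowPart, if_neg (not_lt.2 hi)]

theorem lowPart_lowPart [Semiring R] {N N' : ℕ} (h : N ≤ N') (p : R[X]) :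
    lowPart N (lowPart N' p) = lowPart N p := by
  ext i
  simp only [coeff_lowPart]
  split_ifs with h1 h2
  · rfl
  · omega
  · rfl

theorem lowPart_sub [Ring R] (N : ℕ) (p q : R[X]) :
    lowPart N (p - q) = lowPart N p - lowPart N q := by
  ext i
  simp only [coeff_lowPart, coeff_sub]
  split_ifs <;> simp

theorem lowPart_eq_of_dvd [Ring R] {N : ℕ} {p q : R[X]} (h : X ^ N ∣ p - q) :
    lowPart N p = lowPart N q := by
  ext i
  simp only [coeff_lowPart]
  split_ifs with hi
  · have := (X_pow_dvd_iff.1 h) i hi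
    rwa [coeff_sub, sub_eq_zero] at this
  · rfl

theorem X_pow_dvd_sub_lowPart [Ring R] (N : ℕ) (p : R[X]) : X ^ N ∣ p - lowPart N p := by
  rw [X_pow_dvd_iff]
  intro i hi
  simp [coeff_lowPart, hi]

theorem lowPart_lowPart_mul [CommRing R] (N : ℕ) (p q : R[X]) :
    lowPart N (lowPart N p * q) = lowPart N (p * q) := by
  refine (lowPart_eq_of_dvd ?_).symm
  rw [← sub_mul]
  exact Dvd.dvd.mul_right (X_pow_dvd_sub_lowPart N p) q

theorem lowPart_mul_lowPart [CommRing R] (N : ℕ) (p q : R[X]) :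
    lowPart N (p * lowPart N q) = lowPart N (p * q) := by
  rw [mul_comm, lowPart_lowPart_mul, mul_comm]

end LowPart

/-- The sum of the moduli of the coefficients. -/
noncomputable def l1 (p : ℂ[X]) : ℝ := ∑ i ∈ p.support, ‖p.coeff i‖

theorem l1_eq_sum {p : ℂ[X]} {S : Finset ℕ} (h : p.support ⊆ S) : l1 p = ∑ i ∈ S, ‖p.coeff i‖ :=
  Finset.sum_subset h fun i _ hi => by simpa using hi

theorem l1_eq_sum_range {p : ℂ[X]} {N : ℕ} (h : p.degree < N) :
    l1 p = ∑ i ∈ Finset.range N, ‖p.coeff i‖ := by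
  refine l1_eq_sum fun i hi => ?_
  by_contra hN
  exact mem_support_iff.1 hi ((degree_lt_iff_coeff_zero _ _).1 h i (by simpa using hN))

theorem l1_nonneg (p : ℂ[X]) : 0 ≤ l1 p := Finset.sum_nonneg fun _ _ => norm_nonneg _

theorem norm_coeff_le_l1 (p : ℂ[X]) (i : ℕ) : ‖p.coeff i‖ ≤ l1 p := by
  by_cases h : i ∈ p.support
  · exact Finset.single_le_sum (f := fun i => ‖p.coeff i‖) (fun _ _ => norm_nonneg _) h
  · rw [notMem_support_iff.1 h, norm_zero]
    exact l1_nonneg p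

theorem l1_le_mul {p : ℂ[X]} {N : ℕ} {c : ℝ} (h : p.degree < N) (hc : ∀ i, ‖p.coeff i‖ ≤ c) :
    l1 p ≤ N * c := by
  rw [l1_eq_sum_range h]
  refine (Finset.sum_le_sum fun i _ => hc i).trans ?_
  simp

theorem l1_add_le (p q : ℂ[X]) : l1 (p + q) ≤ l1 p + l1 q := by
  classical
  rw [l1_eq_sum (S := p.support ∪ q.support) support_add,
    l1_eq_sum (p := p) (S := p.support ∪ q.support) Finset.subset_union_left,
    l1_eq_sum (p := q) (S := p.support ∪ q.support) Finset.subset_union_right,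
    ← Finset.sum_add_distrib]
  exact Finset.sum_le_sum fun i _ => by rw [coeff_add]; exact norm_add_le _ _

theorem l1_neg (p : ℂ[X]) : l1 (-p) = l1 p := by simp [l1]

theorem l1_sub_le (p q : ℂ[X]) : l1 (p - q) ≤ l1 p + l1 q := by
  rw [sub_eq_add_neg, ← l1_neg q]
  exact l1_add_le _ _

theorem l1_sub_comm (p q : ℂ[X]) : l1 (p - q) = l1 (q - p) := by rw [← l1_neg, neg_sub]

theorem l1_le_add (p q : ℂ[X]) : l1 p ≤ l1 (p - q) + l1 q := by
  simpa using l1_add_le (p - q) q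

theorem l1_sub_le_add (p q r : ℂ[X]) : l1 (p - r) ≤ l1 (p - q) + l1 (q - r) := by
  simpa using l1_add_le (p - q) (q - r)

theorem l1_sum_le {ι : Type*} (S : Finset ι) (f : ι → ℂ[X]) :
    l1 (∑ i ∈ S, f i) ≤ ∑ i ∈ S, l1 (f i) := by
  classical
  induction S using Finset.induction_on with
  | empty => simp [l1]
  | insert a S ha ih =>
    rw [Finset.sum_insert ha, Finset.sum_insert ha]
    exact (l1_add_le _ _).trans (by linarith)

theorem l1_monomial (n : ℕ) (a : ℂ) : l1 (monomial n a) = ‖a‖ := by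
  rw [l1_eq_sum (S := {n}) (support_monomial_subset n a)]
  simp

theorem l1_one : l1 1 = 1 := by
  rw [← C_1, ← monomial_zero_left, l1_monomial, norm_one]

theorem l1_two : l1 2 = 2 := by
  rw [← map_ofNat C 2, ← monomial_zero_left, l1_monomial]; simp

theorem l1_mul_le (p q : ℂ[X]) : l1 (p * q) ≤ l1 p * l1 q := by
  conv_lhs => rw [p.as_sum_support, q.as_sum_support, Finset.sum_mul_sum]
  have e : l1 p * l1 q = ∑ i ∈ p.support, ∑ j ∈ q.support, ‖p.coeff i‖ * ‖q.coeff j‖ :=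
    Finset.sum_mul_sum _ _ _ _
  rw [e]
  refine (l1_sum_le _ _).trans (Finset.sum_le_sum fun i _ => ?_)
  refine (l1_sum_le _ _).trans (Finset.sum_le_sum fun j _ => ?_)
  rw [monomial_mul_monomial, l1_monomial, norm_mul]

theorem l1_mul_le_of_le {p q : ℂ[X]} {a b : ℝ} (hp : l1 p ≤ a) (hq : l1 q ≤ b) :
    l1 (p * q) ≤ a * b :=
  (l1_mul_le p q).trans (mul_le_mul hp hq (l1_nonneg q) ((l1_nonneg p).trans hp))

theorem l1_pow_le (p : ℂ[X]) (n : ℕ) : l1 (p ^ n) ≤ l1 p ^ n := by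
  induction n with
  | zero => simp [l1_one]
  | succ n ih => rw [pow_succ, pow_succ]; exact l1_mul_le_of_le ih le_rfl

theorem l1_lowPart_le (N : ℕ) (p : ℂ[X]) : l1 (lowPart N p) ≤ l1 p := by
  have hs : (lowPart N p).support ⊆ p.support := fun i hi => by
    rw [mem_support_iff, coeff_lowPart] at hi
    rw [mem_support_iff]
    split_ifs at hi with h
    · exact hi
    · exact absurd rfl hi
  rw [l1_eq_sum hs, l1]
  refine Finset.sum_le_sum fun i _ => ?_
  rw [coeff_lowPart]
  split_ifs <;> simp

theorem l1_sub_lowPart_le (N : ℕ) (p : ℂ[X]) : l1 (p - lowPart N p) ≤ l1 p := by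
  have hs : (p - lowPart N p).support ⊆ p.support := fun i hi => by
    rw [mem_support_iff, coeff_sub, coeff_lowPart] at hi
    rw [mem_support_iff]
    rintro h
    simp [h] at hi
  rw [l1_eq_sum hs, l1]
  refine Finset.sum_le_sum fun i _ => ?_
  rw [coeff_sub, coeff_lowPart]
  split_ifs <;> simp

theorem l1_reflect (N : ℕ) (p : ℂ[X]) : l1 (reflect N p) = l1 p := by
  rw [l1, l1, reflect_support, Finset.sum_image fun i _ j _ h => (revAt N).injective h]
  exact Finset.sum_congr rfl fun i _ => by simp [coeff_reflect]

theorem reflect_sub' (N : ℕ) (p q : ℂ[X]) : reflect N (p - q) = reflect N p - reflect N q := by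
  ext i; simp [coeff_reflect]

theorem reflect_reflect' (N : ℕ) (p : ℂ[X]) : reflect N (reflect N p) = p := by
  ext i; simp

/-! ### Inversion of power series and division with remainder -/

/-- The inverse is a truncated geometric series in `-u`, whose norm is bounded by the sum of the
powers of `1 / 2`. -/
theorem exists_inverse_mod_X_pow {u : ℂ[X]} (hX : X ∣ u) (hu : l1 u ≤ 1 / 2) (D : ℕ) :
    ∃ G : ℂ[X], l1 G ≤ 2 ∧ X ^ D ∣ (1 + u) * G - 1 := by
  refine ⟨∑ i ∈ Finset.range D, (-u) ^ i, ?_, ?_⟩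
  · refine (l1_sum_le _ _).trans ?_
    have h1 : ∀ i ∈ Finset.range D, l1 ((-u) ^ i) ≤ (1 / 2 : ℝ) ^ i := fun i _ =>
      (l1_pow_le _ _).trans (pow_le_pow_left₀ (l1_nonneg _) (by rwa [l1_neg]) i)
    refine (Finset.sum_le_sum h1).trans ?_
    rw [geom_sum_eq (by norm_num)]
    have : (0 : ℝ) ≤ (1 / 2 : ℝ) ^ D := by positivity
    rw [div_le_iff_of_neg (by norm_num)]
    linarith
  · have h := mul_neg_geom_sum (-u) D
    rw [sub_neg_eq_add] at h
    rw [h, sub_sub_cancel_left, dvd_neg]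
    exact pow_dvd_pow_of_dvd ((dvd_neg).2 hX) D

/-- Modulo `X ^ (D + D)` one has `g * (2 - m * g) - G = -m * (g - G) ^ 2`. Here `g - G = lo + hi`,
with `lo` the error of size `e` and `hi` divisible by `X ^ D`, so `hi ^ 2` drops out. What remains
is linear in `e` to leading order: `3 / 2 * (e ^ 2 + 4 * e) ≤ 8 * e`. -/
theorem newton_exact_error {D : ℕ} {m G g : ℂ[X]} {e : ℝ} (hm : l1 m ≤ 3 / 2) (hG : l1 G ≤ 2)
    (hmG : X ^ (D + D) ∣ m * G - 1) (he : l1 (g - lowPart D G) ≤ e) (he1 : e ≤ 1) :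
    l1 (lowPart (D + D) (g * (2 - m * g)) - lowPart (D + D) G) ≤ 8 * e := by
  have he0 : 0 ≤ e := (l1_nonneg _).trans he
  set lo := g - lowPart D G with hlo
  set hi := lowPart D G - G with hhi
  have hhid : X ^ D ∣ hi := by
    have := X_pow_dvd_sub_lowPart D G
    rw [hhi, ← neg_sub]
    exact (dvd_neg).2 this
  have hhi2 : X ^ (D + D) ∣ hi * hi := by rw [pow_add]; exact mul_dvd_mul hhid hhid
  have hhil : l1 hi ≤ 2 := by
    rw [hhi, l1_sub_comm]; exact (l1_sub_lowPart_le D G).trans hG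
  rw [← lowPart_sub]
  have key : lowPart (D + D) (g * (2 - m * g) - G) =
      lowPart (D + D) (-(m * (lo * lo + 2 * (lo * hi)))) := by
    apply lowPart_eq_of_dvd
    have : g * (2 - m * g) - G - -(m * (lo * lo + 2 * (lo * hi))) =
        (m * G - 1) * (G - 2 * g) - m * (hi * hi) := by
      simp only [hlo, hhi]; ring
    rw [this]
    exact dvd_sub (Dvd.dvd.mul_right hmG _) (Dvd.dvd.mul_left hhi2 _)
  rw [key]
  refine (l1_lowPart_le _ _).trans ?_
  rw [l1_neg]
  have h1 : l1 (lo * lo + 2 * (lo * hi)) ≤ e * e + 2 * (e * 2) :=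
    (l1_add_le _ _).trans (add_le_add (l1_mul_le_of_le he he)
      (l1_mul_le_of_le l1_two.le (l1_mul_le_of_le he hhil)))
  refine (l1_mul_le_of_le hm h1).trans ?_
  nlinarith

/-- One step of Newton's iteration with inexact arithmetic. -/
theorem newton_error {D : ℕ} {m m' G g s g' p : ℂ[X]} {e η δ : ℝ} (hm : l1 m ≤ 3 / 2)
    (hG : l1 G ≤ 2) (hmG : X ^ (D + D) ∣ m * G - 1) (he : l1 (g - lowPart D G) ≤ e) (he1 : e ≤ 1)
    (hδ : l1 (m' - m) ≤ δ)
    (hp : l1 (p - lowPart (D + D) (m' * g)) ≤ η) (hs : s = 2 - p)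
    (hg' : l1 (g' - lowPart (D + D) (g * s)) ≤ η) :
    l1 (g' - lowPart (D + D) G) ≤ 8 * e + 4 * η + 9 * δ := by
  have hgl : l1 g ≤ 3 := by
    have := l1_le_add g (lowPart D G)
    have := l1_lowPart_le D G
    linarith
  have h0 := newton_exact_error hm hG hmG he he1
  have h1 : l1 (lowPart (D + D) (g * s) - lowPart (D + D) (g * (2 - m * g))) ≤ 3 * (η + δ * 3) := by
    have e1 : lowPart (D + D) (g * s) - lowPart (D + D) (g * (2 - m * g)) =
        lowPart (D + D) (g * lowPart (D + D) (m * g - p)) := by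
      rw [lowPart_mul_lowPart, ← lowPart_sub, hs]
      congr 1; ring
    rw [e1]
    refine (l1_lowPart_le _ _).trans (l1_mul_le_of_le hgl ?_)
    have e2 : lowPart (D + D) (m * g - p) = lowPart (D + D)
        (-((p - lowPart (D + D) (m' * g)) + (m' - m) * g)) := by
      apply lowPart_eq_of_dvd
      have := X_pow_dvd_sub_lowPart (D + D) (m' * g)
      convert this using 1
      ring
    rw [e2]
    refine (l1_lowPart_le _ _).trans ?_
    rw [l1_neg]
    exact (l1_add_le _ _).trans (add_le_add hp (l1_mul_le_of_le hδ hgl))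
  have h2 := l1_sub_le_add g' (lowPart (D + D) (g * s)) (lowPart (D + D) G)
  have h3 := l1_sub_le_add (lowPart (D + D) (g * s)) (lowPart (D + D) (g * (2 - m * g)))
    (lowPart (D + D) G)
  linarith

/-- Division with remainder by inversion of the reversed divisor. -/
theorem reflect_divByMonic {f m' G : ℂ[X]} {d D : ℕ} (hD : 1 ≤ D) (hf : f.degree < (d + D : ℕ))
    (hm' : m'.degree < d) (hG : X ^ D ∣ (1 + reflect d m') * G - 1) :
    reflect (D - 1) (f /ₘ (X ^ d + m')) = lowPart D (reflect (d + (D - 1)) f * G) ∧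
      f %ₘ (X ^ d + m') = lowPart d (f - f /ₘ (X ^ d + m') * m') := by
  set m := X ^ d + m' with hm
  have hmon : m.Monic := monic_X_pow_add hm'
  have hdeg : m.natDegree = d := natDegree_eq_of_degree_eq_some <| by
    rw [hm, degree_add_eq_left_of_degree_lt (by rwa [degree_X_pow]), degree_X_pow]
  set q := f /ₘ m with hq
  have hdiv : f %ₘ m + m * q = f := modByMonic_add_div f m
  have hqdeg : q.natDegree ≤ D - 1 := by
    rw [hq, natDegree_divByMonic f hmon, hdeg]
    have : f.natDegree < d + D ∨ f = 0 := by
      by_cases h : f = 0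
      · exact Or.inr h
      · exact Or.inl ((natDegree_lt_iff_degree_lt h).2 hf)
    rcases this with h | h
    · omega
    · rw [h, natDegree_zero]; omega
  have hrdeg : (f %ₘ m).degree < d := by
    have := degree_modByMonic_lt f hmon
    rwa [degree_eq_natDegree hmon.ne_zero, hdeg] at this
  constructor
  · have hrm : reflect d m = 1 + reflect d m' := by
      rw [hm]
      ext i
      simp only [coeff_reflect, coeff_add, coeff_X_pow, coeff_one]
      congr 1
      by_cases hi : i ≤ d
      · rw [revAt_le hi]
        by_cases h0 : i = 0
        · simp [h0]
        · rw [if_neg (by omega), if_neg h0]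
      · rw [revAt_eq_self_of_lt (not_le.1 hi), if_neg (by omega), if_neg (by omega)]
    -- Reversing `f = q * m + r` moves the remainder, of degree below `d`, into degrees at least
    -- `D`. Modulo `X ^ D` the reversed quotient is therefore the reversed dividend times the
    -- inverse of the reversed divisor.
    have h1 : reflect (d + (D - 1)) f - reflect (D - 1) q * (1 + reflect d m') =
        reflect (d + (D - 1)) (f %ₘ m) := by
      rw [← hrm, mul_comm, ← reflect_mul _ _ hdeg.le hqdeg, ← reflect_sub']
      congr 1
      linear_combination (-1 : ℂ[X]) * hdiv
    have h2 : X ^ D ∣ reflect (d + (D - 1)) (f %ₘ m) := by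
      rw [X_pow_dvd_iff]
      intro i hi
      rw [coeff_reflect, revAt_le (by omega)]
      exact (degree_lt_iff_coeff_zero _ _).1 hrdeg _ (by omega)
    have h3 : (reflect (D - 1) q).degree < D := by
      rw [degree_lt_iff_coeff_zero]
      intro i hi
      rw [coeff_reflect, revAt_eq_self_of_lt (by omega)]
      exact coeff_eq_zero_of_natDegree_lt (by omega)
    rw [← lowPart_eq_self h3]
    apply lowPart_eq_of_dvd
    have e : reflect (D - 1) q - reflect (d + (D - 1)) f * G =
        -(reflect (D - 1) q * ((1 + reflect d m') * G - 1)) -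
          (reflect (d + (D - 1)) f - reflect (D - 1) q * (1 + reflect d m')) * G := by ring
    rw [e, h1]
    exact dvd_sub ((dvd_neg).2 (Dvd.dvd.mul_left hG _)) (Dvd.dvd.mul_right h2 _)
  · rw [← lowPart_eq_self hrdeg]
    apply lowPart_eq_of_dvd
    -- The omitted term `X ^ d * q` does not touch the coefficients below `d`.
    have e : f %ₘ m - (f - q * m') = X ^ d * (-q) := by
      have : f = f %ₘ m + m * q := hdiv.symm
      conv_lhs => enter [2, 1]; rw [this]
      rw [hm]; ring
    rw [e]
    exact dvd_mul_right _ _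

/-- Inexact division with remainder. -/
theorem divMod_error {f m' G f' μ' g Q w : ℂ[X]} {d D : ℕ} {Φ E e δ η : ℝ} (hD : 1 ≤ D)
    (hf : f.degree < (d + D : ℕ)) (hm' : m'.degree < d)
    (hG : X ^ D ∣ (1 + reflect d m') * G - 1) (hml : l1 m' ≤ 1 / 2) (hGl : l1 G ≤ 2)
    (hfl : l1 f ≤ Φ) (hE : l1 (f' - f) ≤ E) (he : l1 (g - lowPart D G) ≤ e) (he1 : e ≤ 1)
    (hδ : l1 (μ' - m') ≤ δ) (hδ1 : δ ≤ 1 / 2)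
    (hQ : l1 (Q - lowPart D (lowPart D (reflect (d + (D - 1)) f') * g)) ≤ η)  :
    l1 (f %ₘ (X ^ d + m')) ≤ 2 * Φ ∧ l1 (reflect (D - 1) Q) ≤ 2 * Φ + (η + 3 * E + Φ * e) ∧
    (l1 (w - reflect (D - 1) Q * μ') ≤ η →
    l1 (lowPart d (f' - w) - f %ₘ (X ^ d + m')) ≤ 4 * E + Φ * (e + 2 * δ) + 2 * η) := by
  obtain ⟨h1, h2⟩ := reflect_divByMonic hD hf hm' hG
  set q := f /ₘ (X ^ d + m')
  have hΦ : 0 ≤ Φ := (l1_nonneg _).trans hfl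
  have hE0 : 0 ≤ E := (l1_nonneg _).trans hE
  have hgl : l1 g ≤ 3 := by
    have := l1_le_add g (lowPart D G)
    have := l1_lowPart_le D G
    linarith
  have hql : l1 q ≤ 2 * Φ := by
    rw [← l1_reflect (D - 1), h1]
    refine (l1_lowPart_le _ _).trans ?_
    rw [mul_comm 2 Φ]
    exact l1_mul_le_of_le (by rwa [l1_reflect]) hGl
  have hmul' : l1 μ' ≤ 1 := by
    have := l1_le_add μ' m'
    linarith
  have hdq : l1 (reflect (D - 1) Q - q) ≤ η + 3 * E + Φ * e := by
    have e0 : reflect (D - 1) Q - q = reflect (D - 1) (Q - reflect (D - 1) q) := by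
      rw [reflect_sub', reflect_reflect']
    rw [e0, l1_reflect, h1]
    refine (l1_sub_le_add _ _ _).trans (add_assoc η _ _ ▸ add_le_add hQ ?_)
    rw [lowPart_lowPart_mul, ← lowPart_mul_lowPart D _ G, ← lowPart_sub]
    have e1 : reflect (d + (D - 1)) f' * g - reflect (d + (D - 1)) f * lowPart D G =
        g * reflect (d + (D - 1)) (f' - f) + reflect (d + (D - 1)) f * (g - lowPart D G) := by
      rw [reflect_sub']; ring
    rw [e1]
    refine (l1_lowPart_le _ _).trans ((l1_add_le _ _).trans (add_le_add ?_ ?_))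
    · exact l1_mul_le_of_le hgl (by rwa [l1_reflect])
    · exact l1_mul_le_of_le (by rwa [l1_reflect]) he
  refine ⟨?_, ?_, fun hw => ?_⟩
  · rw [h2]
    refine (l1_lowPart_le _ _).trans ((l1_sub_le _ _).trans ?_)
    have := l1_mul_le_of_le hql hml
    linarith
  · have := l1_le_add (reflect (D - 1) Q) q
    linarith
  · rw [h2, ← lowPart_sub]
    refine (l1_lowPart_le _ _).trans ?_
    -- Besides the error of the dividend there are three contributions: rounding of the last
    -- product, the error of the quotient, and the error of the divisor multiplied by the exact
    -- quotient.
    have e1 : f' - w - (f - q * m') = (f' - f) - ((w - reflect (D - 1) Q * μ') +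
        ((reflect (D - 1) Q - q) * μ' + q * (μ' - m'))) := by ring
    rw [e1]
    have a1 := l1_sub_le (f' - f) ((w - reflect (D - 1) Q * μ') +
        ((reflect (D - 1) Q - q) * μ' + q * (μ' - m')))
    have a2 := l1_add_le (w - reflect (D - 1) Q * μ')
        ((reflect (D - 1) Q - q) * μ' + q * (μ' - m'))
    have a3 := l1_add_le ((reflect (D - 1) Q - q) * μ') (q * (μ' - m'))
    have a4 := l1_mul_le_of_le hdq hmul'
    have a5 := l1_mul_le_of_le hql hδ
    nlinarith

/-! ### The supermoduli and the remainders under scaling -/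

/-- The degree of the supermodulus at node `(h, j)`. -/
def supermodulusDegree (n h j : ℕ) : ℕ := min (2 ^ h) (n - j * 2 ^ h)

theorem supermodulusDegree_succ (n h j : ℕ) : supermodulusDegree n (h + 1) j =
    supermodulusDegree n h (2 * j) + supermodulusDegree n h (2 * j + 1) := by
  unfold supermodulusDegree
  have h1 : j * 2 ^ (h + 1) = 2 * (j * 2 ^ h) := by ring
  have h2 : 2 * j * 2 ^ h = 2 * (j * 2 ^ h) := by ring
  have h3 : (2 * j + 1) * 2 ^ h = 2 * (j * 2 ^ h) + 2 ^ h := by ring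
  rw [h1, h2, h3, pow_succ]
  omega

theorem supermodulusDegree_le (n h j : ℕ) : supermodulusDegree n h j ≤ 2 ^ h := min_le_left _ _

/-- The sibling contributes at most `2 ^ h`, so the quotient at a node of level `h` has at most `2 ^
h` coefficients even where the padding makes the divisor short. -/
theorem supermodulusDegree_parent_le (n h j : ℕ) :
    supermodulusDegree n (h + 1) (j / 2) ≤ supermodulusDegree n h j + 2 ^ h := by
  rw [supermodulusDegree_succ]
  have h1 := supermodulusDegree_le n h (2 * (j / 2))
  have h2 := supermodulusDegree_le n h (2 * (j / 2) + 1)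
  rcases Nat.mod_two_eq_zero_or_one j with h | h
  · have : 2 * (j / 2) = j := by omega
    rw [this] at h1 h2 ⊢
    omega
  · have : 2 * (j / 2) + 1 = j := by omega
    rw [this] at h2 ⊢
    omega

section Supermodulus

variable {n : ℕ} (x : Fin n → ℂ)

theorem monic_supermodulus (h j : ℕ) : (supermodulus x h j).Monic := by
  induction h generalizing j with
  | zero =>
    rw [supermodulus]
    split_ifs
    · exact monic_X_sub_C _
    · exact monic_one
  | succ h ih => rw [supermodulus]; exact (ih _).mul (ih _)

theorem natDegree_supermodulus (h j : ℕ) :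
    (supermodulus x h j).natDegree = supermodulusDegree n h j := by
  induction h generalizing j with
  | zero =>
    rw [supermodulus, supermodulusDegree]
    split_ifs with hj
    · rw [natDegree_X_sub_C]; omega
    · rw [natDegree_one]; omega
  | succ h ih =>
    rw [supermodulus, (monic_supermodulus x _ _).natDegree_mul (monic_supermodulus x _ _), ih, ih,
      supermodulusDegree_succ]

theorem degree_supermodulus (h j : ℕ) :
    (supermodulus x h j).degree = (supermodulusDegree n h j : ℕ) := by
  rw [degree_eq_natDegree (monic_supermodulus x h j).ne_zero, natDegree_supermodulus]

/-- Each linear factor satisfies `b * X - x = b * (X - x / b)`; the padding by ones is why the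
exponent is the actual degree and not `2 ^ h`. -/
theorem supermodulus_comp {b : ℂ} (hb : b ≠ 0) (h j : ℕ) :
    (supermodulus x h j).comp (C b * X) =
      C (b ^ supermodulusDegree n h j) * supermodulus (fun i => x i / b) h j := by
  induction h generalizing j with
  | zero =>
    rw [supermodulus, supermodulus]
    split_ifs with hj
    · have : supermodulusDegree n 0 j = 1 := by unfold supermodulusDegree; omega
      rw [this, pow_one, mul_sub, ← C_mul, mul_div_cancel₀ _ hb]
      simp
    · have : supermodulusDegree n 0 j = 0 := by unfold supermodulusDegree; omega
      simp [this]
  | succ h ih =>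
    rw [supermodulus, supermodulus, mul_comp, ih, ih, supermodulusDegree_succ, pow_add, C_mul]
    ring

theorem l1_supermodulus_le {a : ℝ} (ha : 0 ≤ a) (hx : ∀ i, ‖x i‖ ≤ a) (h j : ℕ) :
    l1 (supermodulus x h j) ≤ (1 + a) ^ 2 ^ h := by
  induction h generalizing j with
  | zero =>
    rw [supermodulus]
    split_ifs with hj
    · refine (l1_sub_le _ _).trans ?_
      rw [← monomial_one_one_eq_X, ← monomial_zero_left, l1_monomial, l1_monomial]
      simpa using hx _
    · simpa [l1_one] using ha
  | succ h ih =>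
    rw [supermodulus, pow_succ 2 h, pow_mul, sq]
    exact l1_mul_le_of_le (ih _) (ih _)

theorem eq_X_pow_add_lowPart {m : ℂ[X]} {d : ℕ} (hm : m.Monic) (hd : m.natDegree = d) :
    m = X ^ d + lowPart d m := by
  ext i
  rw [coeff_add, coeff_X_pow, coeff_lowPart]
  rcases lt_trichotomy i d with h | h | h
  · simp [h, h.ne]
  · subst h; subst hd
    simp [hm]
  · rw [coeff_eq_zero_of_natDegree_lt (by omega)]
    simp [h.ne']

theorem l1_lowPart_of_monic {m : ℂ[X]} {d : ℕ} (hm : m.Monic) (hd : m.natDegree = d) :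
    l1 (lowPart d m) + 1 = l1 m := by
  have h1 : m.degree < (d + 1 : ℕ) := by
    rw [← natDegree_lt_iff_degree_lt hm.ne_zero]; omega
  rw [l1_eq_sum_range h1, Finset.sum_range_succ, l1_eq_sum_range (degree_lowPart_lt d m)]
  congr 1
  · refine Finset.sum_congr rfl fun i hi => ?_
    rw [coeff_lowPart, if_pos (Finset.mem_range.1 hi)]
  · have : m.coeff d = 1 := by rw [← hd]; exact hm
    rw [this, norm_one]

/-- The whole product has norm at most `(1 + a) ^ 2 ^ k ≤ exp (1 / 4) ≤ 3 / 2`, and its leading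
coefficient accounts for exactly one. -/
theorem l1_lowPart_supermodulus_le {a : ℝ} {k h : ℕ} (ha : 0 ≤ a) (hx : ∀ i, ‖x i‖ ≤ a)
    (hak : 2 ^ k * a ≤ 1 / 4) (hk : h ≤ k) (j : ℕ) :
    l1 (lowPart (supermodulusDegree n h j) (supermodulus x h j)) ≤ 1 / 2 := by
  have h1 := l1_lowPart_of_monic (monic_supermodulus x h j) (natDegree_supermodulus x h j)
  have h2 := l1_supermodulus_le x ha hx h j
  have h3 : (1 + a) ^ 2 ^ h ≤ (1 + a) ^ 2 ^ k :=
    pow_le_pow_right₀ (by linarith) (Nat.pow_le_pow_right (by norm_num) hk)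
  have h4 : (1 + a) ^ 2 ^ k ≤ Real.exp (1 / 4) := by
    calc (1 + a) ^ 2 ^ k ≤ Real.exp a ^ 2 ^ k :=
          pow_le_pow_left₀ (by linarith) (by linarith [Real.add_one_le_exp a]) _
      _ = Real.exp (2 ^ k * a) := by rw [← Real.exp_nat_mul]; push_cast; rfl
      _ ≤ _ := Real.exp_le_exp.2 hak
  have h5 : Real.exp (1 / 4) ≤ 3 / 2 := by
    have e1 := Real.add_one_le_exp (-(1 / 4 : ℝ))
    have e2 : Real.exp (1 / 4) * Real.exp (-(1 / 4 : ℝ)) = 1 := by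
      rw [← Real.exp_add]; simp
    nlinarith [Real.exp_pos (1 / 4 : ℝ)]
  linarith

/-! ### Remainders under scaling of the variable. -/

theorem fanOutAtDepth_succ (v : ℂ[X]) (k d j : ℕ) : fanOutAtDepth x v k (d + 1) j =
    fanOutAtDepth x v k d (j / 2) %ₘ supermodulus x (k - (d + 1)) j := by
  rw [fanOutAtDepth, modByMonic_eq_mod _ (monic_supermodulus x _ _)]

theorem degree_comp_C_mul_X_lt {p : ℂ[X]} {N : ℕ} (h : p.degree < N) (b : ℂ) :
    (p.comp (C b * X)).degree < N := by
  rw [degree_lt_iff_coeff_zero] at h ⊢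
  intro i hi
  rw [comp_C_mul_X_coeff, h i hi, zero_mul]

/-- By uniqueness of division with remainder: scaling a divisor produces a nonzero constant, which
is moved into the quotient. -/
theorem fanOutAtDepth_comp (v : ℂ[X]) {b : ℂ} (hb : b ≠ 0) (k d j : ℕ) :
    fanOutAtDepth (fun i => x i / b) (v.comp (C b * X)) k d j =
      (fanOutAtDepth x v k d j).comp (C b * X) := by
  induction d generalizing j with
  | zero => rfl
  | succ d ih =>
    rw [fanOutAtDepth_succ, fanOutAtDepth_succ, ih]
    set p := fanOutAtDepth x v k d (j / 2)
    have hmon := monic_supermodulus x (k - (d + 1)) j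
    set m := supermodulus x (k - (d + 1)) j with hm
    refine (div_modByMonic_unique
      ((p /ₘ m).comp (C b * X) * C (b ^ supermodulusDegree n (k - (d + 1)) j)) _
      (monic_supermodulus (fun i => x i / b) _ _) ⟨?_, ?_⟩).2
    · conv_rhs => rw [← modByMonic_add_div p m]
      rw [add_comp, mul_comp, hm, supermodulus_comp x hb]
      ring
    · rw [degree_supermodulus]
      refine degree_comp_C_mul_X_lt ?_ b
      rw [← degree_supermodulus x]
      exact degree_modByMonic_lt _ hmon

theorem degree_fanOutAtDepth_lt {v : ℂ[X]} {k : ℕ} (hv : v.degree < n) (hk : n ≤ 2 ^ k) (d j : ℕ)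
    (hj : j < 2 ^ d) :
    (fanOutAtDepth x v k d j).degree < (supermodulusDegree n (k - d) j : ℕ) := by
  cases d with
  | zero =>
    have : supermodulusDegree n (k - 0) j = n := by
      unfold supermodulusDegree
      have : j = 0 := by simpa using hj
      subst this
      simp [hk]
    rw [this]
    exact hv
  | succ d =>
    rw [fanOutAtDepth_succ, ← degree_supermodulus x]
    exact degree_modByMonic_lt _ (monic_supermodulus x _ _)

end Supermodulus

/-! ### Fixed-point complex polynomials -/

/-- The complex polynomial with given integer multiples of `2 ^ (-P)` as real and imaginary parts of
its coefficients. -/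
noncomputable def fixedPoly (P : ℕ) (A : ℤ[X] × ℤ[X]) : ℂ[X] :=
  C ((2 ^ P : ℂ)⁻¹) * (A.1.map (Int.castRingHom ℂ) + C Complex.I * A.2.map (Int.castRingHom ℂ))

theorem coeff_fixedPoly (P : ℕ) (A : ℤ[X] × ℤ[X]) (i : ℕ) : (fixedPoly P A).coeff i =
    (2 ^ P : ℂ)⁻¹ * ((A.1.coeff i : ℤ) + Complex.I * (A.2.coeff i : ℤ)) := by
  simp [fixedPoly, coeff_C_mul, coeff_map]

/-- Truncation of both parts. -/
noncomputable def pairLow (N : ℕ) (A : ℤ[X] × ℤ[X]) : ℤ[X] × ℤ[X] :=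
  (lowPart N A.1, lowPart N A.2)

theorem fixedPoly_pairLow (P N : ℕ) (A : ℤ[X] × ℤ[X]) :
    fixedPoly P (pairLow N A) = lowPart N (fixedPoly P A) := by
  ext i
  rw [coeff_fixedPoly, coeff_lowPart, coeff_fixedPoly]
  simp only [pairLow, coeff_lowPart]
  split_ifs <;> simp

theorem fixedPoly_sub (P : ℕ) (A B : ℤ[X] × ℤ[X]) :
    fixedPoly P (A - B) = fixedPoly P A - fixedPoly P B := by
  simp only [fixedPoly, Prod.fst_sub, Prod.snd_sub, Polynomial.map_sub]
  ring

theorem fixedPoly_C (P : ℕ) (a : ℤ) : fixedPoly P (C (a * 2 ^ P), 0) = C (a : ℂ) := by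
  ext i
  rw [coeff_fixedPoly, coeff_C, coeff_C]
  split_ifs with h
  · simp [mul_comm]
  · simp

theorem fixedPoly_add (P : ℕ) (A B : ℤ[X] × ℤ[X]) :
    fixedPoly P (A + B) = fixedPoly P A + fixedPoly P B := by
  simp only [fixedPoly, Prod.fst_add, Prod.snd_add, Polynomial.map_add]
  ring

/-- Reversal of both parts. -/
noncomputable def pairReflect (N : ℕ) (A : ℤ[X] × ℤ[X]) : ℤ[X] × ℤ[X] :=
  (reflect N A.1, reflect N A.2)

theorem fixedPoly_pairReflect (P N : ℕ) (A : ℤ[X] × ℤ[X]) :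
    fixedPoly P (pairReflect N A) = reflect N (fixedPoly P A) := by
  ext i
  rw [coeff_fixedPoly, coeff_reflect, coeff_fixedPoly]
  simp [pairReflect, coeff_reflect]

theorem abs_coeff_lt_of_l1 {P b w : ℕ} (h : P + b ≤ w) {A : ℤ[X] × ℤ[X]}
    (hA : l1 (fixedPoly P A) < 2 ^ b) (i : ℕ) :
    (-2 ^ w ≤ A.1.coeff i ∧ A.1.coeff i < 2 ^ w) ∧ -2 ^ w ≤ A.2.coeff i ∧ A.2.coeff i < 2 ^ w := by
  have hp : (0 : ℝ) < 2 ^ P := by positivity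
  have h1 : ‖((A.1.coeff i : ℤ) : ℂ) + Complex.I * (A.2.coeff i : ℤ)‖ < 2 ^ w := by
    have h2 := (norm_coeff_le_l1 (fixedPoly P A) i).trans_lt hA
    rw [coeff_fixedPoly, norm_mul, norm_inv, norm_pow, Complex.norm_ofNat, inv_mul_lt_iff₀ hp,
      ← pow_add] at h2
    exact h2.trans_le (pow_le_pow_right₀ (by norm_num) h)
  have hre := (Complex.abs_re_le_norm _).trans_lt h1
  have him := (Complex.abs_im_le_norm _).trans_lt h1
  simp only [Complex.add_re, Complex.intCast_re, Complex.mul_re, Complex.I_re, Complex.I_im,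
    Complex.intCast_im, zero_mul, mul_zero, sub_zero, add_zero, Complex.add_im, Complex.mul_im,
    one_mul, zero_add] at hre him
  have e1 := abs_lt.1 (by exact_mod_cast hre : |A.1.coeff i| < 2 ^ w)
  have e2 := abs_lt.1 (by exact_mod_cast him : |A.2.coeff i| < 2 ^ w)
  exact ⟨⟨e1.1.le, e1.2⟩, e2.1.le, e2.2⟩

/-! ### Machine words as signed integers. -/

/-- The signed value of the `w + 1` low order bits. -/
def signedWord (w : ℕ) (z : ℤ) : ℤ := (z + 2 ^ w) % 2 ^ (w + 1) - 2 ^ w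

theorem signedWord_range (w : ℕ) (z : ℤ) : -2 ^ w ≤ signedWord w z ∧ signedWord w z < 2 ^ w := by
  have hp : (0 : ℤ) < 2 ^ (w + 1) := by positivity
  have h1 := Int.emod_nonneg (z + 2 ^ w) hp.ne'
  have h2 := Int.emod_lt_of_pos (z + 2 ^ w) hp
  have h3 : (2 : ℤ) ^ (w + 1) = 2 * 2 ^ w := by ring
  unfold signedWord
  constructor <;> linarith

theorem signedWord_emod (w : ℕ) (z : ℤ) : signedWord w z % 2 ^ (w + 1) = z % 2 ^ (w + 1) := by
  unfold signedWord
  rw [Int.sub_emod, Int.emod_emod_of_dvd _ dvd_rfl, ← Int.sub_emod, add_sub_cancel_right]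

theorem signedWord_eq {w : ℕ} {z : ℤ} (h : -2 ^ w ≤ z ∧ z < 2 ^ w) : signedWord w z = z := by
  have h3 : (2 : ℤ) ^ (w + 1) = 2 * 2 ^ w := by ring
  unfold signedWord
  rw [Int.emod_eq_of_lt (by linarith) (by linarith)]
  ring

/-- The polynomial of the signed low order words of the first `N` coefficients. -/
noncomputable def wordPoly (w N : ℕ) (p : ℤ[X]) : ℤ[X] :=
  ∑ i ∈ Finset.range N, monomial i (signedWord w (p.coeff i))

theorem coeff_wordPoly (w N : ℕ) (p : ℤ[X]) (i : ℕ) :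
    (wordPoly w N p).coeff i = if i < N then signedWord w (p.coeff i) else 0 := by
  simp [wordPoly, finsetSum_coeff, coeff_monomial]

theorem wordPoly_range (w N : ℕ) (p : ℤ[X]) (i : ℕ) :
    -2 ^ w ≤ (wordPoly w N p).coeff i ∧ (wordPoly w N p).coeff i < 2 ^ w := by
  rw [coeff_wordPoly]
  split_ifs
  · exact signedWord_range _ _
  · simp

theorem wordPoly_eq {w N : ℕ} {p : ℤ[X]} (h : ∀ i, -2 ^ w ≤ p.coeff i ∧ p.coeff i < 2 ^ w) :
    wordPoly w N p = lowPart N p := by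
  ext i
  rw [coeff_wordPoly, coeff_lowPart]
  split_ifs
  · exact signedWord_eq (h i)
  · rfl

section Circuits

variable {I : Type} {M w P b κ : ℕ}

/-- Passing to signed words changes no wire. A multiplier can thus be built whose range conditions
hold for every input, even where the intended numbers would overflow. -/
theorem polyBits_wordPoly (N : ℕ) (A : (I → Bool) → ℤ[X]) :
    polyBits (w + 1) N (fun x => wordPoly w N (A x)) = polyBits (w + 1) N A := by
  refine Set.iUnion₂_congr fun i hi => bits_congr fun x => ?_
  rw [coeff_wordPoly, if_pos hi, signedWord_emod]

/-- The low order bits of the first `d` coefficients. -/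
abbrev pairBits (W d : ℕ) (A : (I → Bool) → ℤ[X] × ℤ[X]) : Set ((I → Bool) → Bool) :=
  polyBits W d (fun x => (A x).1) ∪ polyBits W d (fun x => (A x).2)

theorem pairBits_mono {W d d' : ℕ} (h : d ≤ d') (A : (I → Bool) → ℤ[X] × ℤ[X]) :
    pairBits W d A ⊆ pairBits W d' A := by
  refine Set.union_subset_union ?_ ?_ <;>
    exact Set.iUnion₂_subset fun i hi => bits_subset_polyBits _ (hi.trans_le h)

/-- Rearranging coefficients and inserting constants costs nothing. -/
theorem Computes.pair_free {W d d' : ℕ} {A B : (I → Bool) → ℤ[X] × ℤ[X]}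
    (h : ∀ i < d', (∃ j < d, ∀ x, (B x).1.coeff i = (A x).1.coeff j ∧
      (B x).2.coeff i = (A x).2.coeff j) ∨
      ∃ c₁ c₂ : ℤ, ∀ x, (B x).1.coeff i = c₁ ∧ (B x).2.coeff i = c₂) :
    Computes 0 (pairBits W d A) (pairBits W d' B) := by
  refine ((Computes.iUnion_lt d' 0 _ fun i hi => ?_).union
    (Computes.iUnion_lt d' 0 _ fun i hi => ?_)).mono_cost (by simp)
  · rcases h i hi with ⟨j, hj, h⟩ | ⟨c₁, c₂, h⟩
    · rw [funext fun x => (h x).1]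
      exact Computes.of_subset ((bits_subset_polyBits (fun x => (A x).1) hj).trans
        Set.subset_union_left)
    · rw [funext fun x => (h x).1]
      exact Computes.const _ _
  · rcases h i hi with ⟨j, hj, h⟩ | ⟨c₁, c₂, h⟩
    · rw [funext fun x => (h x).2]
      exact Computes.of_subset ((bits_subset_polyBits (fun x => (A x).2) hj).trans
        Set.subset_union_right)
    · rw [funext fun x => (h x).2]
      exact Computes.const _ _

theorem Computes.pairLow {W d d' N : ℕ} (h : N ≤ d) (A : (I → Bool) → ℤ[X] × ℤ[X]) :
    Computes 0 (pairBits W d A) (pairBits W d' fun x => pairLow N (A x)) := by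
  refine Computes.pair_free fun i _ => ?_
  by_cases hi : i < N
  · exact Or.inl ⟨i, by omega, fun x => by simp [_root_.pairLow, coeff_lowPart, hi]⟩
  · exact Or.inr ⟨0, 0, fun x => by simp [_root_.pairLow, coeff_lowPart, hi]⟩

theorem Computes.polySub (W d : ℕ) (A B : (I → Bool) → ℤ[X]) :
    Computes (d * (5 * W)) (polyBits W d A ∪ polyBits W d B)
      (polyBits W d fun x => A x - B x) := by
  refine Computes.iUnion_lt d (5 * W) _ fun i hi => ?_
  simp only [coeff_sub]
  exact (Computes.sub W _ _).mono_left
    (Set.union_subset_union (bits_subset_polyBits A hi) (bits_subset_polyBits B hi))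

theorem Computes.polyAdd (W d : ℕ) (A B : (I → Bool) → ℤ[X]) :
    Computes (d * (5 * W)) (polyBits W d A ∪ polyBits W d B)
      (polyBits W d fun x => A x + B x) := by
  refine Computes.iUnion_lt d (5 * W) _ fun i hi => ?_
  simp only [coeff_add]
  exact (Computes.add W _ _).mono_left
    (Set.union_subset_union (bits_subset_polyBits A hi) (bits_subset_polyBits B hi))

theorem Computes.pairSub (W d : ℕ) (A B : (I → Bool) → ℤ[X] × ℤ[X]) :
    Computes (d * (10 * W)) (pairBits W d A ∪ pairBits W d B)
      (pairBits W d fun x => A x - B x) := by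
  refine (((Computes.polySub W d (fun x => (A x).1) fun x => (B x).1).mono_left
    (Set.union_subset_union Set.subset_union_left Set.subset_union_left)).union
    ((Computes.polySub W d (fun x => (A x).2) fun x => (B x).2).mono_left
    (Set.union_subset_union Set.subset_union_right Set.subset_union_right))).mono_cost ?_
  exact le_of_eq (by ring)

/-- Rounding down costs at most one unit in the last place in each of the real and imaginary parts.
-/
theorem norm_floor_error (P r : ℕ) (a b : ℤ) :
    ‖(2 ^ P : ℂ)⁻¹ * (((a / 2 ^ r : ℤ) : ℂ) + Complex.I * ((b / 2 ^ r : ℤ) : ℂ)) -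
      (2 ^ P : ℂ)⁻¹ * ((2 ^ r : ℂ)⁻¹ * ((a : ℂ) + Complex.I * (b : ℂ)))‖ ≤ 2 * (2 ^ P : ℝ)⁻¹ := by
  have hp : (0 : ℝ) < 2 ^ r := by positivity
  have fl : ∀ a : ℤ, ‖((a / 2 ^ r : ℤ) : ℂ) - (2 ^ r : ℂ)⁻¹ * (a : ℂ)‖ ≤ 1 := by
    intro a
    have h1 : ((a / 2 ^ r : ℤ) : ℂ) - (2 ^ r : ℂ)⁻¹ * (a : ℂ) =
        (((a / 2 ^ r : ℤ) - (2 ^ r : ℝ)⁻¹ * (a : ℝ) : ℝ) : ℂ) := by push_cast; rfl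
    rw [h1, Complex.norm_real, Real.norm_eq_abs]
    have hz : (0 : ℤ) < 2 ^ r := by positivity
    have e1 : (a % 2 ^ r : ℤ) + (2 ^ r : ℝ) * ((a / 2 ^ r : ℤ) : ℝ) = a := by
      exact_mod_cast Int.emod_add_mul_ediv a (2 ^ r)
    have e2 : (0 : ℝ) ≤ (a % 2 ^ r : ℤ) := by exact_mod_cast Int.emod_nonneg a hz.ne'
    have e3 : ((a % 2 ^ r : ℤ) : ℝ) ≤ 2 ^ r := by exact_mod_cast (Int.emod_lt_of_pos a hz).le
    have e4 : ((a / 2 ^ r : ℤ) : ℝ) - (2 ^ r : ℝ)⁻¹ * (a : ℝ) =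
        -((2 ^ r : ℝ)⁻¹ * ((a % 2 ^ r : ℤ) : ℝ)) := by
      rw [← e1]; field_simp; ring
    rw [e4, abs_neg, abs_of_nonneg (by positivity), inv_mul_le_iff₀ hp, mul_one]
    exact e3
  rw [← mul_sub, norm_mul, norm_inv, norm_pow, Complex.norm_ofNat, mul_comm 2]
  refine mul_le_mul_of_nonneg_left ?_ (by positivity)
  have e : ((a / 2 ^ r : ℤ) : ℂ) + Complex.I * ((b / 2 ^ r : ℤ) : ℂ) -
      (2 ^ r : ℂ)⁻¹ * ((a : ℂ) + Complex.I * (b : ℂ)) =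
      (((a / 2 ^ r : ℤ) : ℂ) - (2 ^ r : ℂ)⁻¹ * (a : ℂ)) +
        Complex.I * (((b / 2 ^ r : ℤ) : ℂ) - (2 ^ r : ℂ)⁻¹ * (b : ℂ)) := by ring
  rw [e]
  refine (norm_add_le _ _).trans ?_
  rw [norm_mul, Complex.norm_I, one_mul]
  linarith [fl a, fl b]

/-- Fixed-point multiplication of complex polynomials with `2 ^ t` coefficients. -/
theorem exists_pairMul {t : ℕ} (hκ : mulComplexity (2 * M) + 50 * M ≤ κ)
    (hM : 2 * w + t + 2 ≤ M) (hdvd : ∀ t' ≤ t, 2 ^ t' ∣ M) (hP : P + b ≤ w)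
    (A B : (I → Bool) → ℤ[X] × ℤ[X]) :
    ∃ Z : (I → Bool) → ℤ[X] × ℤ[X], Computes ((24 * t + 41) * 2 ^ t * κ)
      (pairBits (w + 1) (2 ^ t) A ∪ pairBits (w + 1) (2 ^ t) B)
      (pairBits (w + 1) (2 ^ (t + 1)) Z) ∧
      ∀ x, l1 (fixedPoly P (A x)) < 2 ^ b → l1 (fixedPoly P (B x)) < 2 ^ b →
        l1 (fixedPoly P (Z x) - lowPart (2 ^ t) (fixedPoly P (A x)) *
          lowPart (2 ^ t) (fixedPoly P (B x))) ≤ 2 ^ (t + 1) * (2 * (2 ^ P : ℝ)⁻¹) := by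
  set N := 2 ^ t with hN
  have hNN : 2 ^ (t + 1) = N + N := by rw [pow_succ]; omega
  -- The circuit multiplies signed words; only under the norm bounds of the last clause do they
  -- agree with the given coefficients.
  let wd : ℤ[X] → ℤ[X] := wordPoly w N
  have hz : ∀ (A : (I → Bool) → ℤ[X]) x i, N ≤ i → (wd (A x)).coeff i = 0 := fun A x i hi => by
    simp only [wd, coeff_wordPoly, if_neg (not_lt.2 hi)]
  have prod : ∀ A B : (I → Bool) → ℤ[X], Computes ((6 * t + 10) * N * κ)
      (polyBits (w + 1) N A ∪ polyBits (w + 1) N B)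
      (polyBits M (2 ^ (t + 1)) fun x => wd (A x) * wd (B x)) := by
    intro A B
    have := Computes.intPolyMul hκ hM hdvd (fun x => wd (A x)) (fun x => wd (B x))
      (fun x i => wordPoly_range _ _ _ _) (fun x i => wordPoly_range _ _ _ _) (hz A) (hz B)
    rwa [polyBits_wordPoly, polyBits_wordPoly] at this
  set Cr : (I → Bool) → ℤ[X] := fun x => wd (A x).1 * wd (B x).1 - wd (A x).2 * wd (B x).2
  set Ci : (I → Bool) → ℤ[X] := fun x => wd (A x).1 * wd (B x).2 + wd (A x).2 * wd (B x).1
  -- The integer products carry `2 * P` fractional bits; rounding down by `2 ^ P` restores the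
  -- format.
  let fl : ℤ[X] → ℤ[X] := fun p => ∑ i ∈ Finset.range (2 ^ (t + 1)), monomial i (p.coeff i / 2 ^ P)
  have hfl : ∀ p i, (fl p).coeff i = if i < 2 ^ (t + 1) then p.coeff i / 2 ^ P else 0 := by
    intro p i
    simp [fl, finsetSum_coeff, coeff_monomial]
  have hflb : ∀ p : (I → Bool) → ℤ[X],
      polyBits (w + 1) (2 ^ (t + 1)) (fun x => fl (p x)) ⊆ polyBits M (2 ^ (t + 1)) p := by
    intro p
    refine Set.iUnion₂_subset fun i hi => ?_
    rw [funext fun x => (hfl (p x) i).trans (if_pos hi)]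
    exact (bits_ediv_subset _).trans ((bits_mono (by omega)).trans (bits_subset_polyBits p hi))
  refine ⟨fun x => (fl (Cr x), fl (Ci x)), ?_, fun x hA hB => ?_⟩
  · have l1 := Set.subset_union_left (s := polyBits (w + 1) N fun x => (A x).1)
      (t := polyBits (w + 1) N fun x => (A x).2)
    have r1 := Set.subset_union_right (s := polyBits (w + 1) N fun x => (A x).1)
      (t := polyBits (w + 1) N fun x => (A x).2)
    have l2 := Set.subset_union_left (s := polyBits (w + 1) N fun x => (B x).1)
      (t := polyBits (w + 1) N fun x => (B x).2)
    have r2 := Set.subset_union_right (s := polyBits (w + 1) N fun x => (B x).1)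
      (t := polyBits (w + 1) N fun x => (B x).2)
    have c1 := ((prod _ _).mono_left (Set.union_subset_union l1 l2)).union
      ((prod _ _).mono_left (Set.union_subset_union r1 r2))
    have c2 := ((prod _ _).mono_left (Set.union_subset_union l1 r2)).union
      ((prod _ _).mono_left (Set.union_subset_union r1 l2))
    have c3 := (c1.trans (Computes.polySub M (2 ^ (t + 1)) _ _)).mono_right (hflb Cr)
    have c4 := (c2.trans (Computes.polyAdd M (2 ^ (t + 1)) _ _)).mono_right (hflb Ci)
    refine (c3.union c4).mono_cost ?_
    rw [hNN]
    have : N * (50 * M) ≤ N * κ := Nat.mul_le_mul_left _ (by omega)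
    calc _ = 4 * ((6 * t + 10) * N * κ) + 20 * (N * M) := by ring
      _ ≤ 4 * ((6 * t + 10) * N * κ) + N * κ := by
        have : N * (50 * M) = 50 * (N * M) := by ring
        omega
      _ = _ := by ring
  · have hA1 := wordPoly_eq (N := N) fun i => (abs_coeff_lt_of_l1 hP hA i).1
    have hA2 := wordPoly_eq (N := N) fun i => (abs_coeff_lt_of_l1 hP hA i).2
    have hB1 := wordPoly_eq (N := N) fun i => (abs_coeff_lt_of_l1 hP hB i).1
    have hB2 := wordPoly_eq (N := N) fun i => (abs_coeff_lt_of_l1 hP hB i).2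
    have hmul : lowPart N (fixedPoly P (A x)) * lowPart N (fixedPoly P (B x)) =
        C ((2 ^ P : ℂ)⁻¹) * fixedPoly P (Cr x, Ci x) := by
      rw [← fixedPoly_pairLow, ← fixedPoly_pairLow]
      simp only [fixedPoly, pairLow, Cr, Ci, wd, hA1, hA2, hB1, hB2, Polynomial.map_sub,
        Polynomial.map_add, Polynomial.map_mul]
      have hI : (C Complex.I : ℂ[X]) * C Complex.I = -1 := by
        rw [← C_mul, Complex.I_mul_I]; simp
      linear_combination (C ((2 ^ P : ℂ)⁻¹) * C ((2 ^ P : ℂ)⁻¹) *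
        map (Int.castRingHom ℂ) (lowPart N (A x).2) *
        map (Int.castRingHom ℂ) (lowPart N (B x).2)) * hI
    have hC0 : ∀ i, 2 ^ (t + 1) ≤ i → (Cr x).coeff i = 0 ∧ (Ci x).coeff i = 0 := by
      intro i hi
      have hm : ∀ p q : ℤ[X], (wd p * wd q).coeff i = 0 := by
        intro p q
        rw [coeff_mul]
        refine Finset.sum_eq_zero fun ij hij => ?_
        replace hij := Finset.HasAntidiagonal.mem_antidiagonal.1 hij
        rcases Nat.lt_or_ge ij.1 N with h | h
        · rw [hz (fun _ => q) x ij.2 (by omega), mul_zero]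
        · rw [hz (fun _ => p) x ij.1 h, zero_mul]
      simp only [Cr, Ci, coeff_sub, coeff_add, hm]
      simp
    rw [hmul]
    have hdeg : (fixedPoly P (fl (Cr x), fl (Ci x)) -
        C ((2 ^ P : ℂ)⁻¹) * fixedPoly P (Cr x, Ci x)).degree < (2 ^ (t + 1) : ℕ) := by
      rw [degree_lt_iff_coeff_zero]
      intro i hi
      rw [coeff_sub, coeff_C_mul, coeff_fixedPoly, coeff_fixedPoly]
      simp [hfl, (hC0 i hi).1, (hC0 i hi).2, not_lt.2 hi]
    refine (l1_le_mul hdeg (c := 2 * (2 ^ P : ℝ)⁻¹) fun i => ?_).trans (by push_cast; rfl)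
    rcases Nat.lt_or_ge i (2 ^ (t + 1)) with hi | hi
    · rw [coeff_sub, coeff_C_mul, coeff_fixedPoly, coeff_fixedPoly]
      simp only [hfl, if_pos hi]
      exact norm_floor_error P P _ _
    · rw [(degree_lt_iff_coeff_zero _ _).1 hdeg i hi, norm_zero]
      positivity

end Circuits

/-! ### Circuits for inversion and division -/

section Division

variable {I : Type} {M w P b κ h : ℕ}

/-- Inversion of `1 + …` modulo `X ^ (2 ^ i)` by Newton's iteration. -/
theorem exists_newtonInverse (hκ : mulComplexity (2 * M) + 50 * M ≤ κ)
    (hM : 2 * w + h + 2 ≤ M) (hdvd : ∀ t' ≤ h, 2 ^ t' ∣ M) (hP : P + b ≤ w) (hb : 4 ≤ b)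
    {η : ℝ} (hη : 2 ^ (h + 1) * (2 * (2 ^ P : ℝ)⁻¹) = η)
    (m' : (I → Bool) → ℤ[X] × ℤ[X]) (i : ℕ) (hi : i ≤ h) :
    ∃ g : (I → Bool) → ℤ[X] × ℤ[X], Computes (96 * (i + 1) * 2 ^ i * κ)
      (pairBits (w + 1) (2 ^ h) m') (pairBits (w + 1) (2 ^ i) g) ∧
      ∀ (x : I → Bool) (m G : ℂ[X]) (δ : ℝ), m.coeff 0 = 1 → l1 m ≤ 3 / 2 → l1 G ≤ 2 →
        X ^ 2 ^ h ∣ m * G - 1 → l1 (fixedPoly P (m' x) - m) ≤ δ → δ ≤ 1 →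
        9 ^ h * (4 * η + 9 * δ) ≤ 1 →
        l1 (fixedPoly P (g x) - lowPart (2 ^ i) G) ≤ 9 ^ i * (4 * η + 9 * δ) := by
  have hη0 : 0 ≤ η := hη ▸ by positivity
  induction i with
  | zero =>
    refine ⟨fun _ => (C (1 * 2 ^ P), 0), ?_, fun x m G δ hm0 hm hG hmG hδ _ _ => ?_⟩
    · refine ((Computes.pair_free (d := 0) (A := m') fun i _ => Or.inr
        ⟨(C (1 * 2 ^ P : ℤ)).coeff i, 0, fun x => by simp⟩).mono_cost
        (Nat.zero_le _)).mono_left ?_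
      exact pairBits_mono (Nat.zero_le _) _
    -- The iteration can start from the constant one, since `m * G` and `m` both have constant term
    -- one.
    · have h1 : lowPart (2 ^ 0) G = 1 := by
        have h2 : (X : ℂ[X]) ∣ m * G - 1 := dvd_trans (dvd_pow_self _ (by positivity)) hmG
        rw [X_dvd_iff, coeff_sub, mul_coeff_zero, hm0, one_mul, coeff_one_zero, sub_eq_zero] at h2
        ext j
        rw [coeff_lowPart, coeff_one]
        rcases Nat.eq_zero_or_pos j with rfl | hj
        · simp [h2]
        · rw [if_neg (by simpa using hj.ne'), if_neg (by omega)]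
      have hδ0 : 0 ≤ δ := (l1_nonneg _).trans hδ
      rw [h1, fixedPoly_C]
      simp [l1]
      positivity
  | succ i ih =>
    obtain ⟨g, hg, hgspec⟩ := ih (by omega)
    set D := 2 ^ i with hD
    have hDD : 2 ^ (i + 1) = D + D := by rw [pow_succ]; omega
    have hDh : D + D ≤ 2 ^ h := by rw [← hDD]; exact Nat.pow_le_pow_right (by norm_num) hi
    set gl : (I → Bool) → ℤ[X] × ℤ[X] := fun x => pairLow D (g x)
    obtain ⟨Z₁, hZ₁, hZ₁s⟩ := exists_pairMul (t := i + 1) hκ (by omega)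
      (fun t' ht' => hdvd t' (by omega)) hP m' gl
    set p : (I → Bool) → ℤ[X] × ℤ[X] := fun x => pairLow (D + D) (Z₁ x)
    set s : (I → Bool) → ℤ[X] × ℤ[X] := fun x => (C (2 * 2 ^ P), 0) - p x
    obtain ⟨Z₂, hZ₂, hZ₂s⟩ := exists_pairMul (t := i + 1) hκ (by omega)
      (fun t' ht' => hdvd t' (by omega)) hP gl s
    rw [hDD] at hZ₁ hZ₂ hZ₁s hZ₂s ⊢
    refine ⟨fun x => pairLow (D + D) (Z₂ x), ?_, fun x m G δ hm0 hm hG hmG hδ hδ1 hsmall => ?_⟩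
    · have hle : D + D ≤ 2 ^ (i + 1 + 1) := by rw [pow_succ, hDD]; omega
      set S := pairBits (w + 1) (2 ^ h) m'
      have c1 : Computes (96 * (i + 1) * D * κ) S (pairBits (w + 1) (D + D) gl) :=
        (hg.trans (Computes.pairLow le_rfl g)).mono_cost (by omega)
      have c2 : Computes 0 S (pairBits (w + 1) (D + D) m') :=
        Computes.of_subset (pairBits_mono hDh m')
      have c3 : Computes ((24 * (i + 1) + 41) * (D + D) * κ)
          (S ∪ pairBits (w + 1) (D + D) gl) (pairBits (w + 1) (D + D) p) := by
        refine (((c2.mono_left Set.subset_union_left).union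
          (Computes.of_subset Set.subset_union_right)).trans
          (hZ₁.trans (Computes.pairLow hle Z₁))).mono_cost (by omega)
      have c4 : Computes ((D + D) * (10 * (w + 1))) (pairBits (w + 1) (D + D) p)
          (pairBits (w + 1) (D + D) s) := by
        have k : Computes 0 (pairBits (w + 1) (D + D) p)
            (pairBits (w + 1) (D + D) fun _ : I → Bool => (C (2 * 2 ^ P : ℤ), (0 : ℤ[X]))) :=
          Computes.pair_free fun j _ => Or.inr ⟨(C (2 * 2 ^ P : ℤ)).coeff j, 0, fun x => by simp⟩
        exact ((k.union (Computes.of_subset subset_rfl)).trans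
          (Computes.pairSub (w + 1) (D + D) _ p)).mono_cost (by omega)
      have c5 := c1.trans' (((Computes.of_subset (Set.subset_union_right (s := S))).union
        (c3.trans c4)).trans (hZ₂.trans (Computes.pairLow (d' := D + D) hle Z₂)))
      refine c5.mono_cost ?_
      have e : D * (20 * (w + 1)) ≤ D * κ := Nat.mul_le_mul_left _ (by omega)
      calc _ = 96 * (i + 1) * D * κ + (96 * (i + 1) + 164) * (D * κ) + D * (20 * (w + 1)) := by ring
        _ ≤ 96 * (i + 1) * D * κ + (96 * (i + 1) + 164) * (D * κ) + D * κ := by omega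
        _ ≤ 96 * (i + 1) * D * κ + (96 * (i + 1) + 192) * (D * κ) := by
          have : (96 * (i + 1) + 192) * (D * κ) =
            (96 * (i + 1) + 164) * (D * κ) + 28 * (D * κ) := by ring
          omega
        _ = _ := by ring
    · have hδ0 : 0 ≤ δ := (l1_nonneg _).trans hδ
      set c := 4 * η + 9 * δ with hc
      have hc0 : 0 ≤ c := by positivity
      have hpow : ∀ j ≤ h, (9 : ℝ) ^ j * c ≤ 1 := fun j hj =>
        (mul_le_mul_of_nonneg_right (pow_le_pow_right₀ (by norm_num) hj) hc0).trans hsmall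
      have hc1 : c ≤ 1 := by simpa using hpow 0 (by omega)
      have he := hgspec x m G δ hm0 hm hG hmG hδ hδ1 hsmall
      have he1 := hpow i (by omega)
      -- Four integer bits suffice: the iterate has norm at most 3, the operand at most `5 / 2`, and
      -- `s` at most `2 + η + 15 / 2 < 16`.
      have hb16 : (16 : ℝ) ≤ 2 ^ b := by
        calc (16 : ℝ) = 2 ^ 4 := by norm_num
          _ ≤ 2 ^ b := pow_le_pow_right₀ (by norm_num) hb
      have hgl : l1 (fixedPoly P (gl x) - lowPart D G) ≤ 9 ^ i * c := by
        simp only [gl]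
        rw [fixedPoly_pairLow, ← lowPart_lowPart (le_refl D) G, ← lowPart_sub]
        exact (l1_lowPart_le _ _).trans he
      have hgl3 : l1 (fixedPoly P (gl x)) ≤ 3 := by
        have := l1_le_add (fixedPoly P (gl x)) (lowPart D G)
        have := l1_lowPart_le D G
        linarith
      have hm'l : l1 (fixedPoly P (m' x)) ≤ 5 / 2 := by
        have := l1_le_add (fixedPoly P (m' x)) m
        linarith
      have hη' : (2 : ℝ) ^ (i + 1 + 1) * (2 * (2 ^ P : ℝ)⁻¹) ≤ η := by
        rw [← hη]
        exact mul_le_mul_of_nonneg_right (pow_le_pow_right₀ (by norm_num) (by omega))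
          (by positivity)
      have hprod : ∀ (a b z : ℂ[X]), l1 (z - lowPart (D + D) a * lowPart (D + D) b) ≤ η →
          l1 (lowPart (D + D) z - lowPart (D + D) (a * b)) ≤ η := by
        intro a b z hz
        rw [← lowPart_lowPart_mul, ← lowPart_mul_lowPart, ← lowPart_sub]
        exact (l1_lowPart_le _ _).trans hz
      have hp : l1 (fixedPoly P (p x) -
          lowPart (D + D) (fixedPoly P (m' x) * fixedPoly P (gl x))) ≤ η := by
        simp only [p]
        rw [fixedPoly_pairLow]
        exact hprod _ _ _ ((hZ₁s x (by linarith) (by linarith)).trans hη')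
      have hs : fixedPoly P (s x) = 2 - fixedPoly P (p x) := by
        simp only [s]
        rw [fixedPoly_sub, fixedPoly_C]
        simp
        exact map_ofNat C 2
      have hsl : l1 (fixedPoly P (s x)) < 2 ^ b := by
        rw [hs]
        have a1 := l1_sub_le 2 (fixedPoly P (p x))
        rw [l1_two] at a1
        have a2 := l1_le_add (fixedPoly P (p x))
          (lowPart (D + D) (fixedPoly P (m' x) * fixedPoly P (gl x)))
        have a3 := (l1_lowPart_le (D + D) (fixedPoly P (m' x) * fixedPoly P (gl x))).trans
          (l1_mul_le_of_le hm'l hgl3)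
        linarith
      have hg' : l1 (fixedPoly P (pairLow (D + D) (Z₂ x)) -
          lowPart (D + D) (fixedPoly P (gl x) * fixedPoly P (s x))) ≤ η := by
        rw [fixedPoly_pairLow]
        exact hprod _ _ _ ((hZ₂s x (by linarith) hsl).trans hη')
      have := newton_error hm hG ((pow_dvd_pow _ hDh).trans hmG) hgl he1 hδ hp hs hg'
      refine this.trans ?_
      -- A step gives `8 * 9 ^ i * c + c`, and the surplus ninth multiple of `9 ^ i * c` absorbs the
      -- new `c`.
      have h9 : (1 : ℝ) ≤ 9 ^ i := one_le_pow₀ (by norm_num)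
      rw [pow_succ]
      nlinarith

/-- Division with remainder in fixed-point arithmetic. -/
theorem exists_pairMod (hκ : mulComplexity (2 * M) + 50 * M ≤ κ)
    (hM : 2 * w + h + 2 ≤ M) (hdvd : ∀ t' ≤ h, 2 ^ t' ∣ M) (hP : P + b ≤ w) (hb : 4 ≤ b)
    {η : ℝ} (hη : 2 ^ (h + 1) * (2 * (2 ^ P : ℝ)⁻¹) = η) {d : ℕ} (hd : d ≤ 2 ^ h)
    (A m₀ : (I → Bool) → ℤ[X] × ℤ[X]) :
    ∃ Z : (I → Bool) → ℤ[X] × ℤ[X], Computes (180 * (h + 1) * 2 ^ h * κ)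
      (pairBits (w + 1) (2 ^ (h + 1)) A ∪ pairBits (w + 1) (2 ^ h) m₀)
      (pairBits (w + 1) (2 ^ h) Z) ∧
      ∀ (x : I → Bool) (f m : ℂ[X]) (Φ E δ : ℝ), f.degree < (d + 2 ^ h : ℕ) → m.degree < d →
        l1 m ≤ 1 / 2 → l1 f ≤ Φ → l1 (fixedPoly P (A x) - f) ≤ E →
        l1 (lowPart d (fixedPoly P (m₀ x)) - m) ≤ δ → 9 ^ h * (4 * η + 9 * δ) ≤ 1 →
        E ≤ Φ → 1 ≤ Φ → 8 * Φ < 2 ^ b →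
        l1 (f %ₘ (X ^ d + m)) ≤ 2 * Φ ∧
        l1 (fixedPoly P (Z x) - f %ₘ (X ^ d + m)) ≤
          4 * E + Φ * (9 ^ h * (4 * η + 9 * δ) + 2 * δ) + 2 * η := by
  set D := 2 ^ h with hD
  have hD1 : 1 ≤ D := Nat.one_le_two_pow
  have hDD : 2 ^ (h + 1) = D + D := by rw [pow_succ]; omega
  have hη0 : 0 ≤ η := hη ▸ by positivity
  rw [hDD]
  set μ : (I → Bool) → ℤ[X] × ℤ[X] := fun x => pairLow d (m₀ x)
  -- The leading coefficient of the divisor is taken to be exactly one and not read from the input,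
  -- so the reversed divisor has constant term exactly one.
  set m' : (I → Bool) → ℤ[X] × ℤ[X] := fun x => (C (1 * 2 ^ P), 0) + pairReflect d (μ x)
  obtain ⟨g, hg, hgs⟩ := exists_newtonInverse hκ hM hdvd hP hb hη m' h le_rfl
  -- The dividend is reversed at the largest degree it may have; only the lowest `D` coefficients of
  -- the reversal enter the quotient.
  set F : (I → Bool) → ℤ[X] × ℤ[X] := fun x => pairReflect (d + (D - 1)) (A x)
  obtain ⟨Z₁, hZ₁, hZ₁s⟩ := exists_pairMul hκ hM hdvd hP F g
  set q : (I → Bool) → ℤ[X] × ℤ[X] := fun x => pairReflect (D - 1) (pairLow D (Z₁ x))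
  obtain ⟨Z₂, hZ₂, hZ₂s⟩ := exists_pairMul hκ hM hdvd hP q μ
  rw [hDD] at hZ₁ hZ₂
  rw [← hD] at hg hZ₁ hZ₂ hgs hZ₁s hZ₂s
  refine ⟨fun x => pairLow d (A x - Z₂ x), ?_,
    fun x f m Φ E δ hf hm hml hfl hE hδ hsmall hEΦ hΦ hΦb => ?_⟩
  · set S := pairBits (w + 1) (D + D) A ∪ pairBits (w + 1) D m₀
    have cA : Computes 0 S (pairBits (w + 1) D A) :=
      Computes.of_subset ((pairBits_mono (by omega) A).trans Set.subset_union_left)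
    have cμ : Computes 0 S (pairBits (w + 1) D μ) :=
      (Computes.pairLow hd m₀).mono_left Set.subset_union_right
    have cm : Computes 0 (pairBits (w + 1) D μ) (pairBits (w + 1) D m') := by
      refine Computes.pair_free fun i hi => ?_
      rcases Nat.eq_zero_or_pos i with rfl | hi0
      · refine Or.inr ⟨2 ^ P, 0, fun x => ?_⟩
        simp only [m', μ, pairReflect, Prod.fst_add, Prod.snd_add, coeff_add, coeff_reflect,
          pairLow, coeff_lowPart, revAt_le (Nat.zero_le d), coeff_C_zero]
        simp
      · have hC : (C (1 * 2 ^ P) : ℤ[X]).coeff i = 0 := by rw [coeff_C, if_neg (by omega)]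
        rcases Nat.lt_or_ge d i with hdi | hdi
        · refine Or.inr ⟨0, 0, fun x => ?_⟩
          simp only [m', μ, pairReflect, Prod.fst_add, Prod.snd_add, coeff_add, coeff_reflect,
            pairLow, coeff_lowPart, revAt_eq_self_of_lt hdi, if_neg (not_lt.2 hdi.le), hC]
          simp
        · refine Or.inl ⟨d - i, by omega, fun x => ?_⟩
          simp only [m', pairReflect, Prod.fst_add, Prod.snd_add, coeff_add, coeff_reflect,
            revAt_le hdi, hC]
          simp
    have cF : Computes 0 S (pairBits (w + 1) D F) := by
      refine (Computes.pair_free (A := A) (d := D + D) fun i hi =>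
        Or.inl ⟨d + (D - 1) - i, by omega, fun x => ?_⟩).mono_left Set.subset_union_left
      simp only [F, pairReflect, coeff_reflect, revAt_le (show i ≤ d + (D - 1) by omega)]
      simp
    have cq : Computes 0 (pairBits (w + 1) (D + D) Z₁) (pairBits (w + 1) D q) := by
      refine Computes.pair_free fun i hi => Or.inl ⟨D - 1 - i, by omega, fun x => ?_⟩
      simp only [q, pairReflect, coeff_reflect, revAt_le (show i ≤ D - 1 by omega), pairLow,
        coeff_lowPart, if_pos (show D - 1 - i < D by omega)]
      simp
    have c1 := cF.union (cμ.trans (cm.trans hg))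
    have c2 := (c1.trans (hZ₁.trans cq)).union cμ
    have c3 := cA.union ((c2.trans hZ₂).mono_right (pairBits_mono (by omega : D ≤ D + D) Z₂))
    refine (c3.trans ((Computes.pairSub (w + 1) D A Z₂).trans
      (Computes.pairLow hd fun x => A x - Z₂ x))).mono_cost ?_
    have e : D * (10 * (w + 1)) ≤ D * κ := Nat.mul_le_mul_left _ (by omega)
    calc _ = (144 * h + 178) * (D * κ) + D * (10 * (w + 1)) := by ring
      _ ≤ (144 * h + 178) * (D * κ) + D * κ := by omega
      _ ≤ (144 * h + 178) * (D * κ) + (36 * h + 2) * (D * κ) := by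
        have : (36 * h + 2) * (D * κ) = (36 * h + 1) * (D * κ) + D * κ := by ring
        omega
      _ = _ := by ring
  · have hδ0 : 0 ≤ δ := (l1_nonneg _).trans hδ
    have hE0 : 0 ≤ E := (l1_nonneg _).trans hE
    set e := 9 ^ h * (4 * η + 9 * δ) with he
    have h9 : (1 : ℝ) ≤ 9 ^ h := one_le_pow₀ (by norm_num)
    have hc : 4 * η + 9 * δ ≤ 1 := by
      have : 0 ≤ 4 * η + 9 * δ := by positivity
      nlinarith
    have hX : X ∣ reflect d m := by
      rw [X_dvd_iff, coeff_reflect, revAt_le (Nat.zero_le d)]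
      exact (degree_lt_iff_coeff_zero _ _).1 hm _ (by omega)
    obtain ⟨G, hG, hmG⟩ := exists_inverse_mod_X_pow hX (by rwa [l1_reflect]) D
    have hμ : fixedPoly P (μ x) = lowPart d (fixedPoly P (m₀ x)) := fixedPoly_pairLow _ _ _
    have hm'x : fixedPoly P (m' x) = 1 + reflect d (fixedPoly P (μ x)) := by
      simp only [m']
      rw [fixedPoly_add, fixedPoly_C, fixedPoly_pairReflect]
      simp
    have hge := hgs x (1 + reflect d m) G δ (by
        rw [coeff_add, coeff_one_zero, X_dvd_iff.1 hX, add_zero])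
      (by
        have := l1_add_le 1 (reflect d m)
        rw [l1_one, l1_reflect] at this
        linarith) hG hmG
      (by rwa [hm'x, add_sub_add_left_eq_sub, ← reflect_sub', l1_reflect, hμ])
      (by linarith) hsmall
    have hQ : l1 (fixedPoly P (F x)) < 2 ^ b := by
      simp only [F]
      rw [fixedPoly_pairReflect, l1_reflect]
      have := l1_le_add (fixedPoly P (A x)) f
      linarith
    have hb16 : (16 : ℝ) ≤ 2 ^ b := by
      calc (16 : ℝ) = 2 ^ 4 := by norm_num
        _ ≤ 2 ^ b := pow_le_pow_right₀ (by norm_num) hb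
    have hgl : l1 (fixedPoly P (g x)) ≤ 3 := by
      have := l1_le_add (fixedPoly P (g x)) (lowPart D G)
      have := l1_lowPart_le D G
      linarith
    have hZ1 := hZ₁s x hQ (by linarith)
    rw [hη] at hZ1
    have hQ' : l1 (fixedPoly P (pairLow D (Z₁ x)) - lowPart D (lowPart D
        (reflect (d + (D - 1)) (fixedPoly P (A x))) * fixedPoly P (g x))) ≤ η := by
      rw [fixedPoly_pairLow, ← lowPart_mul_lowPart, ← lowPart_sub]
      refine (l1_lowPart_le _ _).trans ?_
      rwa [← fixedPoly_pairReflect]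
    obtain ⟨r1, r2, r3⟩ := divMod_error (w := fixedPoly P (Z₂ x)) hD1 hf hm hmG hml hG hfl hE hge
      hsmall (hμ ▸ hδ) (by linarith) hQ'
    refine ⟨r1, ?_⟩
    have hqx : fixedPoly P (q x) = reflect (D - 1) (fixedPoly P (pairLow D (Z₁ x))) :=
      fixedPoly_pairReflect _ _ _
    have hμl : l1 (fixedPoly P (μ x)) ≤ 1 := by
      have := l1_le_add (fixedPoly P (μ x)) m
      rw [hμ] at this ⊢
      linarith
    have hΦe : Φ * e ≤ Φ * 1 := mul_le_mul_of_nonneg_left hsmall (by linarith)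
    have hZ2 := hZ₂s x (by rw [hqx]; linarith) (by linarith)
    rw [hη] at hZ2
    have hql : lowPart D (fixedPoly P (q x)) = reflect (D - 1) (fixedPoly P (pairLow D (Z₁ x))) := by
      rw [← hqx]
      apply lowPart_eq_self
      rw [degree_lt_iff_coeff_zero]
      intro i hi
      rw [hqx, coeff_reflect, revAt_eq_self_of_lt (by omega), fixedPoly_pairLow, coeff_lowPart,
        if_neg (by omega)]
    have hμl' : lowPart D (fixedPoly P (μ x)) = fixedPoly P (μ x) := by
      apply lowPart_eq_self
      rw [hμ]
      exact (degree_lowPart_lt _ _).trans_le (by exact_mod_cast hd)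
    rw [hql, hμl'] at hZ2
    have := r3 hZ2
    rwa [fixedPoly_pairLow, fixedPoly_sub]

end Division

/-! ### The circuit for the remainder tree -/

section Tree

variable {I : Type} {M w P b κ k n : ℕ}

/-- On each level the nodes together cost at most `180 * k * 2 ^ k * κ`, as halving the size doubles
the number of nodes. Norms double per level, and errors obey `E ↦ 4 * E + B` with one `B` valid
throughout the tree, which yields `5 ^ d * (E + B)` at depth `d`. The last smallness condition keeps
these errors below the norm bound, as each division requires. -/
theorem exists_fanOutCircuit (hκ : mulComplexity (2 * M) + 50 * M ≤ κ)
    (hM : 2 * w + k + 2 ≤ M) (hdvd : ∀ t ≤ k, 2 ^ t ∣ M) (hP : P + b ≤ w) (hb : 4 ≤ b)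
    (hnk : n ≤ 2 ^ k) {η : ℝ} (hη : 2 ^ k * (2 * (2 ^ P : ℝ)⁻¹) = η)
    (S : Set ((I → Bool) → Bool)) (A₀ : (I → Bool) → ℤ[X] × ℤ[X])
    (m₀ : ℕ → ℕ → (I → Bool) → ℤ[X] × ℤ[X])
    (hA₀ : Computes 0 S (pairBits (w + 1) (2 ^ k) A₀))
    (hm₀ : ∀ h < k, ∀ j < 2 ^ (k - h), Computes 0 S (pairBits (w + 1) (2 ^ h) (m₀ h j))) :
    ∃ R : ℕ → ℕ → (I → Bool) → ℤ[X] × ℤ[X],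
      Computes (k * (180 * k * 2 ^ k * κ)) S
        (⋃ d, ⋃ _ : d ≤ k, ⋃ j, ⋃ _ : j < 2 ^ d, pairBits (w + 1) (2 ^ (k - d)) (R d j)) ∧
      ∀ (x : I → Bool) (z : Fin n → ℂ) (v : ℂ[X]) (a Φ E δ : ℝ), v.degree < n → 0 ≤ a →
        (∀ i, ‖z i‖ ≤ a) → 2 ^ k * a ≤ 1 / 4 → l1 v ≤ Φ → l1 (fixedPoly P (A₀ x) - v) ≤ E →
        (∀ h < k, ∀ j < 2 ^ (k - h), l1 (lowPart (supermodulusDegree n h j)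
          (fixedPoly P (m₀ h j x)) - lowPart (supermodulusDegree n h j) (supermodulus z h j)) ≤ δ) →
        0 ≤ δ → 9 ^ k * (4 * η + 9 * δ) ≤ 1 → 1 ≤ Φ → 8 * (2 ^ k * Φ) < 2 ^ b →
        5 ^ k * (E + (2 ^ k * Φ * (9 ^ k * (4 * η + 9 * δ) + 2 * δ) + 2 * η)) ≤ Φ →
        ∀ d ≤ k, ∀ j < 2 ^ d, l1 (fanOutAtDepth z v k d j) ≤ 2 ^ d * Φ ∧
          l1 (fixedPoly P (R d j x) - fanOutAtDepth z v k d j) ≤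
          5 ^ d * (E + (2 ^ k * Φ * (9 ^ k * (4 * η + 9 * δ) + 2 * δ) + 2 * η)) := by
  have hη0 : 0 ≤ η := hη ▸ by positivity
  -- The claim is vacuous outside the tree, so that the choice of `Z` is total and `R` can be
  -- defined by recursion on the depth.
  have step : ∀ h j A, ∃ Z : (I → Bool) → ℤ[X] × ℤ[X], h < k →
      Computes (180 * (h + 1) * 2 ^ h * κ)
        (pairBits (w + 1) (2 ^ (h + 1)) A ∪ pairBits (w + 1) (2 ^ h) (m₀ h j))
        (pairBits (w + 1) (2 ^ h) Z) ∧
      ∀ (x : I → Bool) (f m : ℂ[X]) (Φ E δ : ℝ),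
        f.degree < (supermodulusDegree n h j + 2 ^ h : ℕ) → m.degree < supermodulusDegree n h j →
        l1 m ≤ 1 / 2 → l1 f ≤ Φ → l1 (fixedPoly P (A x) - f) ≤ E →
        l1 (lowPart (supermodulusDegree n h j) (fixedPoly P (m₀ h j x)) - m) ≤ δ →
        9 ^ k * (4 * η + 9 * δ) ≤ 1 → E ≤ Φ → 1 ≤ Φ → 8 * Φ < 2 ^ b →
        l1 (f %ₘ (X ^ supermodulusDegree n h j + m)) ≤ 2 * Φ ∧
        l1 (fixedPoly P (Z x) - f %ₘ (X ^ supermodulusDegree n h j + m)) ≤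
          4 * E + Φ * (9 ^ k * (4 * η + 9 * δ) + 2 * δ) + 2 * η := by
    intro h j A
    by_cases hk : h < k
    · obtain ⟨Z, h1, h2⟩ := exists_pairMod (h := h) hκ (by omega) (fun t ht => hdvd t (by omega))
        hP hb rfl (supermodulusDegree_le n h j) A (m₀ h j)
      refine ⟨Z, fun _ => ⟨h1, fun x f m Φ E δ a1 a2 a3 a4 a5 a6 a7 a8 a9 a10 => ?_⟩⟩
      have hη' : 2 ^ (h + 1) * (2 * (2 ^ P : ℝ)⁻¹) ≤ η := by
        rw [← hη]
        exact mul_le_mul_of_nonneg_right (pow_le_pow_right₀ (by norm_num) hk) (by positivity)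
      have hδ0 : 0 ≤ δ := (l1_nonneg _).trans a6
      have h9 : (9 : ℝ) ^ h * (4 * (2 ^ (h + 1) * (2 * (2 ^ P : ℝ)⁻¹)) + 9 * δ) ≤
          9 ^ k * (4 * η + 9 * δ) :=
        mul_le_mul (pow_le_pow_right₀ (by norm_num) hk.le) (by linarith) (by positivity)
          (by positivity)
      obtain ⟨r1, r2⟩ := h2 x f m Φ E δ a1 a2 a3 a4 a5 a6 (h9.trans a7) a8 a9 a10
      refine ⟨r1, r2.trans ?_⟩
      have := mul_le_mul_of_nonneg_left (add_le_add_left h9 (2 * δ)) (by linarith : 0 ≤ Φ)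
      linarith
    · exact ⟨A, fun h => absurd h hk⟩
  choose Z hZ using step
  let R : ℕ → ℕ → (I → Bool) → ℤ[X] × ℤ[X] := fun d =>
    Nat.rec (fun _ => A₀) (fun d Rd j => Z (k - (d + 1)) j (Rd (j / 2))) d
  have hR : ∀ d j, R (d + 1) j = Z (k - (d + 1)) j (R d (j / 2)) := fun d j => rfl
  refine ⟨R, ?_, ?_⟩
  · have key : ∀ e ≤ k, Computes (e * (180 * k * 2 ^ k * κ)) S
        (⋃ d, ⋃ _ : d ≤ e, ⋃ j, ⋃ _ : j < 2 ^ d, pairBits (w + 1) (2 ^ (k - d)) (R d j)) := by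
      intro e
      induction e with
      | zero =>
        intro _
        refine (hA₀.mono_right ?_).mono_cost (Nat.zero_le _)
        refine Set.iUnion₂_subset fun d hd => Set.iUnion₂_subset fun j hj => ?_
        obtain rfl : d = 0 := by omega
        exact subset_rfl
      | succ e ih =>
        intro he
        have ih' := ih (by omega)
        set U := ⋃ d, ⋃ _ : d ≤ e, ⋃ j, ⋃ _ : j < 2 ^ d, pairBits (w + 1) (2 ^ (k - d)) (R d j)
          with hU
        have hsub : ∀ j < 2 ^ e, pairBits (w + 1) (2 ^ (k - e)) (R e j) ⊆ U := by
          intro j hj f hf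
          simp only [hU, Set.mem_iUnion]
          exact ⟨e, le_rfl, j, hj, hf⟩
        obtain ⟨h, hh⟩ : ∃ h, k = h + (e + 1) := ⟨k - (e + 1), by omega⟩
        have c1 : Computes (2 ^ (e + 1) * (180 * (h + 1) * 2 ^ h * κ)) (S ∪ U)
            (⋃ j, ⋃ _ : j < 2 ^ (e + 1), pairBits (w + 1) (2 ^ (k - (e + 1))) (R (e + 1) j)) := by
          refine Computes.iUnion_lt _ _ _ fun j hj => ?_
          have hh1 : k - (e + 1) = h := by omega
          have hh2 : k - e = h + 1 := by omega
          have hh3 : k - h = e + 1 := by omega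
          rw [hR, hh1]
          have hj2 : j / 2 < 2 ^ e := by rw [pow_succ] at hj; omega
          have e1 : Computes 0 (S ∪ U) (pairBits (w + 1) (2 ^ (h + 1)) (R e (j / 2))) :=
            Computes.of_subset ((hh2 ▸ hsub _ hj2).trans Set.subset_union_right)
          have e2 : Computes 0 (S ∪ U) (pairBits (w + 1) (2 ^ h) (m₀ h j)) :=
            (hm₀ h (by omega) j (by rwa [hh3])).mono_left Set.subset_union_left
          exact ((e1.union e2).trans (hZ h j (R e (j / 2)) (by omega)).1).mono_cost (by omega)
        refine (ih'.bind c1).mono ?_ subset_rfl ?_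
        · have : 2 ^ (e + 1) * (180 * (h + 1) * 2 ^ h * κ) ≤ 180 * k * 2 ^ k * κ := by
            have e3 : (2 : ℕ) ^ k = 2 ^ (e + 1) * 2 ^ h := by rw [hh, pow_add, mul_comm]
            calc _ = 180 * (h + 1) * 2 ^ k * κ := by rw [e3]; ring
              _ ≤ _ := by gcongr; omega
          rw [add_mul, one_mul]
          exact Nat.add_le_add_left this _
        · refine Set.iUnion₂_subset fun d hd => ?_
          rcases Nat.lt_or_ge e d with h' | h'
          · obtain rfl : d = e + 1 := by omega
            exact Set.subset_union_right
          · refine Set.Subset.trans ?_ Set.subset_union_left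
            exact Set.subset_iUnion₂ (s := fun d (_ : d ≤ e) => ⋃ j, ⋃ _ : j < 2 ^ d,
              pairBits (w + 1) (2 ^ (k - d)) (R d j)) d h'
    exact key k le_rfl
  · intro x z v a Φ E δ hv ha hz hak hvl hE hδ hδ0 hsmall hΦ hΦb hbig
    set B := 2 ^ k * Φ * (9 ^ k * (4 * η + 9 * δ) + 2 * δ) + 2 * η with hB
    have hE0 : 0 ≤ E := (l1_nonneg _).trans hE
    have hB0 : 0 ≤ B := by positivity
    intro d
    induction d with
    | zero =>
      intro _ j _
      refine ⟨by simpa [fanOutAtDepth] using hvl, ?_⟩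
      rw [pow_zero, one_mul]
      exact hE.trans (le_add_of_nonneg_right hB0)
    | succ d ih =>
      intro hd j hj
      have hj2 : j / 2 < 2 ^ d := by rw [pow_succ] at hj; omega
      obtain ⟨i1, i2⟩ := ih (by omega) (j / 2) hj2
      obtain ⟨h, hh⟩ : ∃ h, k = h + (d + 1) := ⟨k - (d + 1), by omega⟩
      have hh1 : k - (d + 1) = h := by omega
      have hh2 : k - d = h + 1 := by omega
      have hh3 : k - h = d + 1 := by omega
      have h2d : (2 : ℝ) ^ d ≤ 2 ^ k := pow_le_pow_right₀ (by norm_num) (by omega)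
      have h1d : (1 : ℝ) ≤ 2 ^ d := one_le_pow₀ (by norm_num)
      have h5d : (5 : ℝ) ^ d ≤ 5 ^ k := pow_le_pow_right₀ (by norm_num) (by omega)
      have h15d : (1 : ℝ) ≤ 5 ^ d := one_le_pow₀ (by norm_num)
      have hdeg := degree_fanOutAtDepth_lt z hv hnk d (j / 2) hj2
      rw [hh2] at hdeg
      rw [fanOutAtDepth_succ, hR, hh1,
        eq_X_pow_add_lowPart (monic_supermodulus z h j) (natDegree_supermodulus z h j)]
      -- The admissible error at this depth follows from the bound at the deepest level.
      have hEΦ : 5 ^ d * (E + B) ≤ 2 ^ d * Φ := by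
        have : 5 ^ d * (E + B) ≤ 5 ^ k * (E + B) := mul_le_mul_of_nonneg_right h5d (by positivity)
        nlinarith
      have hdΦ : (2 : ℝ) ^ d * Φ ≤ 2 ^ k * Φ := mul_le_mul_of_nonneg_right h2d (by linarith)
      obtain ⟨r1, r2⟩ := (hZ h j (R d (j / 2)) (by omega)).2 x (fanOutAtDepth z v k d (j / 2))
        (lowPart (supermodulusDegree n h j) (supermodulus z h j)) (2 ^ d * Φ) (5 ^ d * (E + B)) δ
        (hdeg.trans_le (by exact_mod_cast supermodulusDegree_parent_le n h j))
        (degree_lowPart_lt _ _) (l1_lowPart_supermodulus_le z ha hz hak (by omega) j) i1 i2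
        (hδ h (by omega) j (by rwa [hh3])) hsmall hEΦ (by nlinarith) (by linarith)
      refine ⟨by rw [pow_succ]; linarith, r2.trans ?_⟩
      have e1 : 2 ^ d * Φ * (9 ^ k * (4 * η + 9 * δ) + 2 * δ) + 2 * η ≤ B := by
        have := mul_le_mul_of_nonneg_right hdΦ
          (by positivity : 0 ≤ 9 ^ k * (4 * η + 9 * δ) + 2 * δ)
        linarith
      -- One fifth of the next bound pays for the additive term, the other four for the propagated
      -- error.
      have e2 : B ≤ 5 ^ d * (E + B) := by nlinarith
      rw [pow_succ]
      linarith

end Tree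

/-! ### Input and output in two's complement -/

/-- The integer with a given two's complement representation. -/
def intOfBits {w : ℕ} (b : Fin w → Bool) : ℤ :=
  ∑ i : Fin w, if b i then (if (i : ℕ) + 1 = w then -(2 : ℤ) ^ (i : ℕ) else 2 ^ (i : ℕ)) else 0

theorem realOfBits_eq (p : ℕ) {w : ℕ} (b : Fin w → Bool) :
    realOfBits p b = (intOfBits b : ℝ) / 2 ^ p := by
  unfold realOfBits intOfBits
  push_cast
  congr 1

theorem intOfBits_succ {w : ℕ} (f : ℕ → Bool) : intOfBits (fun i : Fin (w + 1) => f i) =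
    ∑ i ∈ Finset.range w, (f i).toInt * 2 ^ i - (f w).toInt * 2 ^ w := by
  rw [intOfBits, Fin.sum_univ_castSucc, Finset.sum_range, sub_eq_add_neg]
  congr 1
  · refine Finset.sum_congr rfl fun i _ => ?_
    have : (i : ℕ) + 1 ≠ w + 1 := by have := i.2; omega
    simp only [Fin.val_castSucc, this, if_false]
    cases f i <;> simp
  · simp only [Fin.val_last, if_true]
    cases f w <;> simp

theorem intOfBits_succ_spec {w : ℕ} (f : ℕ → Bool) :
    (-2 ^ w ≤ intOfBits (fun i : Fin (w + 1) => f i) ∧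
      intOfBits (fun i : Fin (w + 1) => f i) < 2 ^ w) ∧
    ∀ i < w + 1, ibit (intOfBits fun i : Fin (w + 1) => f i) i = f i := by
  have h := sum_toInt_mul_two_pow_lt f w
  have hp : (0 : ℤ) < 2 ^ w := by positivity
  rw [intOfBits_succ]
  refine ⟨?_, fun i hi => ?_⟩
  · cases f w <;> simp <;> constructor <;> linarith
  · rw [← ibit_sum f hi]
    refine ibit_congr ?_ hi
    rw [Finset.sum_range_succ]
    -- Signed and unsigned readings of a word differ by a multiple of `2 ^ (w + 1)`, so they share
    -- their `w + 1` low bits.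
    have : ∀ S : ℤ, S - (f w).toInt * 2 ^ w =
        S + (f w).toInt * 2 ^ w + 2 ^ (w + 1) * (-(f w).toInt) := fun S => by ring
    rw [this, Int.add_mul_emod_self_left]

theorem intOfBits_ibit {w : ℕ} {z : ℤ} (hz : -2 ^ w ≤ z ∧ z < 2 ^ w) :
    intOfBits (fun i : Fin (w + 1) => ibit z i) = z := by
  obtain ⟨h1, h2⟩ := intOfBits_succ_spec (w := w) (ibit z)
  have h3 := emod_eq_of_ibit h2
  have h4 : ∀ z : ℤ, signedWord w z = (z % 2 ^ (w + 1) + 2 ^ w) % 2 ^ (w + 1) - 2 ^ w := by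
    intro z; simp [signedWord]
  refine (signedWord_eq h1).symm.trans (Eq.trans ?_ (signedWord_eq hz))
  rw [h4 (intOfBits _), h4 z, h3]

section InputOutput

variable {I : Type}

/-- The input bits. -/
def inputBits (I : Type) : Set ((I → Bool) → Bool) := {f | ∃ i : I, f = fun x => x i}

/-- Every bit of the represented integer is an input bit, the sign bit being repeated; a word of
width zero represents zero. -/
theorem Computes.intOfBits {w : ℕ} (e : Fin w → I) (W : ℕ) :
    Computes 0 (inputBits I) (bits W fun x => intOfBits fun i => x (e i)) := by
  cases w with
  | zero =>
    have : (fun x : I → Bool => _root_.intOfBits fun i => x (e i)) = fun _ => 0 := by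
      funext x; simp [_root_.intOfBits]
    rw [this]
    exact Computes.const _ _
  | succ w =>
    have hf : ∀ x : I → Bool, (fun i => x (e i)) = fun i : Fin (w + 1) =>
        (fun j : ℕ => if h : j < w + 1 then x (e ⟨j, h⟩) else false) i := by
      intro x
      funext i
      show x (e i) = if h : (i : ℕ) < w + 1 then x (e ⟨i, h⟩) else false
      rw [dif_pos i.2]
    have hs := fun x : I → Bool => intOfBits_succ_spec (w := w)
      fun j : ℕ => if h : j < w + 1 then x (e ⟨j, h⟩) else false
    simp only [← hf] at hs
    refine Computes.of_subset ((bits_sign_ext fun x => (hs x).1).trans ?_)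
    rintro f ⟨i, hi, rfl⟩
    exact ⟨e ⟨i, hi⟩, funext fun x => by rw [(hs x).2 i hi, dif_pos hi]⟩

theorem complexOfBits_eq (p : ℕ) {w : ℕ} (b : Fin 2 × Fin w → Bool) :
    complexOfBits p b = (2 ^ p : ℂ)⁻¹ * (((intOfBits fun i => b (0, i) : ℤ) : ℂ) +
      Complex.I * ((intOfBits fun i => b (1, i) : ℤ) : ℂ)) := by
  have e : (2 ^ p : ℂ)⁻¹ = (((2 ^ p : ℝ)⁻¹ : ℝ) : ℂ) := by push_cast; rfl
  rw [complexOfBits, realOfBits_eq, realOfBits_eq, e]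
  apply Complex.ext <;>
    simp [-Complex.ofReal_inv, -Complex.ofReal_pow, Complex.mul_re, Complex.mul_im] <;>
    ring

theorem coeff_polyOfBits (p : ℕ) {w d : ℕ} (b : Fin d × Fin 2 × Fin w → Bool) (i : ℕ) :
    (polyOfBits p b).coeff i = if h : i < d then complexOfBits p fun t => b (⟨i, h⟩, t) else 0 := by
  rw [polyOfBits, finsetSum_coeff]
  simp only [coeff_C_mul_X_pow]
  split_ifs with h
  · rw [Finset.sum_eq_single ⟨i, h⟩]
    · simp
    · intro j _ hj
      rw [if_neg fun hij => hj (Fin.ext hij.symm)]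
    · simp
  · refine Finset.sum_eq_zero fun j _ => if_neg ?_
    rintro rfl
    exact h j.2

/-- Reading a polynomial from the input, with its coefficients scaled by powers of two. -/
theorem exists_readPoly (p P W d : ℕ) {w N : ℕ} (e : Fin N × Fin 2 × Fin w → I) (s r : ℕ → ℕ) :
    ∃ A : (I → Bool) → ℤ[X] × ℤ[X], Computes 0 (inputBits I) (pairBits W d A) ∧
      ∀ x, (fixedPoly P (A x)).degree < N ∧ ∀ i, ‖(fixedPoly P (A x)).coeff i -
        (polyOfBits p fun t => x (e t)).coeff i * (2 ^ s i * (2 ^ r i)⁻¹)‖ ≤ 2 * (2 ^ P : ℝ)⁻¹ := by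
  -- Change of format and scaling are merged into one left shift followed by one right shift, so
  -- rounding happens once.
  let c : Fin 2 → ℕ → (I → Bool) → ℤ := fun u i x =>
    if h : i < N then (intOfBits fun j => x (e (⟨i, h⟩, u, j))) * 2 ^ (P + s i) / 2 ^ (p + r i)
    else 0
  let A : Fin 2 → (I → Bool) → ℤ[X] := fun u x => ∑ i ∈ Finset.range N, monomial i (c u i x)
  have hA : ∀ u x i, (A u x).coeff i = c u i x := by
    intro u x i
    simp only [A, finsetSum_coeff, coeff_monomial, Finset.sum_ite_eq', Finset.mem_range]
    split_ifs with h
    · rfl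
    · simp [c, h]
  have hc : ∀ u i, Computes 0 (inputBits I) (bits W (c u i)) := by
    intro u i
    by_cases h : i < N
    · have e1 := (Computes.intOfBits (fun j => e (⟨i, h⟩, u, j)) (p + r i + W)).trans
        (Computes.mul_pow (P + s i))
      have e2 := e1.mono_right ((bits_ediv_subset (W := W) (p + r i)).trans (bits_mono (by omega)))
      simpa only [c, h, dite_true] using e2
    · simp only [c, h, dite_false]
      exact Computes.const _ _
  refine ⟨fun x => (A 0 x, A 1 x), ?_, fun x => ⟨?_, fun i => ?_⟩⟩
  · refine ((Computes.iUnion_lt d 0 _ fun i _ => ?_).union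
      (Computes.iUnion_lt d 0 _ fun i _ => ?_)).mono_cost (by simp)
    · simp only [hA]; exact hc 0 i
    · simp only [hA]; exact hc 1 i
  · rw [degree_lt_iff_coeff_zero]
    intro i hi
    rw [coeff_fixedPoly]
    simp [hA, c, not_lt.2 hi]
  · rw [coeff_fixedPoly, coeff_polyOfBits]
    simp only [hA, c]
    by_cases h : i < N
    · simp only [h, dite_true]
      refine le_trans (le_of_eq ?_) (norm_floor_error P (p + r i)
        ((intOfBits fun j => x (e (⟨i, h⟩, 0, j))) * 2 ^ (P + s i))
        ((intOfBits fun j => x (e (⟨i, h⟩, 1, j))) * 2 ^ (P + s i)))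
      congr 2
      rw [complexOfBits_eq]
      push_cast
      field_simp
      ring
    · simp only [h, dite_false]
      simp

/-- The bits of the output coefficient `z / 2 ^ s`. -/
theorem Computes.output {w s W : ℕ} (Y : (I → Bool) → ℤ) :
    Computes 0 (bits (w + 1) Y) (bits W fun x => signedWord w (Y x) * 2 ^ s) := by
  have h1 : ∀ x, -2 ^ (w + s) ≤ signedWord w (Y x) * 2 ^ s ∧
      signedWord w (Y x) * 2 ^ s < 2 ^ (w + s) := by
    intro x
    have := signedWord_range w (Y x)
    have hp : (0 : ℤ) < 2 ^ s := by positivity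
    rw [pow_add]
    constructor <;> nlinarith
  rw [← bits_congr (X := fun x => signedWord w (Y x)) fun x => signedWord_emod w (Y x)]
  exact (Computes.mul_pow s).mono_right ((bits_sign_ext h1).trans (bits_mono (by omega)))

theorem complexOfBits_ibit {p w : ℕ} {y z : ℤ} (hy : -2 ^ w ≤ y ∧ y < 2 ^ w)
    (hz : -2 ^ w ≤ z ∧ z < 2 ^ w) :
    complexOfBits p (fun t : Fin 2 × Fin (w + 1) => ibit (if t.1 = 0 then y else z) t.2) =
      (2 ^ p : ℂ)⁻¹ * ((y : ℂ) + Complex.I * (z : ℂ)) := by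
  rw [complexOfBits_eq]
  simp only [if_true, one_ne_zero, if_false]
  rw [intOfBits_ibit hy, intOfBits_ibit hz]

end InputOutput

/-! ### The fan-out process -/

/-- All losses become powers of `2 ^ k`. The fourth power bounds `9 ^ k`, the third bounds `5 ^ k`,
one factor comes from the accuracy of the supermoduli and of rounding, and one from the growth of
the norm: nine in all. -/
theorem fanOut_error_bound {k : ℕ} {Φ S ε η θ : ℝ} (hS : 0 ≤ S) (hSΦ : S ≤ Φ)
    (hΦ : 1 ≤ Φ) (hε : 0 ≤ ε) (hη0 : 0 ≤ η) (hη : η ≤ 2 ^ k * (2 * ε))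
    (hθ : 512 * Φ * (2 ^ k) ^ 9 * ε ≤ θ) :
    9 ^ k * (4 * η + 9 * (2 ^ k * (3 * ε))) ≤ θ ∧
    5 ^ k * (2 ^ k * (3 * S * ε) + (2 ^ k * Φ * (9 ^ k * (4 * η + 9 * (2 ^ k * (3 * ε))) +
      2 * (2 ^ k * (3 * ε))) + 2 * η)) ≤ θ := by
  have h9 : (9 : ℝ) ^ k ≤ (2 ^ k) ^ 4 := by
    rw [← pow_mul, mul_comm, pow_mul]
    exact pow_le_pow_left₀ (by norm_num) (by norm_num) k
  have h5 : (5 : ℝ) ^ k ≤ (2 ^ k) ^ 3 := by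
    rw [← pow_mul, mul_comm, pow_mul]
    exact pow_le_pow_left₀ (by norm_num) (by norm_num) k
  have hQ : (1 : ℝ) ≤ 2 ^ k := one_le_pow₀ (by norm_num)
  set Q : ℝ := 2 ^ k
  have hQ0 : 0 ≤ Q := by linarith
  have hpow : ∀ i j : ℕ, i ≤ j → Q ^ i * ε ≤ Q ^ j * ε := fun i j h =>
    mul_le_mul_of_nonneg_right (pow_le_pow_right₀ hQ h) hε
  have hQε : ∀ i : ℕ, 0 ≤ Q ^ i * ε := fun i => by positivity
  have hΦm : ∀ y : ℝ, 0 ≤ y → y ≤ Φ * y := fun y hy => le_mul_of_one_le_left hy hΦ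
  have e1 : 9 ^ k * (4 * η + 9 * (Q * (3 * ε))) ≤ 35 * (Q ^ 5 * ε) := by
    calc _ ≤ Q ^ 4 * (35 * (Q * ε)) :=
          mul_le_mul h9 (by linarith) (by positivity) (by positivity)
      _ = _ := by ring
  have hB : Q * Φ * (9 ^ k * (4 * η + 9 * (Q * (3 * ε))) + 2 * (Q * (3 * ε))) + 2 * η ≤
      45 * (Φ * (Q ^ 6 * ε)) := by
    have a1 : 9 ^ k * (4 * η + 9 * (Q * (3 * ε))) + 2 * (Q * (3 * ε)) ≤ 41 * (Q ^ 5 * ε) := by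
      have := hpow 1 5 (by norm_num)
      rw [pow_one] at this
      linarith
    have a2 := mul_le_mul_of_nonneg_left a1 (by positivity : 0 ≤ Q * Φ)
    have a3 := hpow 1 6 (by norm_num)
    rw [pow_one] at a3
    have a4 := hΦm _ (hQε 6)
    calc _ ≤ Q * Φ * (41 * (Q ^ 5 * ε)) + 4 * (Q ^ 6 * ε) := by linarith
      _ = 41 * (Φ * (Q ^ 6 * ε)) + 4 * (Q ^ 6 * ε) := by ring
      _ ≤ _ := by linarith
  have hE : Q * (3 * S * ε) ≤ 3 * (Φ * (Q ^ 6 * ε)) := by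
    have a3 := hpow 1 6 (by norm_num)
    rw [pow_one] at a3
    have := mul_le_mul hSΦ a3 (by positivity) (by positivity)
    calc _ = 3 * (S * (Q * ε)) := by ring
      _ ≤ _ := by linarith
  constructor
  · refine e1.trans (le_trans ?_ hθ)
    have := hpow 5 9 (by norm_num)
    have := hΦm _ (hQε 9)
    have := hQε 9
    calc _ ≤ 35 * (Φ * (Q ^ 9 * ε)) := by linarith
      _ ≤ 512 * (Φ * (Q ^ 9 * ε)) := by
        have : 0 ≤ Φ * (Q ^ 9 * ε) := by positivity
        linarith
      _ = _ := by ring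
  · calc _ ≤ Q ^ 3 * (48 * (Φ * (Q ^ 6 * ε))) :=
          mul_le_mul h5 (by linarith) (by positivity) (by positivity)
      _ = 48 * (Φ * (Q ^ 9 * ε)) := by ring
      _ ≤ 512 * (Φ * (Q ^ 9 * ε)) := by
        have : 0 ≤ Φ * (Q ^ 9 * ε) := by positivity
        linarith
      _ ≤ θ := by linarith

theorem supNorm_le_of_coeff {p : ℂ[X]} {c : ℝ} (h : ∀ i, ‖p.coeff i‖ ≤ c) : p.supNorm ≤ c := by
  obtain ⟨i, hi⟩ := p.exists_eq_supNorm
  rw [hi]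
  exact h i

/-- The scaled input polynomial is close to the scaled true polynomial. -/
theorem l1_read_sub_comp_le {n σ P : ℕ} {ε : ℝ} {v v' A : ℂ[X]} (hv : v.degree < n)
    (hA : A.degree < n) (hPε : (2 ^ P : ℝ)⁻¹ ≤ ε) (hvv : (v - v').supNorm ≤ ε)
    (hAv : ∀ i, ‖A.coeff i - v'.coeff i * (2 ^ (σ * i) * (2 ^ 0)⁻¹)‖ ≤ 2 * (2 ^ P : ℝ)⁻¹) :
    l1 (A - v.comp (C (2 ^ σ) * X)) ≤ n * (3 * 2 ^ (σ * n) * ε) := by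
  have hε : 0 ≤ ε := le_trans (by positivity) hPε
  have hdeg : (A - v.comp (C (2 ^ σ) * X)).degree < n :=
    (degree_sub_le _ _).trans_lt (max_lt hA (degree_comp_C_mul_X_lt hv _))
  refine l1_le_mul hdeg fun i => ?_
  rcases Nat.lt_or_ge i n with hi | hi
  · rw [coeff_sub, comp_C_mul_X_coeff]
    have e : A.coeff i - v.coeff i * (2 ^ σ) ^ i =
        (A.coeff i - v'.coeff i * (2 ^ (σ * i) * (2 ^ 0)⁻¹)) - (v - v').coeff i * 2 ^ (σ * i) := by
      rw [coeff_sub, pow_mul]; ring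
    rw [e]
    refine (norm_sub_le _ _).trans ?_
    rw [norm_mul, norm_pow, Complex.norm_ofNat]
    have h1 := ((v - v').le_supNorm i).trans hvv
    have h2 : (2 : ℝ) ^ (σ * i) ≤ 2 ^ (σ * n) :=
      pow_le_pow_right₀ (by norm_num) (Nat.mul_le_mul_left _ hi.le)
    have h3 : (1 : ℝ) ≤ 2 ^ (σ * n) := one_le_pow₀ (by norm_num)
    have h4 := mul_le_mul h1 h2 (by positivity) hε
    nlinarith [hAv i]
  · rw [(degree_lt_iff_coeff_zero _ _).1 hdeg i hi, norm_zero]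
    positivity

/-- The scaled input supermoduli are close to the scaled supermoduli. -/
theorem l1_read_sub_supermodulus_le {n σ P k h j : ℕ} {ε : ℝ} {m' A : ℂ[X]} (x : Fin n → ℂ)
    (hk : h ≤ k) (hPε : (2 ^ P : ℝ)⁻¹ ≤ ε) (hmm : (supermodulus x h j - m').supNorm ≤ ε)
    (hA : ∀ i, ‖A.coeff i - m'.coeff i *
      (2 ^ 0 * (2 ^ (σ * (supermodulusDegree n h j - i)))⁻¹)‖ ≤ 2 * (2 ^ P : ℝ)⁻¹) :
    l1 (lowPart (supermodulusDegree n h j) A - lowPart (supermodulusDegree n h j)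
      (supermodulus (fun i => x i / 2 ^ σ) h j)) ≤ 2 ^ k * (3 * ε) := by
  have hε : 0 ≤ ε := le_trans (by positivity) hPε
  set d := supermodulusDegree n h j with hd
  have hdk : (d : ℝ) ≤ 2 ^ k := by
    exact_mod_cast (supermodulusDegree_le n h j).trans (Nat.pow_le_pow_right (by norm_num) hk)
  rw [← lowPart_sub]
  refine (l1_le_mul (degree_lowPart_lt d _) (c := 3 * ε) fun i => ?_).trans
    (mul_le_mul_of_nonneg_right hdk (by positivity))
  rw [coeff_lowPart]
  split_ifs with hi
  · have hb : (2 : ℂ) ^ σ ≠ 0 := pow_ne_zero _ two_ne_zero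
    have hc := congrArg (fun p => p.coeff i) (supermodulus_comp x hb h j)
    simp only [comp_C_mul_X_coeff, coeff_C_mul] at hc
    rw [← hd] at hc
    -- Making the scaled divisor monic divides coefficient `i` by `2 ^ (σ * (d - i))`, so input
    -- errors in the supermoduli are never amplified.
    have hc' : (supermodulus (fun i => x i / 2 ^ σ) h j).coeff i =
        (supermodulus x h j).coeff i * (2 ^ 0 * (2 ^ (σ * (d - i)))⁻¹) := by
      have e : ((2 : ℂ) ^ σ) ^ d = (2 ^ σ) ^ i * 2 ^ (σ * (d - i)) := by
        rw [pow_mul, ← pow_add, Nat.add_sub_cancel' hi.le]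
      rw [e] at hc
      have hb1 : ((2 : ℂ) ^ σ) ^ i ≠ 0 := pow_ne_zero _ hb
      have hb2 : (2 : ℂ) ^ (σ * (d - i)) ≠ 0 := pow_ne_zero _ two_ne_zero
      rw [pow_zero, one_mul, ← div_eq_mul_inv, eq_div_iff hb2]
      apply mul_left_cancel₀ hb1
      linear_combination -hc
    rw [coeff_sub, hc']
    have e : A.coeff i - (supermodulus x h j).coeff i * (2 ^ 0 * (2 ^ (σ * (d - i)))⁻¹) =
        (A.coeff i - m'.coeff i * (2 ^ 0 * (2 ^ (σ * (d - i)))⁻¹)) -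
          (supermodulus x h j - m').coeff i * (2 ^ 0 * (2 ^ (σ * (d - i)))⁻¹) := by
      rw [coeff_sub]; ring
    rw [e]
    refine (norm_sub_le _ _).trans ?_
    have h1 := ((supermodulus x h j - m').le_supNorm i).trans hmm
    have h2 : ‖((2 : ℂ) ^ 0 * (2 ^ (σ * (d - i)))⁻¹)‖ ≤ 1 := by
      rw [pow_zero, one_mul, norm_inv, norm_pow, Complex.norm_ofNat]
      exact inv_le_one_of_one_le₀ (one_le_pow₀ (by norm_num))
    rw [norm_mul]
    have h3 := mul_le_mul h1 h2 (norm_nonneg _) hε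
    linarith [hA i]
  · rw [norm_zero]; positivity

/-- Scaled data are read, the tree is run on them, and the scaling is undone on output. Here `2 ^ β`
bounds the norm of the scaled `v`, `P` and `b` count fractional and integer bits, and all but the
input and output of the circuit is independent of the input format. -/
theorem exists_fanOutFunction {n k σ β P b w M κ : ℕ}
    (hκ : mulComplexity (2 * M) + 50 * M ≤ κ) (hM : 2 * w + k + 2 ≤ M)
    (hdvd : ∀ t ≤ k, 2 ^ t ∣ M) (hw : P + b ≤ w) (hb : β + k + 4 ≤ b) (hnk : n ≤ 2 ^ k)
    {T r θ ε : ℝ} (hr0 : 0 ≤ r) (hr : 2 ^ k * (r / 2 ^ σ) ≤ 1 / 4)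
    (hT0 : 0 ≤ T) (hT : 2 ^ k * (T * 2 ^ (σ * n)) ≤ 2 ^ β) (hσ : σ * n ≤ β)
    (hPε : (2 ^ P : ℝ)⁻¹ ≤ ε) (hθ : 2 ^ (β + 9 * k + 9) * ε ≤ θ) (hθ1 : θ ≤ 1) (p w₀ : ℕ) :
    ∃ (p' w' : ℕ) (F : (FanOutInput n k w₀ → Bool) → (FanOutOutput k w' → Bool)),
      ComputableWithGates (k * (180 * k * 2 ^ k * κ)) F ∧
      ∀ (x : Fin n → ℂ) (v : ℂ[X]) (input : FanOutInput n k w₀ → Bool),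
        v.degree < n → v.supNorm ≤ T → (∀ i, ‖x i‖ ≤ r) →
        (v - polyOfBits p fun b => input (Sum.inl b)).supNorm ≤ ε →
        (∀ t : Node k,
          (supermodulus x t.1 t.2 - polyOfBits p fun b => input (Sum.inr ⟨t, b⟩)).supNorm ≤ ε) →
        ∀ t : Node k,
          (fanOut x v k t.1 t.2 - polyOfBits p' fun b => F input ⟨t, b⟩).supNorm ≤ θ := by
  obtain ⟨A₀, hA₀, hA₀s⟩ := exists_readPoly p P (w + 1) (2 ^ k)
    (fun t : Fin n × Fin 2 × Fin w₀ => (Sum.inl t : FanOutInput n k w₀)) (fun i => σ * i)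
    fun _ => 0
  have hm : ∀ h j, ∃ A : (FanOutInput n k w₀ → Bool) → ℤ[X] × ℤ[X],
      ∀ (hh : h < k) (hj : j < 2 ^ (k - h)),
      Computes 0 (inputBits (FanOutInput n k w₀)) (pairBits (w + 1) (2 ^ h) A) ∧
      ∀ x i, ‖(fixedPoly P (A x)).coeff i -
        (polyOfBits p fun t => x (Sum.inr ⟨⟨⟨h, hh⟩, ⟨j, hj⟩⟩, t⟩)).coeff i *
          (2 ^ 0 * (2 ^ (σ * (supermodulusDegree n h j - i)))⁻¹)‖ ≤ 2 * (2 ^ P : ℝ)⁻¹ := by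
    intro h j
    by_cases hhj : h < k ∧ j < 2 ^ (k - h)
    · obtain ⟨A, h1, h2⟩ := exists_readPoly p P (w + 1) (2 ^ h)
        (fun t : Fin (2 ^ h + 1) × Fin 2 × Fin w₀ =>
          (Sum.inr ⟨⟨⟨h, hhj.1⟩, ⟨j, hhj.2⟩⟩, t⟩ : FanOutInput n k w₀)) (fun _ => 0)
        fun i => σ * (supermodulusDegree n h j - i)
      exact ⟨A, fun _ _ => ⟨h1, fun x => (h2 x).2⟩⟩
    · exact ⟨fun _ => 0, fun hh hj => absurd ⟨hh, hj⟩ hhj⟩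
  choose m₀ hm₀ using hm
  obtain ⟨R, hR, hRs⟩ := exists_fanOutCircuit hκ hM hdvd hw (by omega) hnk rfl
    (inputBits (FanOutInput n k w₀)) A₀ m₀ hA₀ fun h hh j hj => (hm₀ h j hh hj).1
  let Y : FanOutOutput k (w + σ * 2 ^ k + 1) → (FanOutInput n k w₀ → Bool) → ℤ := fun o x =>
    if o.2.2.1 = 0 then (R (k - o.1.1) o.1.2 x).1.coeff o.2.1
    else (R (k - o.1.1) o.1.2 x).2.coeff o.2.1
  -- Coefficient `i` must be divided by `2 ^ (σ * i)`. With `σ * 2 ^ k` additional fractional bits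
  -- this is a left shift by `σ * (2 ^ k - i)`, exact and free of gates.
  refine ⟨P + σ * 2 ^ k, w + σ * 2 ^ k + 1, fun x o =>
    ibit (signedWord w (Y o x) * 2 ^ (σ * (2 ^ k - o.2.1))) o.2.2.2, ?_, ?_⟩
  · refine Computes.computableWithGates ((hR.trans (t := 0) ?_).mono_cost (by omega))
    have key : ∀ o : FanOutOutput k (w + σ * 2 ^ k + 1), Computes 0
        (⋃ d, ⋃ _ : d ≤ k, ⋃ j, ⋃ _ : j < 2 ^ d, pairBits (w + 1) (2 ^ (k - d)) (R d j))
        {fun x => ibit (signedWord w (Y o x) * 2 ^ (σ * (2 ^ k - o.2.1))) o.2.2.2} := by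
      intro o
      refine ((Computes.output (w := w) (W := w + σ * 2 ^ k + 1) (s := σ * (2 ^ k - o.2.1))
        (Y o)).mono_left ?_).mono_right ?_
      · intro f hf
        simp only [Set.mem_iUnion]
        refine ⟨k - o.1.1, by omega, o.1.2, o.1.2.2, ?_⟩
        have hlt : (o.2.1 : ℕ) < 2 ^ (k - (k - (o.1.1 : ℕ))) := by
          rw [Nat.sub_sub_self o.1.1.2.le]
          exact o.2.1.2
        by_cases h0 : o.2.2.1 = 0
        · simp only [Y, h0, if_true] at hf
          exact Or.inl (bits_subset_polyBits _ hlt hf)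
        · simp only [Y, h0, if_false] at hf
          exact Or.inr (bits_subset_polyBits _ hlt hf)
      · rintro f rfl
        exact mem_bits o.2.2.2.2
    have := Computes.biUnion_finset Finset.univ (fun _ => 0) _ fun o _ => key o
    refine (this.mono_cost (by simp)).mono_right ?_
    rintro _ ⟨o, rfl⟩
    simp only [Set.mem_iUnion]
    exact ⟨o, Finset.mem_univ o, rfl⟩
  · intro x v input hv hvT hx hvv hmm t
    set Q : ℝ := 2 ^ k with hQ
    have hε0 : 0 ≤ ε := le_trans (by positivity) hPε
    have hnQ : (n : ℝ) ≤ Q := by rw [hQ]; exact_mod_cast hnk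
    have hb0 : (2 : ℂ) ^ σ ≠ 0 := pow_ne_zero _ two_ne_zero
    have hΦ1 : (1 : ℝ) ≤ 2 ^ β := one_le_pow₀ (by norm_num)
    obtain ⟨err1, err2⟩ := fanOut_error_bound (k := k) (Φ := 2 ^ β) (S := 2 ^ (σ * n)) (ε := ε)
      (η := 2 ^ k * (2 * (2 ^ P : ℝ)⁻¹)) (θ := θ) (by positivity)
      (pow_le_pow_right₀ (by norm_num) hσ) hΦ1 hε0 (by positivity)
      (mul_le_mul_of_nonneg_left (by linarith) (by positivity))
      (le_trans (le_of_eq (by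
        rw [pow_add, pow_add, pow_mul' 2 9 k, (by norm_num : (2 : ℝ) ^ 9 = 512)]
        ring)) hθ)
    have hvl : l1 (v.comp (C (2 ^ σ) * X)) ≤ 2 ^ β := by
      refine (l1_le_mul (degree_comp_C_mul_X_lt hv _) (c := T * 2 ^ (σ * n)) fun i => ?_).trans
        ((mul_le_mul_of_nonneg_right hnQ (by positivity)).trans hT)
      rcases Nat.lt_or_ge i n with hi | hi
      · rw [comp_C_mul_X_coeff, norm_mul, ← pow_mul, norm_pow, Complex.norm_ofNat]
        exact mul_le_mul ((v.le_supNorm i).trans hvT)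
          (pow_le_pow_right₀ (by norm_num) (Nat.mul_le_mul_left _ hi.le)) (by positivity) hT0
      · rw [(degree_lt_iff_coeff_zero _ _).1 (degree_comp_C_mul_X_lt hv _) i hi, norm_zero]
        positivity
    obtain ⟨⟨h, hh⟩, ⟨j, hj⟩⟩ := t
    have hE := (l1_read_sub_comp_le hv (hA₀s input).1 hPε hvv (hA₀s input).2).trans
      (mul_le_mul_of_nonneg_right hnQ (by positivity))
    obtain ⟨r1, r2⟩ := hRs input (fun i => x i / 2 ^ σ) (v.comp (C (2 ^ σ) * X)) (r / 2 ^ σ)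
      (2 ^ β) (Q * (3 * 2 ^ (σ * n) * ε)) (2 ^ k * (3 * ε)) (degree_comp_C_mul_X_lt hv _)
      (by positivity) (fun i => by
        rw [norm_div, norm_pow, Complex.norm_ofNat]
        exact div_le_div_of_nonneg_right (hx i) (by positivity)) hr hvl hE
      (fun h hh j hj => l1_read_sub_supermodulus_le x hh.le hPε (hmm ⟨⟨h, hh⟩, ⟨j, hj⟩⟩)
        ((hm₀ h j hh hj).2 input)) (by positivity) (err1.trans hθ1) hΦ1
      (by
        have : (2 : ℝ) ^ (β + k + 4) ≤ 2 ^ b := pow_le_pow_right₀ (by norm_num) hb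
        refine lt_of_lt_of_le ?_ this
        rw [pow_add, pow_add]
        have : (0 : ℝ) < 2 ^ β * 2 ^ k := by positivity
        nlinarith)
      (err2.trans (hθ1.trans hΦ1)) (k - h) (Nat.sub_le _ _) j hj
    have hkk : k - (k - h) = h := by omega
    have r3 := r2.trans ((mul_le_mul_of_nonneg_right
      (pow_le_pow_right₀ (by norm_num : (1 : ℝ) ≤ 5) (Nat.sub_le k h)) (by positivity)).trans err2)
    rw [fanOutAtDepth_comp x v hb0] at r1 r3
    have hdeg := degree_fanOutAtDepth_lt x hv hnk (k - h) j hj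
    rw [hkk] at hdeg
    have hdeg' := (degree_lt_iff_coeff_zero _ _).1 (hdeg.trans_le
      (by exact_mod_cast supermodulusDegree_le n h j : _ ≤ ((2 ^ h : ℕ) : WithBot ℕ)))
    have hrange : l1 (fixedPoly P (R (k - h) j input)) < 2 ^ b := by
      have e1 := l1_le_add (fixedPoly P (R (k - h) j input))
        ((fanOutAtDepth x v k (k - h) j).comp (C (2 ^ σ) * X))
      have e2 : (2 : ℝ) ^ (k - h) ≤ 2 ^ k := pow_le_pow_right₀ (by norm_num) (Nat.sub_le _ _)
      have e3 : (2 : ℝ) ^ (k - h) * 2 ^ β ≤ 2 ^ k * 2 ^ β :=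
        mul_le_mul_of_nonneg_right e2 (by positivity)
      have e4 : (2 : ℝ) ^ (β + k + 4) ≤ 2 ^ b := pow_le_pow_right₀ (by norm_num) hb
      rw [pow_add, pow_add] at e4
      have e5 : (1 : ℝ) ≤ 2 ^ k := one_le_pow₀ (by norm_num)
      nlinarith
    refine supNorm_le_of_coeff fun i => ?_
    rw [coeff_sub, coeff_polyOfBits]
    have hθ0 : 0 ≤ θ := (l1_nonneg _).trans r3
    split_ifs with hi
    · have hi' : i < 2 ^ h := hi
      obtain ⟨c1, c2⟩ := abs_coeff_lt_of_l1 hw hrange i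
      have hsh : ∀ y : ℤ, -2 ^ w ≤ y ∧ y < 2 ^ w →
          -2 ^ (w + σ * 2 ^ k) ≤ y * 2 ^ (σ * (2 ^ k - i)) ∧
            y * 2 ^ (σ * (2 ^ k - i)) < 2 ^ (w + σ * 2 ^ k) := by
        intro y hy
        have hp : (0 : ℤ) < 2 ^ (σ * (2 ^ k - i)) := by positivity
        have hle : (2 : ℤ) ^ (w + σ * (2 ^ k - i)) ≤ 2 ^ (w + σ * 2 ^ k) :=
          pow_le_pow_right₀ (by norm_num)
            (Nat.add_le_add_left (Nat.mul_le_mul_left _ (Nat.sub_le _ _)) _)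
        rw [pow_add] at hle
        constructor <;> nlinarith
      have hout : (complexOfBits (P + σ * 2 ^ k) fun t : Fin 2 × Fin (w + σ * 2 ^ k + 1) =>
          ibit (signedWord w (Y ⟨⟨⟨h, hh⟩, ⟨j, hj⟩⟩, (⟨i, hi⟩, t)⟩ input) *
            2 ^ (σ * (2 ^ k - i))) t.2) =
          (fixedPoly P (R (k - h) j input)).coeff i * ((2 ^ σ) ^ i)⁻¹ := by
        have e1 : ∀ t : Fin 2 × Fin (w + σ * 2 ^ k + 1),
            signedWord w (Y ⟨⟨⟨h, hh⟩, ⟨j, hj⟩⟩, (⟨i, hi⟩, t)⟩ input) * 2 ^ (σ * (2 ^ k - i)) =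
            if t.1 = 0 then (R (k - h) j input).1.coeff i * 2 ^ (σ * (2 ^ k - i))
            else (R (k - h) j input).2.coeff i * 2 ^ (σ * (2 ^ k - i)) := by
          intro t
          simp only [Y]
          split_ifs
          · rw [signedWord_eq c1]
          · rw [signedWord_eq c2]
        simp only [e1]
        rw [complexOfBits_ibit (hsh _ c1) (hsh _ c2), coeff_fixedPoly]
        have hik : i ≤ 2 ^ k := hi'.le.trans (Nat.pow_le_pow_right (by norm_num) hh.le)
        have e2 : (2 : ℂ) ^ (σ * 2 ^ k) = 2 ^ (σ * (2 ^ k - i)) * (2 ^ σ) ^ i := by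
          rw [← pow_mul, ← pow_add, ← mul_add, Nat.sub_add_cancel hik]
        rw [pow_add, e2]
        have hz : (2 : ℂ) ^ (σ * (2 ^ k - i)) ≠ 0 := pow_ne_zero _ two_ne_zero
        push_cast
        field_simp
      have hco := (norm_coeff_le_l1 _ i).trans r3
      rw [coeff_sub, comp_C_mul_X_coeff] at hco
      have hbi : ((2 : ℂ) ^ σ) ^ i ≠ 0 := pow_ne_zero _ hb0
      have e3 : (fanOut x v k h j).coeff i -
          (fixedPoly P (R (k - h) j input)).coeff i * ((2 ^ σ) ^ i)⁻¹ =
          -(((fixedPoly P (R (k - h) j input)).coeff i -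
            (fanOutAtDepth x v k (k - h) j).coeff i * (2 ^ σ) ^ i) * ((2 ^ σ) ^ i)⁻¹) := by
        rw [fanOut]
        field_simp
        ring
      -- Undoing the scaling divides by a number of modulus at least one, so the error bound carries
      -- over.
      have e4 : ‖(((2 : ℂ) ^ σ) ^ i)⁻¹‖ ≤ 1 := by
        rw [← pow_mul, norm_inv, norm_pow, Complex.norm_ofNat]
        exact inv_le_one_of_one_le₀ (one_le_pow₀ (by norm_num))
      refine le_trans (le_of_eq (congrArg _ ((congrArg _ hout).trans e3))) ?_
      rw [norm_neg, norm_mul]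
      calc _ ≤ θ * 1 := mul_le_mul hco e4 (norm_nonneg _) hθ0
        _ = θ := mul_one θ
    · have h0 : (fanOut x v k h j).coeff i = 0 := hdeg' i (not_lt.1 hi)
      have : (fanOut x v k ((⟨h, hh⟩ : Fin k) : ℕ) ((⟨j, hj⟩ : Fin (2 ^ (k - h))) : ℕ)).coeff i = 0 :=
        h0
      rw [sub_zero]
      refine le_trans (le_of_eq ?_) hθ0
      exact norm_eq_zero.2 this

/-! ### Choice of the parameters and the final estimate. -/

theorem clog_two_bounds {n : ℕ} (hn : 2 ≤ n) :
    1 ≤ Real.logb 2 n ∧ (Nat.clog 2 n : ℝ) ≤ 2 * Real.logb 2 n ∧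
      n ≤ 2 ^ Nat.clog 2 n ∧ 2 ^ Nat.clog 2 n ≤ 2 * n := by
  have hn0 : (0 : ℝ) < n := by positivity
  have hL : 1 ≤ Real.logb 2 n := by
    rw [Real.le_logb_iff_rpow_le one_lt_two hn0, Real.rpow_one]
    exact_mod_cast hn
  have hpos : 0 < Nat.clog 2 n := Nat.clog_pos one_lt_two hn
  have hlt : 2 ^ (Nat.clog 2 n - 1) < n := Nat.pow_pred_clog_lt_self one_lt_two (by omega)
  have hlog : ((Nat.clog 2 n - 1 : ℕ) : ℝ) ≤ Real.logb 2 n := by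
    rw [Real.le_logb_iff_rpow_le one_lt_two hn0, Real.rpow_natCast]
    exact_mod_cast hlt.le
  rw [Nat.cast_sub hpos, Nat.cast_one] at hlog
  refine ⟨hL, by linarith, Nat.le_pow_clog one_lt_two n, ?_⟩
  have h : 2 ^ Nat.clog 2 n = 2 * 2 ^ (Nat.clog 2 n - 1) := by
    rw [← pow_succ', Nat.sub_add_cancel hpos]
  omega

/-- Rounding up to a multiple of `2 ^ k` costs at most `2 ^ k ≤ 2 * n`, which the nominal precision
absorbs. -/
theorem exists_dvd_two_pow_mul (k m : ℕ) :
    ∃ M, m ≤ M ∧ M ≤ m + 2 ^ k ∧ ∀ t ≤ k, 2 ^ t ∣ M := by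
  refine ⟨2 ^ k * (m / 2 ^ k + 1), ?_, ?_, fun t ht => (pow_dvd_pow 2 ht).mul_right _⟩
  · exact (Nat.lt_mul_div_succ m (by positivity)).le
  · rw [mul_add, mul_one]
    exact Nat.add_le_add_right (Nat.mul_div_le m _) _

/-- The working precision of the fan-out circuit is at most a constant multiple of the nominal
precision `N`. -/
theorem fanOut_precision_le {n k N c t l a : ℕ} {ℓ τ ρ L : ℝ} (hn : 2 ≤ n)
    (hk2 : 2 ^ k ≤ 2 * n) (hL : 1 ≤ L) (hkL : (k : ℝ) ≤ 2 * L) (hℓ : 0 ≤ ℓ) (hτ : 0 ≤ τ)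
    (hρ : 1 ≤ ρ) (hN : ℓ + τ * L + ρ * n * L ≤ N) (hc : (c : ℝ) ≤ ρ + 1) (ht : (t : ℝ) ≤ τ + 1)
    (hl : (l : ℝ) ≤ ℓ + 2 * τ * L + 300 * (ρ + 1) * n * L + 1)
    (ha : a = t + (c + k + 2) * n + k) :
    2 * (2 * (l + (a + k + 4)) + k + 2 + 2 ^ k) ≤ 2 ^ 13 * N := by
  have ha' : (a : ℝ) = t + (c + k + 2) * n + k := by exact_mod_cast ha
  have hk2' : (2 : ℝ) ^ k ≤ 2 * n := by exact_mod_cast hk2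
  have hn2 : (2 : ℝ) ≤ n := by exact_mod_cast hn
  have hnL : (n : ℝ) ≤ n * L := le_mul_of_one_le_right (by positivity) hL
  have hLn : L ≤ n * L := le_mul_of_one_le_left (by positivity) (by linarith)
  have hρn : (n : ℝ) * L ≤ ρ * n * L := by
    rw [mul_assoc]; exact le_mul_of_one_le_left (by positivity) hρ
  have hρL : ρ * n ≤ ρ * n * L := le_mul_of_one_le_right (by positivity) hL
  have hτL : τ ≤ τ * L := le_mul_of_one_le_right hτ hL
  have hcn : (c : ℝ) * n ≤ (ρ + 1) * n := by gcongr
  have hkn' : (k : ℝ) * n ≤ 2 * L * n := by gcongr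
  have hτL0 : 0 ≤ τ * L := by positivity
  have : (2 : ℝ) * (2 * (l + (a + k + 4)) + k + 2 + 2 ^ k) ≤ 2 ^ 13 * N := by
    rw [ha']
    nlinarith
  exact_mod_cast this

/-- The number of bits lost in the fan-out circuit is covered by the precision of the input. -/
theorem fanOut_loss_le {n k c t a : ℕ} {ℓ τ ρ L : ℝ} (hn : 2 ≤ n) (hL : 1 ≤ L)
    (hkL : (k : ℝ) ≤ 2 * L) (hτ : 0 ≤ τ) (hρ : 1 ≤ ρ) (hc : (c : ℝ) ≤ ρ + 1)
    (ht : (t : ℝ) ≤ τ + 1) (ha : a = t + (c + k + 2) * n + k) :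
    (a : ℝ) + 9 * k + 9 + ℓ ≤ ℓ + 2 * τ * L + 300 * (ρ + 1) * n * L := by
  have ha' : (a : ℝ) = t + (c + k + 2) * n + k := by exact_mod_cast ha
  have hn2 : (2 : ℝ) ≤ n := by exact_mod_cast hn
  have hnL : (n : ℝ) ≤ n * L := le_mul_of_one_le_right (by positivity) hL
  have hLn : L ≤ n * L := le_mul_of_one_le_left (by positivity) (by linarith)
  have hρn : (n : ℝ) * L ≤ ρ * n * L := by
    rw [mul_assoc]; exact le_mul_of_one_le_left (by positivity) hρ
  have hρL : ρ * n ≤ ρ * n * L := le_mul_of_one_le_right (by positivity) hL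
  have hτL : τ ≤ τ * L := le_mul_of_one_le_right hτ hL
  have hcn : (c : ℝ) * n ≤ (ρ + 1) * n := by gcongr
  have hkn' : (k : ℝ) * n ≤ 2 * L * n := by gcongr
  have hτL0 : 0 ≤ τ * L := by positivity
  rw [ha']
  nlinarith

theorem mainTheorem8 :
    ∃ K : ℝ, 0 < K ∧
      ∀ (n : ℕ) (ℓ τ₁ ρ : ℝ), 2 ≤ n → 0 ≤ ℓ → 0 ≤ τ₁ → 1 ≤ ρ →
      ∀ p w : ℕ, ∃ (p' w' s : ℕ)
        (F : (FanOutInput n (Nat.clog 2 n) w → Bool) → (FanOutOutput (Nat.clog 2 n) w' → Bool)),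
        ComputableWithGates s F ∧
        (s : ℝ) ≤ K * (n * Real.logb 2 n ^ 2 *
          mulComplexity ⌈ℓ + τ₁ * Real.logb 2 n + ρ * n * Real.logb 2 n⌉₊) ∧
        ∀ (x : Fin n → ℂ) (v : ℂ[X]) (input : FanOutInput n (Nat.clog 2 n) w → Bool) (ε : ℝ),
          ε = 2 ^ (-(ℓ + 2 * τ₁ * Real.logb 2 n + 300 * (ρ + 1) * n * Real.logb 2 n)) →
          v.degree < n → v.supNorm ≤ 2 ^ τ₁ → (∀ i, ‖x i‖ ≤ 2 ^ ρ) →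
          (v - polyOfBits p fun b => input (Sum.inl b)).supNorm ≤ ε →
          (∀ t : Node (Nat.clog 2 n),
            (supermodulus x t.1 t.2 - polyOfBits p fun b => input (Sum.inr ⟨t, b⟩)).supNorm ≤ ε) →
          ∀ t : Node (Nat.clog 2 n),
            (fanOut x v (Nat.clog 2 n) t.1 t.2 -
              polyOfBits p' fun b => F input ⟨t, b⟩).supNorm ≤ 2 ^ (-ℓ) := by
  -- The factor 1440 is `180 * 2 * 2 * 2`, from `k ≤ 2 * lg n` used twice and `2 ^ k ≤ 2 * n`; the
  -- bracket is the price of a coefficient operation in units of `mulComplexity N`.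
  refine ⟨1440 * (124 ^ 13 + 50 * 2 ^ 14), by positivity, ?_⟩
  intro n ℓ τ ρ hn hℓ hτ hρ p w₀
  obtain ⟨hL, hkL, hnk, hk2⟩ := clog_two_bounds hn
  set k := Nat.clog 2 n
  set L := Real.logb 2 n
  set N := ⌈ℓ + τ * L + ρ * n * L⌉₊
  set Λ := ℓ + 2 * τ * L + 300 * (ρ + 1) * n * L with hΛ
  have hn2 : (2 : ℝ) ≤ n := by exact_mod_cast hn
  have hΛ0 : 0 ≤ Λ := by positivity
  set c := ⌈ρ⌉₊
  set t := ⌈τ⌉₊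
  set l := ⌈Λ⌉₊
  have hc : (c : ℝ) ≤ ρ + 1 := (Nat.ceil_lt_add_one (by linarith)).le
  have ht : (t : ℝ) ≤ τ + 1 := (Nat.ceil_lt_add_one hτ).le
  have hl : (l : ℝ) ≤ Λ + 1 := (Nat.ceil_lt_add_one hΛ0).le
  -- This is a bit bound for the norm of the scaled `v`: size of the coefficients, scaling by `σ = c
  -- + k + 2` over at most `n` degrees, and number of coefficients.
  set a := t + (c + k + 2) * n + k with ha
  obtain ⟨M, hM, hMle, hdvd⟩ := exists_dvd_two_pow_mul k (2 * (l + (a + k + 4)) + k + 2)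
  have hM13 : 2 * M ≤ 2 ^ 13 * N := le_trans (Nat.mul_le_mul_left 2 hMle)
    (fanOut_precision_le hn hk2 hL hkL hℓ hτ hρ (Nat.le_ceil _) hc ht hl ha)
  -- Thirteen doublings lead from `N` past `2 * M`, and the linear term is absorbed by `N ≤ 2 *
  -- mulComplexity N`.
  have hκ : mulComplexity (2 * M) + 50 * M ≤ (124 ^ 13 + 50 * 2 ^ 14) * mulComplexity N := by
    have h1 := (mulComplexity_mono hM13).trans (mulComplexity_two_pow_mul_le 13 N)
    have h2 := le_two_mul_mulComplexity N
    rw [add_mul]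
    refine Nat.add_le_add h1 ?_
    omega
  have hc2 : (2 : ℝ) ^ ρ ≤ 2 ^ c := by
    rw [← Real.rpow_natCast]
    exact Real.rpow_le_rpow_of_exponent_le one_le_two (Nat.le_ceil ρ)
  have ht2 : (2 : ℝ) ^ τ ≤ 2 ^ t := by
    rw [← Real.rpow_natCast]
    exact Real.rpow_le_rpow_of_exponent_le one_le_two (Nat.le_ceil τ)
  have hr : (2 : ℝ) ^ k * (2 ^ ρ / 2 ^ (c + k + 2)) ≤ 1 / 4 := by
    rw [← mul_div_assoc, div_le_iff₀ (by positivity)]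
    calc _ ≤ (2 : ℝ) ^ k * 2 ^ c := by gcongr
      _ = _ := by ring
  have hT : (2 : ℝ) ^ k * (2 ^ τ * 2 ^ ((c + k + 2) * n)) ≤ 2 ^ a := by
    calc _ ≤ (2 : ℝ) ^ k * (2 ^ t * 2 ^ ((c + k + 2) * n)) := by gcongr
      _ = _ := by rw [ha, pow_add, pow_add]; ring
  have hP : ((2 : ℝ) ^ l)⁻¹ ≤ 2 ^ (-Λ) := by
    rw [← Real.rpow_natCast, ← Real.rpow_neg zero_le_two]
    exact Real.rpow_le_rpow_of_exponent_le one_le_two (neg_le_neg (Nat.le_ceil Λ))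
  have hθ : (2 : ℝ) ^ (a + 9 * k + 9) * 2 ^ (-Λ) ≤ 2 ^ (-ℓ) := by
    rw [← Real.rpow_natCast, ← Real.rpow_add two_pos]
    refine Real.rpow_le_rpow_of_exponent_le one_le_two ?_
    have := fanOut_loss_le hn hL hkL hτ hρ (ℓ := ℓ) hc ht ha
    push_cast
    linarith
  -- In `σ = c + k + 2`, the term `c` brings the knots into the unit disc and `k + 2` gives `2 ^ k *
  -- a ≤ 1 / 4`. The integer part gets `k` bits beyond `a` for the doubling of norms at each level
  -- and four for slack.
  obtain ⟨p', w', F, hF, hFs⟩ := exists_fanOutFunction (n := n) (k := k) (σ := c + k + 2) (β := a)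
    (P := l) (b := a + k + 4) (w := l + (a + k + 4)) hκ hM hdvd le_rfl le_rfl hnk
    (by positivity) hr (by positivity) hT (by omega) hP hθ
    (Real.rpow_le_one_of_one_le_of_nonpos one_le_two (by linarith)) p w₀
  refine ⟨p', w', _, F, hF, ?_, fun x v input ε hε => ?_⟩
  · have h2 : ((2 ^ k : ℕ) : ℝ) ≤ 2 * n := by exact_mod_cast hk2
    push_cast at h2 ⊢
    have h3 : (k : ℝ) * k * 2 ^ k ≤ (2 * L) * (2 * L) * (2 * n) := by gcongr
    calc _ = 180 * ((k : ℝ) * k * 2 ^ k) * ((124 ^ 13 + 50 * 2 ^ 14) * mulComplexity N) := by ring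
      _ ≤ 180 * ((2 * L) * (2 * L) * (2 * n)) * ((124 ^ 13 + 50 * 2 ^ 14) * mulComplexity N) := by
        gcongr
      _ = _ := by ring
  · subst hε
    exact hFs x v input
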